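/- Conventions. All manifolds are real, $C^\infty$, Hausdorff, paracompact and connected, and maps are $C^\infty$. Let $\pi\colon E\to M$ be a fibre bundle with $\dim M=m>1$ and $n$-dimensional fibres, $\eta$ a volume form on $M$, and $\pi^1\colon J^1\pi\to E$ the first jet bundle; a point $\bar y\in J^1\pi$ over $y\in E$ is identified with a linear map $\bar y\colon T_{\pi(y)}M\to T_yE$ such that $T_y\pi\circ\bar y=\mathrm{id}$. Let $L\in C^\infty(J^1\pi)$, with Lagrangian density $\mathcal L=L\,\eta$, and let $\Theta_{\mathcal L}$ be its Poincaré–Cartan $m$-form: in adapted coordinates $(x^\nu,y^A,v^A_\nu)$ with $\eta=d^mx$, $$\Theta_{\mathcal L}=\frac{\partial L}{\partial v^A_\nu}\,dy^A\wedge d^{m-1}x_\nu-\Big(\frac{\partial L}{\partial v^A_\nu}v^A_\nu-L\Big)d^mx .$$ Let $\mathcal M\pi=\Lambda^m_2T^*E$ be the bundle of $m$-forms on $E$ that vanish when two of their arguments are $\pi$-vertical, $\Theta$ its tautological $m$-form, $\Omega=-d\Theta$, and $\mu\colon\mathcal M\pi\to J^1\pi^*=\mathcal M\pi/\pi^*\Lambda^mT^*M$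 the projection. The extended Legendre map $\widetilde{F\mathcal L}\colon J^1\pi\to\mathcal M\pi$ covers $\mathrm{id}_E$ and is given by $\widetilde{F\mathcal L}(\bar y)(Z_1,\dots,Z_m)=\Theta_{\mathcal L}(\bar Z_1,\dots,\bar Z_m)$, where $\bar Z_i\in T_{\bar y}J^1\pi$ are any vectors with $T\pi^1(\bar Z_i)=Z_i$; the Legendre map is $F\mathcal L=\mu\circ\widetilde{F\mathcal L}$. Assume that $\mathcal L$ is almost-regular: $\mathcal P=F\mathcal L(J^1\pi)$ is a closed (embedded) submanifold of $J^1\pi^*$, $F\mathcal L\colon J^1\pi\to\mathcal P$ is a submersion, and the fibres $F\mathcal L^{-1}(F\mathcal L(\bar y))$, $\bar y\in J^1\pi$, are connected. Let $\kappa\colon\mathcal P\to M$ be the natural projection. Proposition. There is a unique map $\tilde h\colon\mathcal P\to\mathcal M\pi$ with $\tilde h\circ F\mathcal L=\widetilde{F\mathcal L}$; it is smooth and $\mu\circ\tilde h$ is the inclusion of $\mathcal P$. Put $\Omega^0_h=\tilde h^*\Omega\in\Omega^{m+1}(\mathcal P)$. Let $\nabla_0^*$ be a connection on $\kappa$, i.e.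 a smooth family of linear maps $\nabla_p\colon T_{\kappa(p)}M\to T_p\mathcal P$, $p\in\mathcal P$, with $T_p\kappa\circ\nabla_p=\mathrm{id}$, and let $Y^{\nabla_0^*}_\eta=\Lambda^m\nabla_0^*(Z)$, where $Z$ is the $m$-vector field on $M$ with $\eta(Z)=1$. Put $\omega_0^*=\kappa^*\eta$ and $$(\gamma_h)^{\nabla_0^*}_\eta=i\big(Y^{\nabla_0^*}_\eta\big)\Omega^0_h,\qquad i(w_1\wedge\dots\wedge w_m)\alpha=\alpha(w_1,\dots,w_m,\cdot).$$ Then $(\gamma_h)^{\nabla_0^*}_\eta$ is a smooth $1$-form on $\mathcal P$, and there is a smooth $(m+1)$-form $\Omega_h^{\nabla_0^*}$ on $\mathcal P$ such that $$\Omega^0_h=\Omega_h^{\nabla_0^*}+\omega_0^*\wedge(\gamma_h)^{\nabla_0^*}_\eta$$ and $\Omega_h^{\nabla_0^*}$ has bidegree $(m-1,2)$ with respect to the splitting $T\mathcal P=\operatorname{im}\nabla_0^*\oplus\ker T\kappa$; that is, it vanishes on any $m+1$ tangent vectors at a point each of which is horizontal or vertical, unless precisely $m-1$ of them are horizontal and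 the other two vertical. -/

import Mathlib

open Set Topology Manifold
open scoped ContDiff Manifold

set_option maxSynthPendingDepth 3
set_option linter.unusedSectionVars false

noncomputable section

/-- Euclidean space `ℝᵏ`. -/
abbrev Euc (k : ℕ) : Type := EuclideanSpace ℝ (Fin k)

section LinearAlgebra

variable {V W V' W' : Type*} [AddCommGroup V] [Module ℝ V] [TopologicalSpace V]
  [AddCommGroup W] [Module ℝ W] [TopologicalSpace W]
  [AddCommGroup V'] [Module ℝ V'] [TopologicalSpace V']
  [AddCommGroup W'] [Module ℝ W'] [TopologicalSpace W']

/-- For a linear map `p : V → W`, the `k`-forms on `V` that vanish as soon as two of their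
arguments lie in `ker p`. -/
def lambdaTwo (p : V →L[ℝ] W) (k : ℕ) : Submodule ℝ (V [⋀^Fin k]→L[ℝ] ℝ) where
  carrier := {α | ∀ (w : Fin k → V) (i j : Fin k), i ≠ j → p (w i) = 0 → p (w j) = 0 → α w = 0}
  add_mem' := by
    intro α β hα hβ w i j hij hi hj
    simp [hα w i j hij hi hj, hβ w i j hij hi hj]
  zero_mem' := by intro w i j _ _ _; rfl
  smul_mem' := by
    intro c α hα w i j hij hi hj
    simp [hα w i j hij hi hj]

/-- The forms `p^* β`, `β ∈ Λᵏ W^*`, as a subspace of `lambdaTwo p k`. -/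
def basicForms (p : V →L[ℝ] W) (k : ℕ) : Submodule ℝ (lambdaTwo p k) :=
  (LinearMap.range (ContinuousAlternatingMap.compContinuousLinearMapCLM
    (ι := Fin k) (F := ℝ) p).toLinearMap).submoduleOf (lambdaTwo p k)

/-- Pull-back of forms in `lambdaTwo` along a map of pairs. -/
def lambdaTwoPullback {p : V →L[ℝ] W} {p' : V' →L[ℝ] W'} (A : V →L[ℝ] V') (B : W →L[ℝ] W')
    (h : p'.comp A = B.comp p) (k : ℕ) : lambdaTwo p' k →L[ℝ] lambdaTwo p k :=
  ((ContinuousAlternatingMap.compContinuousLinearMapCLM (ι := Fin k) (F := ℝ) A).comp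
    (lambdaTwo p' k).subtypeL).codRestrict (lambdaTwo p k) (by
      intro α w i j hij hi hj
      refine α.2 (A ∘ w) i j hij ?_ ?_
      · exact (DFunLike.congr_fun h (w i)).trans (by simp [hi])
      · exact (DFunLike.congr_fun h (w j)).trans (by simp [hj]))

@[simp] lemma lambdaTwoPullback_coe {p : V →L[ℝ] W} {p' : V' →L[ℝ] W'} (A : V →L[ℝ] V')
    (B : W →L[ℝ] W') (h : p'.comp A = B.comp p) (k : ℕ) (α : lambdaTwo p' k) :
    (lambdaTwoPullback A B h k α : V [⋀^Fin k]→L[ℝ] ℝ) = α.1.compContinuousLinearMap A := rfl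

lemma basicForms_le_comap {p : V →L[ℝ] W} {p' : V' →L[ℝ] W'} (A : V →L[ℝ] V')
    (B : W →L[ℝ] W') (h : p'.comp A = B.comp p) (k : ℕ) :
    basicForms p' k ≤ (basicForms p k).comap (lambdaTwoPullback A B h k).toLinearMap := by
  rintro α ⟨β, hβ⟩
  refine ⟨β.compContinuousLinearMap B, ?_⟩
  ext w
  have h2 : ∀ v, p' (A v) = B (p v) := fun v => DFunLike.congr_fun h v
  have h1 : β (fun i => p' (A (w i))) = α.1 (fun i => A (w i)) :=
    DFunLike.congr_fun hβ (fun i => A (w i))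
  simp only [h2] at h1
  exact h1

/-- The map induced by `lambdaTwoPullback` on the quotients by the basic forms. -/
def lambdaTwoQuotPullback {p : V →L[ℝ] W} {p' : V' →L[ℝ] W'} (A : V →L[ℝ] V') (B : W →L[ℝ] W')
    (h : p'.comp A = B.comp p) (k : ℕ) :
    (lambdaTwo p' k ⧸ basicForms p' k) →L[ℝ] (lambdaTwo p k ⧸ basicForms p k) :=
  (basicForms p' k).liftQL ((basicForms p k).mkQL.comp (lambdaTwoPullback A B h k)) (by
    intro α hα
    have := basicForms_le_comap A B h k hα
    simpa using this)

@[simp] lemma lambdaTwoQuotPullback_mk {p : V →L[ℝ] W} {p' : V' →L[ℝ] W'} (A : V →L[ℝ] V')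
    (B : W →L[ℝ] W') (h : p'.comp A = B.comp p) (k : ℕ) (α : lambdaTwo p' k) :
    lambdaTwoQuotPullback A B h k ((basicForms p' k).mkQ α) =
      (basicForms p k).mkQ (lambdaTwoPullback A B h k α) := rfl

end LinearAlgebra

section Model

instance finiteDimensional_continuousAlternatingMap {V : Type*} [NormedAddCommGroup V]
    [NormedSpace ℝ V] [FiniteDimensional ℝ V] (k : ℕ) :
    FiniteDimensional ℝ (V [⋀^Fin k]→L[ℝ] ℝ) := by
  let f : (V [⋀^Fin k]→L[ℝ] ℝ) →ₗ[ℝ] MultilinearMap ℝ (fun _ : Fin k => V) ℝ :=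
    { toFun := fun α => α.toMultilinearMap
      map_add' := fun _ _ => rfl
      map_smul' := fun _ _ => rfl }
  refine FiniteDimensional.of_injective f ?_
  intro α β h
  ext w
  exact DFunLike.congr_fun h w

variable (m n : ℕ)

/-- Model fibre of the extended multimomentum bundle. -/
abbrev ModelMM : Type := lambdaTwo (ContinuousLinearMap.fst ℝ (Euc m) (Euc n)) m

/-- The basic forms inside `ModelMM m n`. -/
abbrev modelBasic : Submodule ℝ (ModelMM m n) :=
  basicForms (ContinuousLinearMap.fst ℝ (Euc m) (Euc n)) m

instance isClosed_modelBasic : IsClosed (modelBasic m n : Set (ModelMM m n)) :=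
  Submodule.closed_of_finiteDimensional _

/-- Model fibre of the restricted multimomentum bundle. -/
abbrev ModelRMM : Type := ModelMM m n ⧸ modelBasic m n

instance : NormedAddCommGroup (ModelRMM m n) :=
  Submodule.Quotient.normedAddCommGroup (modelBasic m n)
instance : NormedSpace ℝ (ModelRMM m n) :=
  Submodule.Quotient.normedSpace (modelBasic m n) ℝ
instance : FiniteDimensional ℝ (ModelRMM m n) :=
  Module.Finite.quotient ℝ (modelBasic m n)
instance : T2Space (ModelRMM m n) :=
  haveI : T3Space (ModelRMM m n) := Submodule.t3_quotient_of_isClosed (modelBasic m n)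
  T3Space.t25Space.t2Space

/-- A continuous linear projection onto `ModelMM m n`. -/
def modelRetract : ((Euc m × Euc n) [⋀^Fin m]→L[ℝ] ℝ) →L[ℝ] ModelMM m n :=
  LinearMap.toContinuousLinearMap (Classical.choose
    (LinearMap.exists_leftInverse_of_injective (lambdaTwo (ContinuousLinearMap.fst ℝ (Euc m) (Euc n)) m).subtype
      (by simp)))

theorem modelRetract_apply (α : ModelMM m n) : modelRetract m n α.1 = α :=
  DFunLike.congr_fun (Classical.choose_spec (LinearMap.exists_leftInverse_of_injective
    (lambdaTwo (ContinuousLinearMap.fst ℝ (Euc m) (Euc n)) m).subtype (by simp))) α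

theorem exists_modelSection : ∃ s : ModelRMM m n →ₗ[ℝ] ModelMM m n,
    (modelBasic m n).mkQ ∘ₗ s = LinearMap.id :=
  (modelBasic m n).mkQ.exists_rightInverse_of_surjective (Submodule.range_mkQ _)

/-- A linear section of the projection `ModelMM → ModelRMM`. -/
def modelSection : ModelRMM m n →L[ℝ] ModelMM m n :=
  LinearMap.toContinuousLinearMap (Classical.choose (exists_modelSection m n))

theorem modelSection_spec (y : ModelRMM m n) : (modelBasic m n).mkQ (modelSection m n y) = y :=
  DFunLike.congr_fun (Classical.choose_spec (exists_modelSection m n)) y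

end Model

section FibreBundle

universe uM uE

variable {M : Type uM} [TopologicalSpace M] {E : Type uE} [TopologicalSpace E]

/-- `q : E → M` is a smooth fibre bundle with base of dimension `m` and fibres of dimension `n`:
`q` is smooth, and there are a smooth `n`-manifold `F` and smooth local trivialisations
`q⁻¹(U) ≅ U × F` over open sets `U` covering `M`. -/
class IsSmoothFibreBundle (m n : ℕ) [ChartedSpace (Euc m) M] [ChartedSpace (Euc (m + n)) E]
    (q : E → M) : Prop where
  contMDiff : ContMDiff (𝓡 (m + n)) (𝓡 m) ∞ q
  locally_trivial : ∃ (F : Type uE) (_ : TopologicalSpace F) (_ : ChartedSpace (Euc n) F)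
    (_ : IsManifold (𝓡 n) ∞ F), ∀ x : M, ∃ t : Bundle.Trivialization F q, x ∈ t.baseSet ∧
      ContMDiffOn (𝓡 (m + n)) ((𝓡 m).prod (𝓡 n)) ∞ t t.source ∧
      ContMDiffOn ((𝓡 m).prod (𝓡 n)) (𝓡 (m + n)) ∞ t.toOpenPartialHomeomorph.symm t.target

variable (m n : ℕ) [ChartedSpace (Euc m) M] [ChartedSpace (Euc (m + n)) E] (q : E → M)

/-- An adapted (fibred) chart `(xᵅ, yᴬ)` of `E`, together with the chart `(xᵅ)` of `M` below it. -/
structure AdaptedChart where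
  tot : OpenPartialHomeomorph E (Euc m × Euc n)
  base : OpenPartialHomeomorph M (Euc m)
  contMDiffOn_tot : ContMDiffOn (𝓡 (m + n)) 𝓘(ℝ, Euc m × Euc n) ∞ tot tot.source
  contMDiffOn_tot_symm : ContMDiffOn 𝓘(ℝ, Euc m × Euc n) (𝓡 (m + n)) ∞ tot.symm tot.target
  contMDiffOn_base : ContMDiffOn (𝓡 m) 𝓘(ℝ, Euc m) ∞ base base.source
  contMDiffOn_base_symm : ContMDiffOn 𝓘(ℝ, Euc m) (𝓡 m) ∞ base.symm base.target
  mapsTo : ∀ e ∈ tot.source, q e ∈ base.source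
  fst_tot : ∀ e ∈ tot.source, (tot e).1 = base (q e)

theorem exists_adaptedChart [IsManifold (𝓡 m) ∞ M] [IsSmoothFibreBundle m n q] (e : E) :
    ∃ c : AdaptedChart m n q, e ∈ c.tot.source := by
  obtain ⟨F, _, _, _, h⟩ := IsSmoothFibreBundle.locally_trivial (m := m) (n := n) (q := q)
  obtain ⟨t, hx, ht, ht'⟩ := h (q e)
  have he : e ∈ t.source := t.mem_source.2 hx
  let χ := chartAt (Euc m) (q e)
  let ψ := chartAt (Euc n) (t e).2
  have hχ : ContMDiffOn (𝓡 m) 𝓘(ℝ, Euc m) ∞ χ χ.source := contMDiffOn_chart (I := 𝓡 m)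
  have hχ' : ContMDiffOn 𝓘(ℝ, Euc m) (𝓡 m) ∞ χ.symm χ.target := contMDiffOn_chart_symm (I := 𝓡 m)
  have hψ : ContMDiffOn (𝓡 n) 𝓘(ℝ, Euc n) ∞ ψ ψ.source := contMDiffOn_chart (I := 𝓡 n)
  have hψ' : ContMDiffOn 𝓘(ℝ, Euc n) (𝓡 n) ∞ ψ.symm ψ.target := contMDiffOn_chart_symm (I := 𝓡 n)
  refine ⟨⟨t.toOpenPartialHomeomorph ≫ₕ χ.prod ψ, χ, ?_, ?_, hχ, hχ', ?_, ?_⟩, ?_⟩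
  · have h1 := (hχ.prodMap hψ).comp (ht.mono (t := t.source ∩ t ⁻¹' (χ.source ×ˢ ψ.source)) inter_subset_left) (fun x hx => hx.2)
    rw [modelWithCornersSelf_prod, ← chartedSpaceSelf_prod]
    exact h1.mono (fun x hx => by simpa using hx)
  · have h1 := ht'.comp ((hχ'.prodMap hψ').mono (t := (χ.target ×ˢ ψ.target) ∩
      (Prod.map χ.symm ψ.symm) ⁻¹' t.target) inter_subset_left) (fun x hx => hx.2)
    rw [modelWithCornersSelf_prod, ← chartedSpaceSelf_prod]
    exact h1.mono (fun x hx => by simpa [Prod.map] using hx)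
  · intro e' he'
    simp at he'
    have := t.proj_toFun e' he'.1
    have h2 := he'.2.1
    simpa [← this] using h2
  · intro e' he'
    simp at he'
    have := t.proj_toFun e' he'.1
    simp [← this]
  · have := t.proj_toFun e he
    have h3 : (t e).1 ∈ χ.source := by
      rw [show (t e).1 = q e from this]; exact mem_chart_source _ _
    simp only [OpenPartialHomeomorph.trans_source, OpenPartialHomeomorph.prod_source, mem_inter_iff]
    exact ⟨he, h3, mem_chart_source _ _⟩

namespace AdaptedChart

variable {m n q}
variable (c : AdaptedChart m n q)

/-- The frame of `T_e E` given by an adapted chart, i.e. its differential at `e`. -/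
def frame (e : E) : TangentSpace (𝓡 (m + n)) e →L[ℝ] Euc m × Euc n :=
  mfderiv (𝓡 (m + n)) 𝓘(ℝ, Euc m × Euc n) c.tot e

/-- The frame of `T_x M` given by the base chart. -/
def baseFrame (x : M) : TangentSpace (𝓡 m) x →L[ℝ] Euc m :=
  mfderiv (𝓡 m) 𝓘(ℝ, Euc m) c.base x

theorem tot_mdifferentiable : c.tot.MDifferentiable (𝓡 (m + n)) 𝓘(ℝ, Euc m × Euc n) :=
  ⟨c.contMDiffOn_tot.mdifferentiableOn (by simp), c.contMDiffOn_tot_symm.mdifferentiableOn (by simp)⟩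

theorem base_mdifferentiable : c.base.MDifferentiable (𝓡 m) 𝓘(ℝ, Euc m) :=
  ⟨c.contMDiffOn_base.mdifferentiableOn (by simp),
    c.contMDiffOn_base_symm.mdifferentiableOn (by simp)⟩

theorem frame_isInvertible {e : E} (he : e ∈ c.tot.source) : (c.frame e).IsInvertible :=
  ⟨c.tot_mdifferentiable.mfderiv he, rfl⟩

theorem baseFrame_isInvertible {x : M} (hx : x ∈ c.base.source) : (c.baseFrame x).IsInvertible :=
  ⟨c.base_mdifferentiable.mfderiv hx, rfl⟩

theorem fst_comp_frame [IsSmoothFibreBundle m n q] {e : E} (he : e ∈ c.tot.source) :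
    (ContinuousLinearMap.fst ℝ (Euc m) (Euc n)).comp (c.frame e) =
      (c.baseFrame (q e)).comp (mfderiv (𝓡 (m + n)) (𝓡 m) q e) := by
  have hq : MDifferentiableAt (𝓡 (m + n)) (𝓡 m) q e :=
    (IsSmoothFibreBundle.contMDiff (m := m) (n := n)).mdifferentiable (by simp) e
  have h1 : mfderiv (𝓡 (m + n)) 𝓘(ℝ, Euc m) (c.base ∘ q) e =
      (c.baseFrame (q e)).comp (mfderiv (𝓡 (m + n)) (𝓡 m) q e) :=
    mfderiv_comp e (c.base_mdifferentiable.mdifferentiableAt (c.mapsTo e he)) hq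
  have h2 : mfderiv (𝓡 (m + n)) 𝓘(ℝ, Euc m)
      ((ContinuousLinearMap.fst ℝ (Euc m) (Euc n)) ∘ c.tot) e =
      (ContinuousLinearMap.fst ℝ (Euc m) (Euc n)).comp (c.frame e) := by
    rw [mfderiv_comp (I' := 𝓘(ℝ, Euc m × Euc n)) e
      (ContinuousLinearMap.fst ℝ (Euc m) (Euc n)).mdifferentiableAt
      (c.tot_mdifferentiable.mdifferentiableAt he), ContinuousLinearMap.mfderiv_eq]
    rfl
  rw [← h1, ← h2]
  refine Filter.EventuallyEq.mfderiv_eq ?_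
  filter_upwards [c.tot.open_source.mem_nhds he] with e' he'
  exact c.fst_tot e' he'

theorem mfderiv_comp_coframe [IsSmoothFibreBundle m n q] {e : E} (he : e ∈ c.tot.source) :
    (mfderiv (𝓡 (m + n)) (𝓡 m) q e).comp (c.frame e).inverse =
      (c.baseFrame (q e)).inverse.comp (ContinuousLinearMap.fst ℝ (Euc m) (Euc n)) := by
  have h := c.fst_comp_frame he
  refine ContinuousLinearMap.ext fun v => ?_
  obtain ⟨w, rfl⟩ := (c.frame_isInvertible he).surjective v
  have h3 := DFunLike.congr_fun h w
  simp only [ContinuousLinearMap.comp_apply] at h3 ⊢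
  rw [(c.frame_isInvertible he).inverse_apply_self, h3,
    (c.baseFrame_isInvertible (c.mapsTo e he)).inverse_apply_self]

variable (c' : AdaptedChart m n q)

/-- The change of frames between two adapted charts. -/
def frameChange (e : E) : Euc m × Euc n →L[ℝ] Euc m × Euc n :=
  (c'.frame e).comp (c.frame e).inverse

/-- The change of base frames between two adapted charts. -/
def baseFrameChange (x : M) : Euc m →L[ℝ] Euc m :=
  (c'.baseFrame x).comp (c.baseFrame x).inverse

theorem contMDiffOn_frameChange : ContMDiffOn (𝓡 (m + n)) 𝓘(ℝ, Euc m × Euc n →L[ℝ] Euc m × Euc n) ∞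
    (c.frameChange c') (c.tot.source ∩ c'.tot.source) := by
  set U := (c.tot.symm ≫ₕ c'.tot).source
  have hU : IsOpen U := (c.tot.symm ≫ₕ c'.tot).open_source
  have hs : ContDiffOn ℝ ∞ (c'.tot ∘ c.tot.symm) U := by
    rw [← contMDiffOn_iff_contDiffOn]
    exact c'.contMDiffOn_tot.comp (c.contMDiffOn_tot_symm.mono (by simp [U])) (fun x hx => by simpa [U] using hx.2)
  have hd : ContDiffOn ℝ ∞ (fderiv ℝ (c'.tot ∘ c.tot.symm)) U :=
    hs.fderiv_of_isOpen hU (by simp)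
  have h1 := (contMDiffOn_iff_contDiffOn.2 hd).comp (c.contMDiffOn_tot.mono
    (inter_subset_left (t := c'.tot.source))) (fun x hx => by
      simp [U, hx.1, hx.2])
  refine h1.congr fun e he => ?_
  have hinv := c.frame_isInvertible he.1
  have h2 : (fderiv ℝ (c'.tot ∘ c.tot.symm) (c.tot e)).comp (c.frame e) = c'.frame e := by
    rw [← mfderiv_eq_fderiv]
    have hd' : MDifferentiableAt 𝓘(ℝ, Euc m × Euc n) 𝓘(ℝ, Euc m × Euc n) (c'.tot ∘ c.tot.symm) (c.tot e) :=
      ((hs.differentiableOn (by simp)).differentiableAt (hU.mem_nhds (by simp [U, he.1, he.2]))).mdifferentiableAt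
    have := mfderiv_comp e hd' (c.tot_mdifferentiable.mdifferentiableAt he.1)
    refine this.symm.trans ?_
    refine Filter.EventuallyEq.mfderiv_eq ?_
    filter_upwards [c.tot.open_source.mem_nhds he.1] with e' he'
    simp [he']
  simp only [frameChange, Function.comp_apply, ← h2]
  refine ContinuousLinearMap.ext fun v => ?_
  simp [hinv.self_apply_inverse, ContinuousLinearMap.comp_apply]

theorem fst_comp_frameChange [IsSmoothFibreBundle m n q] {e : E}
    (he : e ∈ c.tot.source ∩ c'.tot.source) :
    (ContinuousLinearMap.fst ℝ (Euc m) (Euc n)).comp (c.frameChange c' e) =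
      (c.baseFrameChange c' (q e)).comp (ContinuousLinearMap.fst ℝ (Euc m) (Euc n)) := by
  rw [frameChange, ← ContinuousLinearMap.comp_assoc, c'.fst_comp_frame he.2,
    ContinuousLinearMap.comp_assoc, c.mfderiv_comp_coframe he.1, baseFrameChange,
    ContinuousLinearMap.comp_assoc]

end AdaptedChart

section Assemble

variable {B : Type*} [TopologicalSpace B] {ι : Type*} {Y : Type*} [NormedAddCommGroup Y]
  [NormedSpace ℝ Y] {X : B → Type*} [∀ b, AddCommGroup (X b)] [∀ b, Module ℝ (X b)]
  [∀ b, TopologicalSpace (X b)]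

/-- A family of linear isomorphisms `X b ≅ Y`, `b ∈ S`, viewed as a pretrivialisation. -/
def linearPretrivialization (S : Set B) (hS : IsOpen S) (f : ∀ b, X b →L[ℝ] Y)
    (g : ∀ b, Y →L[ℝ] X b) (hgf : ∀ b ∈ S, ∀ v, g b (f b v) = v)
    (hfg : ∀ b ∈ S, ∀ y, f b (g b y) = y) :
    Bundle.Pretrivialization Y (Bundle.TotalSpace.proj : Bundle.TotalSpace Y X → B) where
  toFun p := (p.1, f p.1 p.2)
  invFun p := ⟨p.1, g p.1 p.2⟩
  source := Bundle.TotalSpace.proj ⁻¹' S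
  target := S ×ˢ univ
  map_source' := fun p hp => ⟨hp, mem_univ _⟩
  map_target' := fun p hp => hp.1
  left_inv' := by
    rintro ⟨b, v⟩ hb
    simp only [hgf b hb v]
  right_inv' := by
    rintro ⟨b, y⟩ hb
    simp only [hfg b hb.1 y]
  open_target := hS.prod isOpen_univ
  baseSet := S
  open_baseSet := hS
  source_eq := rfl
  target_eq := rfl
  proj_toFun _ _ := rfl

/-- The vector prebundle assembled from families of linear isomorphisms `X b ≅ Y` with continuous
coordinate changes. -/
def assembledPrebundle (S : ι → Set B) (hS : ∀ i, IsOpen (S i)) (f : ι → ∀ b, X b →L[ℝ] Y)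
    (g : ι → ∀ b, Y →L[ℝ] X b) (hgf : ∀ i, ∀ b ∈ S i, ∀ v, g i b (f i b v) = v)
    (hfg : ∀ i, ∀ b ∈ S i, ∀ y, f i b (g i b y) = y) (i₀ : B → ι) (hi₀ : ∀ b, b ∈ S (i₀ b))
    (hc : ∀ i j, ∃ T : B → Y →L[ℝ] Y, ContinuousOn T (S i ∩ S j) ∧
      ∀ b ∈ S i ∩ S j, ∀ y, T b y = f j b (g i b y)) : VectorPrebundle ℝ Y X where
  pretrivializationAtlas := range fun i =>
    linearPretrivialization (S i) (hS i) (f i) (g i) (hgf i) (hfg i)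
  pretrivialization_linear' := by
    rintro _ ⟨i, rfl⟩
    exact ⟨fun b _ => ⟨(f i b).map_add, (f i b).map_smul⟩⟩
  pretrivializationAt b :=
    linearPretrivialization (S (i₀ b)) (hS _) (f (i₀ b)) (g (i₀ b)) (hgf _) (hfg _)
  mem_base_pretrivializationAt := hi₀
  pretrivialization_mem_atlas b := ⟨i₀ b, rfl⟩
  exists_coordChange := by
    rintro _ ⟨i, rfl⟩ _ ⟨j, rfl⟩
    obtain ⟨T, hT, hT'⟩ := hc i j
    refine ⟨T, hT, fun b hb y => ?_⟩
    rw [Bundle.Pretrivialization.symm_apply _ hb.1]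
    exact hT' b hb y
  totalSpaceMk_isInducing b := by
    have h : IsEmbedding (f (i₀ b) b) :=
      Function.LeftInverse.isEmbedding (hgf _ b (hi₀ b)) (g (i₀ b) b).continuous
        (f (i₀ b) b).continuous
    exact isInducing_const_prod.2 h.isInducing

end Assemble

section Bundles

/-- The fibre `Λ₂ᵐ T_e^* E` of `𝓜π` at `e`: the `m`-forms on `T_e E` that vanish when contracted
with two vertical vectors. -/
def MMFibre (e : E) : Type := lambdaTwo (mfderiv (𝓡 (m + n)) (𝓡 m) q e) m

instance (e : E) : AddCommGroup (MMFibre m n q e) :=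
  inferInstanceAs (AddCommGroup (lambdaTwo (mfderiv (𝓡 (m + n)) (𝓡 m) q e) m))
instance (e : E) : Module ℝ (MMFibre m n q e) :=
  inferInstanceAs (Module ℝ (lambdaTwo (mfderiv (𝓡 (m + n)) (𝓡 m) q e) m))
instance (e : E) : TopologicalSpace (MMFibre m n q e) :=
  inferInstanceAs (TopologicalSpace (lambdaTwo (mfderiv (𝓡 (m + n)) (𝓡 m) q e) m))

/-- The fibre `Λ₂ᵐ T_e^* E / Λᵐ T_{π(e)}^* M` of `J¹π^*` at `e`. -/
def RMMFibre (e : E) : Type :=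
  lambdaTwo (mfderiv (𝓡 (m + n)) (𝓡 m) q e) m ⧸ basicForms (mfderiv (𝓡 (m + n)) (𝓡 m) q e) m

instance (e : E) : AddCommGroup (RMMFibre m n q e) :=
  inferInstanceAs (AddCommGroup (lambdaTwo (mfderiv (𝓡 (m + n)) (𝓡 m) q e) m ⧸
    basicForms (mfderiv (𝓡 (m + n)) (𝓡 m) q e) m))
instance (e : E) : Module ℝ (RMMFibre m n q e) :=
  inferInstanceAs (Module ℝ (lambdaTwo (mfderiv (𝓡 (m + n)) (𝓡 m) q e) m ⧸
    basicForms (mfderiv (𝓡 (m + n)) (𝓡 m) q e) m))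
instance (e : E) : TopologicalSpace (RMMFibre m n q e) :=
  inferInstanceAs (TopologicalSpace (lambdaTwo (mfderiv (𝓡 (m + n)) (𝓡 m) q e) m ⧸
    basicForms (mfderiv (𝓡 (m + n)) (𝓡 m) q e) m))

variable {m n q}
variable [IsSmoothFibreBundle m n q]

open Classical in
/-- The coordinates of elements of `𝓜π` in an adapted chart. -/
def AdaptedChart.mmCoord (c : AdaptedChart m n q) (e : E) : MMFibre m n q e →L[ℝ] ModelMM m n :=
  if h : e ∈ c.tot.source then
    lambdaTwoPullback (c.frame e).inverse (c.baseFrame (q e)).inverse (c.mfderiv_comp_coframe h) m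
  else 0

open Classical in
/-- The inverse of `mmCoord`. -/
def AdaptedChart.mmCoordSymm (c : AdaptedChart m n q) (e : E) :
    ModelMM m n →L[ℝ] MMFibre m n q e :=
  if h : e ∈ c.tot.source then
    lambdaTwoPullback (c.frame e) (c.baseFrame (q e)) (c.fst_comp_frame h) m
  else 0

open Classical in
/-- The coordinates of elements of `J¹π^*` in an adapted chart. -/
def AdaptedChart.rmmCoord (c : AdaptedChart m n q) (e : E) : RMMFibre m n q e →L[ℝ] ModelRMM m n :=
  if h : e ∈ c.tot.source then
    lambdaTwoQuotPullback (c.frame e).inverse (c.baseFrame (q e)).inverse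
      (c.mfderiv_comp_coframe h) m
  else 0

open Classical in
/-- The inverse of `rmmCoord`. -/
def AdaptedChart.rmmCoordSymm (c : AdaptedChart m n q) (e : E) :
    ModelRMM m n →L[ℝ] RMMFibre m n q e :=
  if h : e ∈ c.tot.source then
    lambdaTwoQuotPullback (c.frame e) (c.baseFrame (q e)) (c.fst_comp_frame h) m
  else 0

section Coord

variable (c c' : AdaptedChart m n q) {e : E}

theorem mmCoord_of_mem (he : e ∈ c.tot.source) : c.mmCoord e =
    lambdaTwoPullback (c.frame e).inverse (c.baseFrame (q e)).inverse
      (c.mfderiv_comp_coframe he) m := dif_pos he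

theorem mmCoordSymm_of_mem (he : e ∈ c.tot.source) : c.mmCoordSymm e =
    lambdaTwoPullback (c.frame e) (c.baseFrame (q e)) (c.fst_comp_frame he) m := dif_pos he

theorem rmmCoord_of_mem (he : e ∈ c.tot.source) : c.rmmCoord e =
    lambdaTwoQuotPullback (c.frame e).inverse (c.baseFrame (q e)).inverse
      (c.mfderiv_comp_coframe he) m := dif_pos he

theorem rmmCoordSymm_of_mem (he : e ∈ c.tot.source) : c.rmmCoordSymm e =
    lambdaTwoQuotPullback (c.frame e) (c.baseFrame (q e)) (c.fst_comp_frame he) m := dif_pos he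

theorem mmCoord_symm (he : e ∈ c.tot.source) (α : MMFibre m n q e) :
    c.mmCoordSymm e (c.mmCoord e α) = α := by
  rw [mmCoord_of_mem c he, mmCoordSymm_of_mem c he]
  refine Subtype.ext (ContinuousAlternatingMap.ext fun w => ?_)
  refine congrArg α.1 (funext fun i => ?_)
  exact (c.frame_isInvertible he).inverse_apply_self _

theorem mmCoord_apply (he : e ∈ c.tot.source) (y : ModelMM m n) :
    c.mmCoord e (c.mmCoordSymm e y) = y := by
  rw [mmCoord_of_mem c he, mmCoordSymm_of_mem c he]
  refine Subtype.ext (ContinuousAlternatingMap.ext fun w => ?_)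
  refine congrArg y.1 (funext fun i => ?_)
  exact (c.frame_isInvertible he).self_apply_inverse _

theorem rmmCoordSymm_mkQ (he : e ∈ c.tot.source) (y : ModelMM m n) :
    c.rmmCoordSymm e ((modelBasic m n).mkQ y) =
      (basicForms (mfderiv (𝓡 (m + n)) (𝓡 m) q e) m).mkQ (c.mmCoordSymm e y) := by
  rw [rmmCoordSymm_of_mem c he, mmCoordSymm_of_mem c he]
  exact lambdaTwoQuotPullback_mk _ _ _ _ _

theorem rmmCoord_mkQ (he : e ∈ c.tot.source) (α : MMFibre m n q e) :
    c.rmmCoord e ((basicForms (mfderiv (𝓡 (m + n)) (𝓡 m) q e) m).mkQ α) =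
      (modelBasic m n).mkQ (c.mmCoord e α) := by
  rw [rmmCoord_of_mem c he, mmCoord_of_mem c he]
  exact lambdaTwoQuotPullback_mk _ _ _ _ _

theorem rmmCoord_symm (he : e ∈ c.tot.source) (α : RMMFibre m n q e) :
    c.rmmCoordSymm e (c.rmmCoord e α) = α := by
  obtain ⟨β, rfl⟩ := Submodule.mkQ_surjective _ α
  refine (congrArg _ (rmmCoord_mkQ c he β)).trans ?_
  exact (rmmCoordSymm_mkQ c he _).trans (congrArg _ (mmCoord_symm c he β))

theorem rmmCoord_apply (he : e ∈ c.tot.source) (y : ModelRMM m n) :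
    c.rmmCoord e (c.rmmCoordSymm e y) = y := by
  obtain ⟨z, rfl⟩ := Submodule.mkQ_surjective _ y
  refine (congrArg _ (rmmCoordSymm_mkQ c he z)).trans ?_
  exact (rmmCoord_mkQ c he _).trans (congrArg _ (mmCoord_apply c he z))

/-- The coordinate change of `𝓜π`. -/
def mmChange (e : E) : ModelMM m n →L[ℝ] ModelMM m n :=
  (modelRetract m n).comp ((ContinuousAlternatingMap.compContinuousLinearMapCLM
    (c'.frameChange c e)).comp (lambdaTwo _ m).subtypeL)

theorem mmChange_apply (he : e ∈ c.tot.source ∩ c'.tot.source) (y : ModelMM m n) :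
    mmChange c c' e y = c'.mmCoord e (c.mmCoordSymm e y) := by
  have h : (ContinuousAlternatingMap.compContinuousLinearMapCLM
    (c'.frameChange c e)) y.1 = (c'.mmCoord e (c.mmCoordSymm e y)).1 := by
    rw [mmCoord_of_mem c' he.2, mmCoordSymm_of_mem c he.1]
    rfl
  refine (congrArg (modelRetract m n) h).trans ?_
  exact modelRetract_apply m n _

theorem continuousOn_mmChange :
    ContinuousOn (mmChange c c') (c.tot.source ∩ c'.tot.source) := by
  have h0 : ContinuousOn (c'.frameChange c) (c.tot.source ∩ c'.tot.source) := by
    rw [inter_comm]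
    exact (c'.contMDiffOn_frameChange c).continuousOn
  have h1 : ContinuousOn (fun e => (ContinuousAlternatingMap.compContinuousLinearMapCLM
      (c'.frameChange c e) : ((Euc m × Euc n) [⋀^Fin m]→L[ℝ] ℝ) →L[ℝ]
        ((Euc m × Euc n) [⋀^Fin m]→L[ℝ] ℝ))) (c.tot.source ∩ c'.tot.source) :=
    ContinuousAlternatingMap.continuous_compContinuousLinearMapCLM.comp_continuousOn h0
  exact continuousOn_const.clm_comp (h1.clm_comp continuousOn_const)

/-- The coordinate change of `J¹π^*`. -/
def rmmChange (e : E) : ModelRMM m n →L[ℝ] ModelRMM m n :=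
  (modelBasic m n).mkQL.comp ((mmChange c c' e).comp (modelSection m n))

theorem rmmChange_apply (he : e ∈ c.tot.source ∩ c'.tot.source) (y : ModelRMM m n) :
    rmmChange c c' e y = c'.rmmCoord e (c.rmmCoordSymm e y) := by
  conv_rhs => rw [← modelSection_spec m n y]
  refine (congrArg (modelBasic m n).mkQ (mmChange_apply c c' he _)).trans ?_
  refine (rmmCoord_mkQ c' he.2 _).symm.trans (congrArg _ ?_)
  exact (rmmCoordSymm_mkQ c he.1 _).symm

theorem continuousOn_rmmChange :
    ContinuousOn (rmmChange c c') (c.tot.source ∩ c'.tot.source) :=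
  continuousOn_const.clm_comp ((continuousOn_mmChange c c').clm_comp continuousOn_const)

end Coord


variable (m n q)
variable [IsManifold (𝓡 m) ∞ M]

/-- An adapted chart around `e`. -/
def adaptedChartAt (e : E) : AdaptedChart m n q := Classical.choose (exists_adaptedChart m n q e)

theorem mem_adaptedChartAt (e : E) : e ∈ (adaptedChartAt m n q e).tot.source :=
  Classical.choose_spec (exists_adaptedChart m n q e)

/-- The vector bundle structure of `𝓜π = Λ₂ᵐ T^*E`. -/
def mmPrebundle : VectorPrebundle ℝ (ModelMM m n) (MMFibre m n q) :=
  assembledPrebundle (ι := AdaptedChart m n q) (fun c => c.tot.source) (fun c => c.tot.open_source)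
    (fun c => c.mmCoord) (fun c => c.mmCoordSymm) (fun c _ he v => mmCoord_symm c he v)
    (fun c _ he y => mmCoord_apply c he y) (adaptedChartAt m n q) (mem_adaptedChartAt m n q)
    (fun c c' => ⟨mmChange c c', continuousOn_mmChange c c', fun _ he y =>
      mmChange_apply c c' he y⟩)

/-- The vector bundle structure of `J¹π^* = Λ₂ᵐ T^*E / π^*Λᵐ T^*M`. -/
def rmmPrebundle : VectorPrebundle ℝ (ModelRMM m n) (RMMFibre m n q) :=
  assembledPrebundle (ι := AdaptedChart m n q) (fun c => c.tot.source) (fun c => c.tot.open_source)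
    (fun c => c.rmmCoord) (fun c => c.rmmCoordSymm) (fun c _ he v => rmmCoord_symm c he v)
    (fun c _ he y => rmmCoord_apply c he y) (adaptedChartAt m n q) (mem_adaptedChartAt m n q)
    (fun c c' => ⟨rmmChange c c', continuousOn_rmmChange c c', fun _ he y =>
      rmmChange_apply c c' he y⟩)

/-- The extended multimomentum bundle `𝓜π`. -/
abbrev MM : Type _ := Bundle.TotalSpace (ModelMM m n) (MMFibre m n q)

/-- The restricted multimomentum bundle `J¹π^*`. -/
abbrev RMM : Type _ := Bundle.TotalSpace (ModelRMM m n) (RMMFibre m n q)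

instance : TopologicalSpace (MM m n q) := (mmPrebundle m n q).totalSpaceTopology
instance : FiberBundle (ModelMM m n) (MMFibre m n q) := (mmPrebundle m n q).toFiberBundle
instance : VectorBundle ℝ (ModelMM m n) (MMFibre m n q) := (mmPrebundle m n q).toVectorBundle

instance : TopologicalSpace (RMM m n q) := (rmmPrebundle m n q).totalSpaceTopology
instance : FiberBundle (ModelRMM m n) (RMMFibre m n q) := (rmmPrebundle m n q).toFiberBundle
instance : VectorBundle ℝ (ModelRMM m n) (RMMFibre m n q) := (rmmPrebundle m n q).toVectorBundle

/-- The model with corners of `𝓜π`. -/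
abbrev modelMM := (𝓡 (m + n)).prod 𝓘(ℝ, ModelMM m n)

/-- The model with corners of `J¹π^*`. -/
abbrev modelRMM := (𝓡 (m + n)).prod 𝓘(ℝ, ModelRMM m n)

end Bundles

end FibreBundle

section JetBundle

universe uM uE

variable {M : Type uM} [TopologicalSpace M] {E : Type uE} [TopologicalSpace E]
  (m n : ℕ) [ChartedSpace (Euc m) M] [ChartedSpace (Euc (m + n)) E] (q : E → M)

/-- The fibre of `J¹π` at `e`: the jets at `π(e)` of local sections through `e`, identified with
their differentials, i.e. with the linear maps `φ : T_{π(e)} M → T_e E` such that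
`T_e π ∘ φ = id`. -/
def JetFibre (e : E) : Type :=
  {φ : TangentSpace (𝓡 m) (q e) →L[ℝ] TangentSpace (𝓡 (m + n)) e //
    (mfderiv (𝓡 (m + n)) (𝓡 m) q e).comp φ = ContinuousLinearMap.id ℝ (TangentSpace (𝓡 m) (q e))}

instance (e : E) : TopologicalSpace (JetFibre m n q e) :=
  inferInstanceAs (TopologicalSpace
    {φ : TangentSpace (𝓡 m) (q e) →L[ℝ] TangentSpace (𝓡 (m + n)) e //
      (mfderiv (𝓡 (m + n)) (𝓡 m) q e).comp φ =
        ContinuousLinearMap.id ℝ (TangentSpace (𝓡 m) (q e))})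

variable {m n q}

/-- The coordinates `v^A_α` of a jet in an adapted chart. -/
def AdaptedChart.jetCoord (c : AdaptedChart m n q) (e : E) (φ : JetFibre m n q e) :
    Euc m →L[ℝ] Euc n :=
  ((ContinuousLinearMap.snd ℝ (Euc m) (Euc n)).comp (c.frame e)).comp
    (φ.1.comp (c.baseFrame (q e)).inverse)

/-- The graph map `u ↦ (u, v u)`. -/
def graphMap (v : Euc m →L[ℝ] Euc n) : Euc m →L[ℝ] Euc m × Euc n :=
  ContinuousLinearMap.inl ℝ (Euc m) (Euc n) + (ContinuousLinearMap.inr ℝ (Euc m) (Euc n)).comp v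

theorem graphMap_apply (v : Euc m →L[ℝ] Euc n) (u : Euc m) : graphMap v u = (u, v u) := by
  simp [graphMap]

theorem continuous_graphMap : Continuous (graphMap (m := m) (n := n)) :=
  continuous_const.add (continuous_const.clm_comp continuous_id)

variable [IsSmoothFibreBundle m n q] (c c' : AdaptedChart m n q) {e : E}

theorem jetCoordSymm_aux (he : e ∈ c.tot.source) (v : Euc m →L[ℝ] Euc n) :
    (mfderiv (𝓡 (m + n)) (𝓡 m) q e).comp
      ((c.frame e).inverse.comp ((graphMap v).comp (c.baseFrame (q e)))) =
      ContinuousLinearMap.id ℝ (TangentSpace (𝓡 m) (q e)) := by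
  refine ContinuousLinearMap.ext fun w => ?_
  have h := DFunLike.congr_fun (c.mfderiv_comp_coframe he) (graphMap v (c.baseFrame (q e) w))
  refine h.trans ?_
  rw [graphMap_apply]
  exact (c.baseFrame_isInvertible (c.mapsTo e he)).inverse_apply_self w

/-- The jet at `e` with given coordinates in an adapted chart around `e`. -/
def AdaptedChart.jetOfCoord (he : e ∈ c.tot.source) (v : Euc m →L[ℝ] Euc n) : JetFibre m n q e :=
  ⟨(c.frame e).inverse.comp ((graphMap v).comp (c.baseFrame (q e))), jetCoordSymm_aux c he v⟩

theorem jetOfCoord_jetCoord (he : e ∈ c.tot.source) (φ : JetFibre m n q e) :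
    c.jetOfCoord he (c.jetCoord e φ) = φ := by
  refine Subtype.ext (ContinuousLinearMap.ext fun w => ?_)
  have h1 : (c.baseFrame (q e)).inverse (c.baseFrame (q e) w) = w :=
    (c.baseFrame_isInvertible (c.mapsTo e he)).inverse_apply_self w
  have h2 : mfderiv (𝓡 (m + n)) (𝓡 m) q e (φ.1 w) = w := DFunLike.congr_fun φ.2 w
  have h3 : (c.frame e (φ.1 w)).1 = c.baseFrame (q e) w :=
    (DFunLike.congr_fun (c.fst_comp_frame he) (φ.1 w)).trans (congrArg _ h2)
  have h4 : graphMap (c.jetCoord e φ) (c.baseFrame (q e) w) = c.frame e (φ.1 w) := by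
    rw [graphMap_apply]
    refine Prod.ext h3.symm ?_
    change (c.frame e (φ.1 ((c.baseFrame (q e)).inverse (c.baseFrame (q e) w)))).2 = _
    rw [h1]
  refine (congrArg (c.frame e).inverse h4).trans ?_
  exact (c.frame_isInvertible he).inverse_apply_self _

theorem jetCoord_jetOfCoord (he : e ∈ c.tot.source) (v : Euc m →L[ℝ] Euc n) :
    c.jetCoord e (c.jetOfCoord he v) = v := by
  refine ContinuousLinearMap.ext fun u => ?_
  have h1 : c.baseFrame (q e) ((c.baseFrame (q e)).inverse u) = u :=
    (c.baseFrame_isInvertible (c.mapsTo e he)).self_apply_inverse u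
  change (c.frame e ((c.frame e).inverse (graphMap v (c.baseFrame (q e)
    ((c.baseFrame (q e)).inverse u))))).2 = v u
  rw [h1, (c.frame_isInvertible he).self_apply_inverse, graphMap_apply]

/-- The coordinate change of `J¹π`. -/
def jetChange (e : E) (v : Euc m →L[ℝ] Euc n) : Euc m →L[ℝ] Euc n :=
  ((ContinuousLinearMap.snd ℝ (Euc m) (Euc n)).comp (c.frameChange c' e)).comp
    ((graphMap v).comp (((ContinuousLinearMap.fst ℝ (Euc m) (Euc n)).comp
      (c'.frameChange c e)).comp (ContinuousLinearMap.inl ℝ (Euc m) (Euc n))))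

theorem jetChange_apply (he : e ∈ c.tot.source ∩ c'.tot.source) (v : Euc m →L[ℝ] Euc n) :
    jetChange c c' e v = c'.jetCoord e (c.jetOfCoord he.1 v) := by
  refine ContinuousLinearMap.ext fun u => ?_
  have h : (c'.frameChange c e (u, 0)).1 = c.baseFrame (q e) ((c'.baseFrame (q e)).inverse u) :=
    DFunLike.congr_fun (c'.fst_comp_frameChange c he.symm) (u, 0)
  change (c'.frame e ((c.frame e).inverse (graphMap v (c'.frameChange c e (u, 0)).1))).2 = _
  rw [h]
  rfl

theorem continuousOn_jetChange : ContinuousOn (fun p : E × (Euc m →L[ℝ] Euc n) =>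
    jetChange c c' p.1 p.2) ((c.tot.source ∩ c'.tot.source) ×ˢ univ) := by
  have h1 : ContinuousOn (fun p : E × (Euc m →L[ℝ] Euc n) => c.frameChange c' p.1)
      ((c.tot.source ∩ c'.tot.source) ×ˢ univ) :=
    (c.contMDiffOn_frameChange c').continuousOn.comp continuousOn_fst (fun p hp => hp.1)
  have h2 : ContinuousOn (fun p : E × (Euc m →L[ℝ] Euc n) => c'.frameChange c p.1)
      ((c.tot.source ∩ c'.tot.source) ×ˢ univ) :=
    (c'.contMDiffOn_frameChange c).continuousOn.comp continuousOn_fst (fun p hp => hp.1.symm)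
  have h3 : ContinuousOn (fun p : E × (Euc m →L[ℝ] Euc n) => graphMap p.2)
      ((c.tot.source ∩ c'.tot.source) ×ˢ univ) :=
    continuous_graphMap.comp_continuousOn continuousOn_snd
  exact (continuousOn_const.clm_comp h1).clm_comp
    (h3.clm_comp ((continuousOn_const.clm_comp h2).clm_comp continuousOn_const))

variable [IsManifold (𝓡 m) ∞ M]

open Classical in
/-- `jetOfCoord`, extended by a junk value off the domain of the chart. -/
def AdaptedChart.jetCoordSymm (e : E) (v : Euc m →L[ℝ] Euc n) : JetFibre m n q e :=
  if h : e ∈ c.tot.source then c.jetOfCoord h v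
  else (adaptedChartAt m n q e).jetOfCoord (mem_adaptedChartAt m n q e) v

theorem jetCoordSymm_of_mem (he : e ∈ c.tot.source) (v : Euc m →L[ℝ] Euc n) :
    c.jetCoordSymm e v = c.jetOfCoord he v := dif_pos he

theorem continuous_jetCoord : Continuous (c.jetCoord e) := by
  have h : Continuous fun φ : JetFibre m n q e => φ.1 := continuous_subtype_val
  have h1 := (ContinuousLinearMap.precomp (TangentSpace (𝓡 (m + n)) e)
    (c.baseFrame (q e)).inverse).continuous.comp h
  exact (ContinuousLinearMap.postcomp (Euc m) ((ContinuousLinearMap.snd ℝ (Euc m) (Euc n)).comp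
    (c.frame e))).continuous.comp h1

theorem continuous_jetOfCoord (he : e ∈ c.tot.source) : Continuous (c.jetOfCoord he) := by
  refine Continuous.subtype_mk ?_ _
  have h1 := (ContinuousLinearMap.precomp (Euc m × Euc n)
    (c.baseFrame (q e))).continuous.comp (continuous_graphMap (m := m) (n := n))
  exact (ContinuousLinearMap.postcomp (TangentSpace (𝓡 m) (q e))
    (c.frame e).inverse).continuous.comp h1

/-- The pretrivialisation of `J¹π` given by an adapted chart. -/
def jetPretrivialization : Bundle.Pretrivialization (Euc m →L[ℝ] Euc n)
    (Bundle.TotalSpace.proj : Bundle.TotalSpace (Euc m →L[ℝ] Euc n) (JetFibre m n q) → E) where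
  toFun p := (p.1, c.jetCoord p.1 p.2)
  invFun p := ⟨p.1, c.jetCoordSymm p.1 p.2⟩
  source := Bundle.TotalSpace.proj ⁻¹' c.tot.source
  target := c.tot.source ×ˢ univ
  map_source' := fun p hp => ⟨hp, mem_univ _⟩
  map_target' := fun p hp => hp.1
  left_inv' := by
    rintro ⟨b, v⟩ hb
    simp only [jetCoordSymm_of_mem c hb, jetOfCoord_jetCoord c hb v]
  right_inv' := by
    rintro ⟨b, y⟩ hb
    simp only [jetCoordSymm_of_mem c hb.1, jetCoord_jetOfCoord c hb.1 y]
  open_target := c.tot.open_source.prod isOpen_univ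
  baseSet := c.tot.source
  open_baseSet := c.tot.open_source
  source_eq := rfl
  target_eq := rfl
  proj_toFun _ _ := rfl

variable (m n q)

/-- The fibre bundle structure of `J¹π → E`. -/
def jetPrebundle : FiberPrebundle (Euc m →L[ℝ] Euc n) (JetFibre m n q) where
  pretrivializationAtlas := range fun c : AdaptedChart m n q => jetPretrivialization c
  pretrivializationAt e := jetPretrivialization (adaptedChartAt m n q e)
  mem_base_pretrivializationAt := mem_adaptedChartAt m n q
  pretrivialization_mem_atlas e := ⟨adaptedChartAt m n q e, rfl⟩
  continuous_trivChange := by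
    rintro _ ⟨c', rfl⟩ _ ⟨c, rfl⟩
    refine ContinuousOn.congr (f := fun p => (p.1, jetChange c c' p.1 p.2)) ?_ ?_
    · refine ContinuousOn.prodMk continuousOn_fst ((continuousOn_jetChange c c').mono ?_)
      rintro p ⟨h1, h2⟩
      exact ⟨⟨h1.1, h2⟩, mem_univ _⟩
    · rintro p ⟨h1, h2⟩
      refine Prod.ext rfl ?_
      change c'.jetCoord p.1 (c.jetCoordSymm p.1 p.2) = jetChange c c' p.1 p.2
      rw [jetCoordSymm_of_mem c h1.1, jetChange_apply c c' ⟨h1.1, h2⟩]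
  totalSpaceMk_isInducing e := by
    have h : IsEmbedding ((adaptedChartAt m n q e).jetCoord e) :=
      Function.LeftInverse.isEmbedding
        (jetOfCoord_jetCoord (adaptedChartAt m n q e) (mem_adaptedChartAt m n q e))
        (continuous_jetOfCoord _ _) (continuous_jetCoord _)
    exact isInducing_const_prod.2 h.isInducing

/-- The first jet bundle `J¹π`. -/
abbrev J1 : Type _ := Bundle.TotalSpace (Euc m →L[ℝ] Euc n) (JetFibre m n q)

instance : TopologicalSpace (J1 m n q) := (jetPrebundle m n q).totalSpaceTopology
instance : FiberBundle (Euc m →L[ℝ] Euc n) (JetFibre m n q) := (jetPrebundle m n q).toFiberBundle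

/-- The model with corners of `J¹π`. -/
abbrev modelJ1 := (𝓡 (m + n)).prod 𝓘(ℝ, Euc m →L[ℝ] Euc n)

end JetBundle

section Multilinear

variable {V : Type*} [NormedAddCommGroup V] [NormedSpace ℝ V] {k : ℕ}

/-- The exterior product `β ∧ γ` of a `k`-form and a `1`-form. -/
def wedgeOne (β : V [⋀^Fin k]→L[ℝ] ℝ) (γ : V [⋀^Fin 1]→L[ℝ] ℝ) : V [⋀^Fin (k + 1)]→L[ℝ] ℝ :=
  (-1 : ℝ) ^ k • ContinuousAlternatingMap.alternatizeUncurryFin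
    (((ContinuousAlternatingMap.ofSubsingleton ℝ V ℝ (0 : Fin 1)).symm γ).smulRight β)

theorem wedgeOne_apply (β : V [⋀^Fin k]→L[ℝ] ℝ) (γ : V [⋀^Fin 1]→L[ℝ] ℝ) (w : Fin (k + 1) → V) :
    wedgeOne β γ w = ∑ i : Fin (k + 1),
      (-1 : ℝ) ^ (k + (i : ℕ)) * (β (i.removeNth w) * γ (fun _ => w i)) := by
  simp only [wedgeOne, ContinuousAlternatingMap.smul_apply,
    ContinuousAlternatingMap.alternatizeUncurryFin_apply, Finset.smul_sum]
  refine Finset.sum_congr rfl fun i _ => ?_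
  have h : (ContinuousAlternatingMap.ofSubsingleton ℝ V ℝ (0 : Fin 1)).symm γ (w i) =
    γ (fun _ => w i) := rfl
  simp [h, pow_add]
  ring

/-- The pairing of a `k`-form with a `k`-vector, `⟨α, w₁ ∧ ⋯ ∧ w_k⟩ = α(w₁, …, w_k)`. -/
def multivectorPairing (α : V [⋀^Fin k]→L[ℝ] ℝ) : (⋀[ℝ]^k V) →ₗ[ℝ] ℝ :=
  exteriorPower.alternatingMapLinearEquiv α.toAlternatingMap

theorem multivectorPairing_ιMulti (α : V [⋀^Fin k]→L[ℝ] ℝ) (w : Fin k → V) :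
    multivectorPairing α (exteriorPower.ιMulti ℝ k w) = α w :=
  exteriorPower.alternatingMapLinearEquiv_apply_ιMulti _ _

/-- The contraction of a form `η` on `W` with a `W`-valued form `C` on `V`, along `P : V → W`, i.e.
`∑ᵢ η(P w₁, …, C wᵢ, …, P w_k)`; for `C = θ ⊗ u` this is `θ ∧ P^* (i(u)η)`. -/
def insertForm {W : Type*} [NormedAddCommGroup W] [NormedSpace ℝ W] (η : W [⋀^Fin k]→L[ℝ] ℝ)
    (P C : V →L[ℝ] W) : V [⋀^Fin k]→L[ℝ] ℝ :=
  η.fderivCompContinuousLinearMap P C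

theorem insertForm_apply {W : Type*} [NormedAddCommGroup W] [NormedSpace ℝ W]
    (η : W [⋀^Fin k]→L[ℝ] ℝ) (P C : V →L[ℝ] W) (w : Fin k → V) :
    insertForm η P C w = ∑ i, η (Function.update (fun j => P (w j)) i (C (w i))) := by
  rw [insertForm, ContinuousAlternatingMap.fderivCompContinuousLinearMap_apply]
  refine Finset.sum_congr rfl fun i _ => congrArg _ (funext fun j => ?_)
  rcases eq_or_ne j i with rfl | h
  · simp
  · simp [h]

theorem insertForm_mem {W : Type*} [NormedAddCommGroup W] [NormedSpace ℝ W]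
    (η : W [⋀^Fin k]→L[ℝ] ℝ) (P C : V →L[ℝ] W) : insertForm η P C ∈ lambdaTwo P k := by
  intro w i j hij hi hj
  rw [insertForm_apply]
  refine Finset.sum_eq_zero fun l _ => ?_
  rcases eq_or_ne i l with rfl | h
  · exact η.map_coord_zero j (by rw [Function.update_of_ne hij.symm]; exact hj)
  · exact η.map_coord_zero i (by rw [Function.update_of_ne h]; exact hi)

theorem compContinuousLinearMap_mem {W : Type*} [NormedAddCommGroup W] [NormedSpace ℝ W]
    (η : W [⋀^Fin k]→L[ℝ] ℝ) (P : V →L[ℝ] W) :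
    η.compContinuousLinearMap P ∈ lambdaTwo P k := by
  intro w i j _ hi _
  exact η.map_coord_zero i hi

variable [FiniteDimensional ℝ V]

/-- The contraction `i(Y)α` of a `(k+1)`-form with a `k`-vector,
`i(w₁ ∧ ⋯ ∧ w_k)α = α(w₁, …, w_k, ·)`. -/
def multivectorContraction (Y : ⋀[ℝ]^k V) (α : V [⋀^Fin (k + 1)]→L[ℝ] ℝ) :
    V [⋀^Fin 1]→L[ℝ] ℝ :=
  ContinuousAlternatingMap.ofSubsingleton ℝ V ℝ (0 : Fin 1) (LinearMap.toContinuousLinearMap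
    { toFun := fun w => (-1 : ℝ) ^ k * multivectorPairing (α.curryLeft w) Y
      map_add' := by
        intro w w'
        simp [multivectorPairing, mul_add]
      map_smul' := by
        intro c w
        simp [multivectorPairing]
        ring })

theorem multivectorContraction_ιMulti (w : Fin k → V) (α : V [⋀^Fin (k + 1)]→L[ℝ] ℝ)
    (u : Fin 1 → V) : multivectorContraction (exteriorPower.ιMulti ℝ k w) α u =
      α (Fin.snoc w (u 0)) := by
  have h : multivectorContraction (exteriorPower.ιMulti ℝ k w) α u =
    (-1 : ℝ) ^ k * multivectorPairing (α.curryLeft (u 0)) (exteriorPower.ιMulti ℝ k w) := rfl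
  rw [h, multivectorPairing_ιMulti, ContinuousAlternatingMap.curryLeft_apply_apply]
  have h2 : Fin.snoc w (u 0) = Matrix.vecCons (u 0) w ∘ finRotate (k + 1) := by
    rw [Fin.snoc_eq_cons_rotate]; rfl
  rw [h2]
  have h3 := α.toAlternatingMap.map_perm (Matrix.vecCons (u 0) w) (finRotate (k + 1))
  refine Eq.trans ?_ h3.symm
  rw [sign_finRotate]
  simp [Units.smul_def]

variable {m : ℕ}

/-- The `m`-vector `Z` on `ℝᵐ` with `η(Z) = 1`. -/
def dualMultivector (η : Euc m [⋀^Fin m]→L[ℝ] ℝ) : ⋀[ℝ]^m (Euc m) :=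
  (η (fun i => EuclideanSpace.single i 1))⁻¹ •
    exteriorPower.ιMulti ℝ m (fun i => EuclideanSpace.single i 1)

theorem multivectorPairing_dualMultivector (η : Euc m [⋀^Fin m]→L[ℝ] ℝ) (hη : η ≠ 0) :
    multivectorPairing η (dualMultivector η) = 1 := by
  have h : η.toAlternatingMap (EuclideanSpace.basisFun (Fin m) ℝ).toBasis ≠ 0 := by
    rw [Ne, AlternatingMap.map_basis_eq_zero_iff]
    intro h0
    exact hη (ContinuousAlternatingMap.ext fun w => DFunLike.congr_fun h0 w)
  have h' : η (fun i => EuclideanSpace.single i 1) ≠ 0 := by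
    intro h0
    refine h ((congrArg η (funext fun i => ?_)).trans h0)
    simp
  rw [dualMultivector, map_smul, multivectorPairing_ιMulti, smul_eq_mul, inv_mul_cancel₀ h']

/-- A `k`-form `α` on a space `H ⊕ V` has bidegree `(p, r)`, i.e. `α ∈ Λᵖ H^* ⊗ Λʳ V^*`: it
vanishes on vectors that are each horizontal or vertical unless precisely `p` of them are
horizontal and the other `r` are vertical. -/
def HasBidegree (H V' : Submodule ℝ V) (p r : ℕ) (α : V [⋀^Fin k]→L[ℝ] ℝ) : Prop :=
  ∀ (w : Fin k → V) (S : Finset (Fin k)), (∀ i ∈ S, w i ∈ V') → (∀ i ∉ S, w i ∈ H) →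
    ¬ (Sᶜ.card = p ∧ S.card = r) → α w = 0

end Multilinear

section Forms

variable {V : Type*} [NormedAddCommGroup V] [NormedSpace ℝ V] {H : Type*} [TopologicalSpace H]
  (I : ModelWithCorners ℝ V H) (N : Type*) [TopologicalSpace N] [ChartedSpace H N] (k : ℕ)
  {V' : Type*} [NormedAddCommGroup V'] [NormedSpace ℝ V'] {H' : Type*} [TopologicalSpace H']
  (I' : ModelWithCorners ℝ V' H') {N' : Type*} [TopologicalSpace N'] [ChartedSpace H' N']

/-- Fields of `k`-forms on `N`. -/
abbrev DForm : Type _ := ∀ x : N, (TangentSpace I x) [⋀^Fin k]→L[ℝ] ℝ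

namespace DForm

variable {I N k I'}

/-- The representation of a form in the preferred chart at `x₀`, for manifolds without boundary. -/
def chartRep (β : DForm I N k) (x₀ : N) (y : V) : V [⋀^Fin k]→L[ℝ] ℝ :=
  (β ((extChartAt I x₀).symm y)).compContinuousLinearMap
    (mfderiv 𝓘(ℝ, V) I (extChartAt I x₀).symm y)

/-- Smooth (`C^∞`) differential forms. -/
def IsSmooth (β : DForm I N k) : Prop :=
  ∀ x₀ : N, ContDiffOn ℝ ∞ (β.chartRep x₀) (extChartAt I x₀).target

/-- The exterior derivative, computed in charts. -/
def extD (β : DForm I N k) : DForm I N (k + 1) := fun x =>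
  (extDeriv (β.chartRep x) (extChartAt I x x)).compContinuousLinearMap
    (mfderiv I 𝓘(ℝ, V) (extChartAt I x) x)

/-- The pull-back `f^*β`. -/
def pullback (β : DForm I' N' k) (f : N → N') : DForm I N k := fun x =>
  (β (f x)).compContinuousLinearMap (mfderiv I I' f x)

/-- The exterior product of a `k`-form and a `1`-form. -/
def wedge (β : DForm I N k) (γ : DForm I N 1) : DForm I N (k + 1) := fun x =>
  wedgeOne (V := V) (β x) (γ x)

/-- Volume forms: smooth forms of top degree without zeros. -/
structure IsVolumeForm {m : ℕ} {M : Type*} [TopologicalSpace M] [ChartedSpace (Euc m) M]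
    (η : DForm (𝓡 m) M m) : Prop where
  isSmooth : η.IsSmooth
  ne_zero : ∀ x, η x ≠ 0

end DForm

end Forms

section Lagrangian

universe uM uE

variable {M : Type uM} [TopologicalSpace M] {E : Type uE} [TopologicalSpace E]
  {m n : ℕ} [ChartedSpace (Euc m) M] [ChartedSpace (Euc (m + n)) E] {q : E → M}

variable (m n q) in
/-- The differential of the projection `q : E → M` at `e`; the tangent spaces are, by definition,
the model spaces. -/
def dproj (e : E) : Euc (m + n) →L[ℝ] Euc m := mfderiv (𝓡 (m + n)) (𝓡 m) q e

/-- The linear map `T_{π(e)} M → T_e E` that a jet amounts to. -/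
def JetFibre.lift {e : E} (φ : JetFibre m n q e) : Euc m →L[ℝ] Euc (m + n) := φ.1

theorem JetFibre.dproj_lift {e : E} (φ : JetFibre m n q e) (u : Euc m) :
    dproj m n q e (φ.lift u) = u := DFunLike.congr_fun φ.2 u

variable (m n q) in
/-- The vertical subspace of `T_e E`. -/
abbrev vertSpace (e : E) : Submodule ℝ (Euc (m + n)) :=
  LinearMap.ker (dproj m n q e).toLinearMap

/-- The vertical part `Z - φ(Tπ Z)` of a tangent vector `Z` of `E` with respect to a jet `φ`. In
adapted coordinates these are the contact forms `dyᴬ - v^A_α dxᵅ`. -/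
def JetFibre.vertPart {e : E} (φ : JetFibre m n q e) : Euc (m + n) →L[ℝ] vertSpace m n q e :=
  (ContinuousLinearMap.id ℝ (Euc (m + n)) - φ.lift.comp (dproj m n q e)).codRestrict (vertSpace m n q e) (by
    intro Z
    change dproj m n q e (Z - φ.lift (dproj m n q e Z)) = 0
    rw [map_sub, φ.dproj_lift, sub_self])

/-- `J¹π → E` is an affine bundle modelled on `T^*M ⊗ V(π)`: translation of a jet. -/
def JetFibre.translate {e : E} (φ : JetFibre m n q e) (A : Euc m →L[ℝ] vertSpace m n q e) :
    JetFibre m n q e :=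
  ⟨(φ.lift + (vertSpace m n q e).subtypeL.comp A : Euc m →L[ℝ] Euc (m + n)), by
    refine ContinuousLinearMap.ext fun u => ?_
    change dproj m n q e (φ.lift u + (A u : Euc (m + n))) = u
    have h : dproj m n q e (A u : Euc (m + n)) = 0 := (A u).2
    refine (map_add (dproj m n q e) _ _).trans ?_
    rw [h, add_zero]
    exact φ.dproj_lift u⟩

/-- The derivative of `L` along the fibre of `J¹π → E`; in adapted coordinates,
`A ↦ (∂L/∂v^A_α) A^A_α`. -/
def vertDeriv (L : J1 m n q → ℝ) (z : J1 m n q) : (Euc m →L[ℝ] vertSpace m n q z.proj) →L[ℝ] ℝ :=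
  fderiv ℝ (fun A => L ⟨z.proj, z.2.translate A⟩) 0

/-- The contraction of `dL` with the vertical endomorphism: the `TM`-valued form on `T_e E` given
in adapted coordinates by `(∂L/∂v^A_α) (dyᴬ - v^A_β dx^β) ⊗ ∂/∂xᵅ`. -/
def momentum (L : J1 m n q → ℝ) (z : J1 m n q) : Euc (m + n) →L[ℝ] Euc m :=
  ∑ ν : Fin m, ((vertDeriv L z).comp
    ((ContinuousLinearMap.smulRightL ℝ (Euc m) (vertSpace m n q z.proj)
      (EuclideanSpace.proj ν : Euc m →L[ℝ] ℝ)).comp z.2.vertPart)).smulRight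
        (EuclideanSpace.single ν (1 : ℝ) : Euc m)

theorem momentum_apply (L : J1 m n q → ℝ) (z : J1 m n q) (Z : Euc (m + n)) :
    momentum L z Z = ∑ ν : Fin m, vertDeriv L z
      ((EuclideanSpace.proj ν : Euc m →L[ℝ] ℝ).smulRight (z.2.vertPart Z)) •
        (EuclideanSpace.single ν (1 : ℝ) : Euc m) := by
  simp [momentum]

/-- The value at a jet of the Poincaré–Cartan `m`-form `i(𝒱)(L η) + L η` of the Lagrangian density
`L η`, as a form on `T_e E`. In adapted coordinates with `η = dᵐx`, this is
`(∂L/∂v^A_α) dyᴬ ∧ d^{m-1}x_α - ((∂L/∂v^A_α) v^A_α - L) dᵐx`. -/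
def cartanValue (η : DForm (𝓡 m) M m) (L : J1 m n q → ℝ) (z : J1 m n q) :
    Euc (m + n) [⋀^Fin m]→L[ℝ] ℝ :=
  let ηx : Euc m [⋀^Fin m]→L[ℝ] ℝ := η (q z.proj)
  insertForm ηx (dproj m n q z.proj) (momentum L z) +
    L z • ηx.compContinuousLinearMap (dproj m n q z.proj)

theorem cartanValue_mem (η : DForm (𝓡 m) M m) (L : J1 m n q → ℝ) (z : J1 m n q) :
    cartanValue η L z ∈ lambdaTwo (dproj m n q z.proj) m :=
  add_mem (insertForm_mem _ _ _) (Submodule.smul_mem _ _ (compContinuousLinearMap_mem _ _))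

variable [IsSmoothFibreBundle m n q] [IsManifold (𝓡 m) ∞ M]

/-- The Poincaré–Cartan form `Θ_𝓛` on `J¹π`. -/
def poincareCartan (η : DForm (𝓡 m) M m) (L : J1 m n q → ℝ) : DForm (modelJ1 m n) (J1 m n q) m :=
  fun z => (cartanValue η L z).compContinuousLinearMap
    (mfderiv (modelJ1 m n) (𝓡 (m + n)) (fun z : J1 m n q => z.proj) z)

/-- The extended Legendre map `J¹π → 𝓜π`, which sends a jet `ȳ` to the form
`(Z₁, …, Z_m) ↦ Θ_𝓛(Z̄₁, …, Z̄_m)`, where `Z̄ᵢ` are any lifts of `Zᵢ` to `T_ȳ J¹π`. -/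
def extendedLegendre (η : DForm (𝓡 m) M m) (L : J1 m n q → ℝ) (z : J1 m n q) : MM m n q :=
  ⟨z.proj, (⟨cartanValue η L z, cartanValue_mem η L z⟩ : lambdaTwo (dproj m n q z.proj) m)⟩

theorem extendedLegendre_apply (η : DForm (𝓡 m) M m) (L : J1 m n q → ℝ) (z : J1 m n q)
    (Z : Fin m → TangentSpace (modelJ1 m n) z) :
    (extendedLegendre η L z).2.1
      (fun i => mfderiv (modelJ1 m n) (𝓡 (m + n)) (fun z : J1 m n q => z.proj) z (Z i)) =
      poincareCartan η L z Z := rfl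

variable (m n q) in
/-- The projection `μ : 𝓜π → J¹π^*`. -/
def muProj (z : MM m n q) : RMM m n q :=
  ⟨z.proj, (basicForms (mfderiv (𝓡 (m + n)) (𝓡 m) q z.proj) m).mkQ z.2⟩

/-- The restricted Legendre map `FL : J¹π → J¹π^*`. -/
def legendre (η : DForm (𝓡 m) M m) (L : J1 m n q → ℝ) (z : J1 m n q) : RMM m n q :=
  muProj m n q (extendedLegendre η L z)

variable (m n q) in
/-- The tautological `m`-form `Θ` of `𝓜π`. -/
def liouville : DForm (modelMM m n) (MM m n q) m := fun z =>
  (z.2.1).compContinuousLinearMap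
    (mfderiv (modelMM m n) (𝓡 (m + n)) (fun z : MM m n q => z.proj) z)

variable (m n q) in
/-- The canonical multisymplectic form `Ω = -dΘ` of `𝓜π`. -/
def multisymplectic : DForm (modelMM m n) (MM m n q) (m + 1) := fun z =>
  -(liouville m n q).extD z

variable {k : ℕ} {P : Type*} [TopologicalSpace P] [ChartedSpace (Euc k) P]

variable (k) in
/-- The Lagrangian density `L η` is almost-regular, with `P = FL(J¹π)`: the image of the restricted
Legendre map `FL` is a closed submanifold of `J¹π^*`, given here as the manifold `P` with its
embedding `ι : P → J¹π^*`; the map `FL₀ : J¹π → P` that `FL` induces is a submersion; and the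
fibres `FL⁻¹(FL(ȳ))` are connected. -/
structure IsAlmostRegular (η : DForm (𝓡 m) M m) (L : J1 m n q → ℝ) (ι : P → RMM m n q)
    (FL₀ : J1 m n q → P) : Prop where
  isSmoothEmbedding : IsSmoothEmbedding (𝓡 k) (modelRMM m n) ∞ ι
  range_eq : range ι = range (legendre η L)
  isClosed_range : IsClosed (range ι)
  comp_eq : ∀ z, ι (FL₀ z) = legendre η L z
  isSubmersion : IsSubmersion (modelJ1 m n) (𝓡 k) ∞ FL₀
  isConnected_fibre : ∀ z, IsConnected (legendre η L ⁻¹' {legendre η L z})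

section Hamiltonian

variable {η : DForm (𝓡 m) M m} {L : J1 m n q → ℝ} {ι : P → RMM m n q} {FL₀ : J1 m n q → P}

theorem IsAlmostRegular.exists_section (h : IsAlmostRegular k η L ι FL₀) (p : P) :
    ∃ z ∈ range (extendedLegendre η L), muProj m n q z = ι p := by
  obtain ⟨y, hy⟩ : ι p ∈ range (legendre η L) := h.range_eq ▸ mem_range_self p
  exact ⟨_, mem_range_self y, hy⟩

/-- The Hamiltonian section `h̃ : P → 𝓜π`, the inverse of the restriction of `μ` to the image
`FL~(J¹π)` of the extended
Legendre map `FL~`, followed by the inclusion of this image. -/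
def IsAlmostRegular.hamiltonianSection (h : IsAlmostRegular k η L ι FL₀) (p : P) : MM m n q :=
  Classical.choose (h.exists_section p)

/-- The Hamilton–Cartan form `Ω_h⁰ = h̃^*Ω` on `P`. -/
def IsAlmostRegular.hamiltonCartan (h : IsAlmostRegular k η L ι FL₀) : DForm (𝓡 k) P (m + 1) :=
  (multisymplectic m n q).pullback h.hamiltonianSection

end Hamiltonian

variable (m n q) in
/-- The projection `P → M`. -/
def toBase (ι : P → RMM m n q) (p : P) : M := q (ι p).proj

end Lagrangian

section Connection

variable {m k : ℕ} {M : Type*} [TopologicalSpace M] [ChartedSpace (Euc m) M]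
  {P : Type*} [TopologicalSpace P] [ChartedSpace (Euc k) P]

/-- An (Ehresmann) connection on `κ : P → M`: a smooth family of horizontal lifts
`∇_p : T_{κ(p)} M → T_p P` with `T_p κ ∘ ∇_p = id`. -/
structure EhresmannConnection (m k : ℕ) {M : Type*} [TopologicalSpace M] [ChartedSpace (Euc m) M]
    {P : Type*} [TopologicalSpace P] [ChartedSpace (Euc k) P]
    [IsManifold (𝓡 m) ∞ M] [IsManifold (𝓡 k) ∞ P] (κ : P → M) where
  lift : ∀ p : P, TangentSpace (𝓡 m) (κ p) →L[ℝ] TangentSpace (𝓡 k) p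
  mfderiv_comp_lift : ∀ p, (mfderiv (𝓡 k) (𝓡 m) κ p).comp (lift p) =
    ContinuousLinearMap.id ℝ (TangentSpace (𝓡 m) (κ p))
  smooth : ∀ p₀, ContMDiffAt (𝓡 k) 𝓘(ℝ, Euc m →L[ℝ] Euc k) ∞
    (inTangentCoordinates (𝓡 m) (𝓡 k) κ id (fun p => (lift p : Euc m →L[ℝ] Euc k)) p₀) p₀

namespace EhresmannConnection

variable [IsManifold (𝓡 m) ∞ M] [IsManifold (𝓡 k) ∞ P] {κ : P → M} (D : EhresmannConnection m k κ)

/-- The horizontal subspace `im ∇_p`. -/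
def horizontal (p : P) : Submodule ℝ (Euc k) :=
  LinearMap.range (D.lift p : Euc m →L[ℝ] Euc k).toLinearMap

/-- The vertical subspace `ker T_p κ`. -/
def vertical (_ : EhresmannConnection m k κ) (p : P) : Submodule ℝ (Euc k) :=
  LinearMap.ker (mfderiv (𝓡 k) (𝓡 m) κ p : Euc k →L[ℝ] Euc m).toLinearMap

/-- The horizontal `m`-vector field `Y^∇_η = Λᵐ∇(Z)`, where `Z` is the `m`-vector field on `M` with
`η(Z) = 1`. -/
def horizontalMultivector (η : DForm (𝓡 m) M m) (p : P) : ⋀[ℝ]^m (Euc k) :=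
  exteriorPower.map m (D.lift p : Euc m →L[ℝ] Euc k).toLinearMap
    (dualMultivector (η (κ p)))

/-- The `1`-form `i(Y^∇_η)α`. -/
def contract (η : DForm (𝓡 m) M m) (α : DForm (𝓡 k) P (m + 1)) : DForm (𝓡 k) P 1 := fun p =>
  multivectorContraction (V := Euc k) (D.horizontalMultivector η p) (α p)

/-- A form on `P` of bidegree `(a, b)` with respect to the splitting `TP = im ∇ ⊕ ker Tκ`. -/
def HasBidegree {l : ℕ} (a b : ℕ) (α : DForm (𝓡 k) P l) : Prop :=
  ∀ p, _root_.HasBidegree (V := Euc k) (D.horizontal p) (D.vertical p) a b (α p)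

end EhresmannConnection

end Connection

end

/-! Existence of the Hamiltonian section. In an adapted chart, let λ = ∂L/∂v be the momenta at a jet
with coordinates v. The extended Legendre map is there the form `cartanCoord η λ v L`: its part with
one vertical argument encodes λ, and its basic part is (L - λ(v)) η. Passing to the quotient by
basic forms, as the Legendre map does, still determines λ (`fibreDeriv_unique`). Once λ is known,
the extended map depends on the jet only through L - λ(v), the energy up to sign
(`cartanCoord_eq_of_energy_eq`). A fibre of the Legendre map lies over a single point of E, and λ is
constant on it. Along a smooth curve in the fibre the derivative of L - λ(v) is therefore λ(v') -
λ(v') = 0 (`AdaptedChart.energy_eq_of_curve`). Since the fibre is that of a submersion, nearby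
points of it are joined by such curves (`Manifold.IsSubmersionAt.exists_curve`), so L - λ(v) is
locally constant on it, and by connectedness constant. The extended Legendre map thus factors
through `FL₀`, and local sections of this submersion make the factor smooth.

Vanishing on three vertical vectors. In the coordinates (x, y; α) of 𝓜π the tautological form is
linear in α, so its exterior derivative `linearOmega` has constant coefficients. Each summand takes
the fibre component of one argument and evaluates it, an element of Λ₂ᵐ, on the remaining arguments.
If three arguments are vertical over M, at least two of them remain, and the summand vanishes
(`linearOmega_eq_zero`). The Hamiltonian section covers κ, so the Hamilton–Cartan form inherits
this.

Splitting. Let γ be the contracted 1-form. On m+1 horizontal vectors every (m+1)-form vanishes, for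
lack of dimensions. With exactly one vertical vector, the Hamilton–Cartan form and κ^*η ∧ γ agree by
the definition of γ. With two or more, κ^*η ∧ γ vanishes. Hence the difference of the two lives only
in bidegree (m-1, 2) (`hasBidegree_sub_wedgeOne`). That γ is smooth follows from the identity γ(u)
η(w) = Ω(∇w, u) of `EhresmannConnection.contract_mul`, which presents γ locally as a quotient of
smooth functions. -/

/-! ### Smooth dependence of operations on alternating forms -/

section AlternatingSmoothness

variable {V W X : Type*} [NormedAddCommGroup V] [NormedSpace ℝ V] [FiniteDimensional ℝ V]
  [NormedAddCommGroup W] [NormedSpace ℝ W] [FiniteDimensional ℝ W]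
  [NormedAddCommGroup X] [NormedSpace ℝ X] {k : ℕ} {r : WithTop ℕ∞}

/-- The evaluation of forms at a fixed tuple, as a continuous linear map. -/
noncomputable def evalForm (w : Fin k → V) : (V [⋀^Fin k]→L[ℝ] ℝ) →L[ℝ] ℝ :=
  LinearMap.toContinuousLinearMap
    { toFun := fun α => α w
      map_add' := fun _ _ => rfl
      map_smul' := fun _ _ => rfl }

/-- Forms are determined, in a continuous linear way, by their values on tuples of basis
vectors. -/
theorem exists_leftInverse_evalBasis (k : ℕ) :
    ∃ S : ((Fin k → Fin (Module.finrank ℝ V)) → ℝ) →L[ℝ] (V [⋀^Fin k]→L[ℝ] ℝ),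
      ∀ α : V [⋀^Fin k]→L[ℝ] ℝ, S (fun s => α fun i => Module.finBasis ℝ V (s i)) = α := by
  classical
  let b := Module.finBasis ℝ V
  let T : (V [⋀^Fin k]→L[ℝ] ℝ) →ₗ[ℝ] ((Fin k → Fin (Module.finrank ℝ V)) → ℝ) :=
    { toFun := fun α s => α (fun i => b (s i))
      map_add' := fun _ _ => rfl
      map_smul' := fun _ _ => rfl }
  have hT : LinearMap.ker T = ⊥ := by
    refine LinearMap.ker_eq_bot'.2 fun α hα => ?_
    refine ContinuousAlternatingMap.toAlternatingMap_injective ?_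
    exact Module.Basis.ext_alternating b fun s _ => congrFun hα s
  obtain ⟨S, hS⟩ := T.exists_leftInverse_of_injective hT
  exact ⟨LinearMap.toContinuousLinearMap S, DFunLike.congr_fun hS⟩

/-- A map into a space of forms is smooth as soon as its evaluations at fixed vectors are. -/
theorem contDiff_form_of_eval {f : X → V [⋀^Fin k]→L[ℝ] ℝ}
    (h : ∀ w, ContDiff ℝ r fun x => f x w) : ContDiff ℝ r f := by
  obtain ⟨S, hS⟩ := exists_leftInverse_evalBasis (V := V) k
  rw [funext fun x => (hS (f x)).symm]
  exact S.contDiff.comp (contDiff_pi.2 fun s => h _)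

/-- By multilinearity the value is a polynomial in the coordinates of the vectors and in the values
of the form on tuples of basis vectors. -/
theorem contDiff_form_apply :
    ContDiff ℝ r fun p : (V [⋀^Fin k]→L[ℝ] ℝ) × (Fin k → V) => p.1 p.2 := by
  classical
  let b := Module.finBasis ℝ V
  have h : ∀ p : (V [⋀^Fin k]→L[ℝ] ℝ) × (Fin k → V), p.1 p.2 =
      ∑ s : Fin k → Fin (Module.finrank ℝ V),
        (∏ i, LinearMap.toContinuousLinearMap (b.coord (s i)) (p.2 i)) *
          evalForm (fun i => b (s i)) p.1 := by
    intro p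
    have h0 : p.2 = fun i => ∑ j, b.repr (p.2 i) j • b j :=
      funext fun i => (b.sum_repr (p.2 i)).symm
    have h1 : p.1 p.2 = p.1.toMultilinearMap (fun i => ∑ j, b.repr (p.2 i) j • b j) :=
      congrArg p.1 h0
    rw [h1, MultilinearMap.map_sum]
    refine Finset.sum_congr rfl fun s _ => ?_
    rw [MultilinearMap.map_smul_univ]
    rfl
  rw [funext h]
  refine ContDiff.sum fun s _ => ContDiff.mul (contDiff_prod fun i _ => ?_)
    ((evalForm fun i => b (s i)).contDiff.comp contDiff_fst)
  exact (LinearMap.toContinuousLinearMap (b.coord (s i))).contDiff.comp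
    ((contDiff_apply ℝ V i).comp contDiff_snd)

/-- Tested on a fixed tuple, the pull-back is a form evaluated at vectors that depend linearly on
the map, so joint smoothness of evaluation suffices. -/
theorem contDiff_form_comp :
    ContDiff ℝ r fun p : (W [⋀^Fin k]→L[ℝ] ℝ) × (V →L[ℝ] W) =>
      p.1.compContinuousLinearMap p.2 := by
  refine contDiff_form_of_eval fun w => ?_
  have h : ContDiff ℝ r fun p : (W [⋀^Fin k]→L[ℝ] ℝ) × (V →L[ℝ] W) =>
      (p.1, fun i => p.2 (w i)) :=
    contDiff_fst.prodMk (contDiff_pi.2 fun i => contDiff_snd.clm_apply contDiff_const)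
  exact contDiff_form_apply.comp h

theorem contDiff_insertForm {W : Type*} [NormedAddCommGroup W] [NormedSpace ℝ W]
    [FiniteDimensional ℝ W] (P : V →L[ℝ] W) :
    ContDiff ℝ r fun p : (W [⋀^Fin k]→L[ℝ] ℝ) × (V →L[ℝ] W) => insertForm p.1 P p.2 := by
  refine contDiff_form_of_eval fun w => ?_
  simp only [insertForm_apply]
  refine ContDiff.sum fun i _ => ?_
  have h : ContDiff ℝ r fun p : (W [⋀^Fin k]→L[ℝ] ℝ) × (V →L[ℝ] W) =>
      (p.1, Function.update (fun j => P (w j)) i (p.2 (w i))) := by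
    refine contDiff_fst.prodMk (contDiff_pi.2 fun j => ?_)
    rcases eq_or_ne j i with rfl | h
    · simpa using contDiff_snd.clm_apply contDiff_const
    · simpa [h] using contDiff_const
  exact contDiff_form_apply.comp h

theorem contDiff_wedgeOne :
    ContDiff ℝ r fun p : (V [⋀^Fin k]→L[ℝ] ℝ) × (V [⋀^Fin 1]→L[ℝ] ℝ) => wedgeOne p.1 p.2 := by
  refine contDiff_form_of_eval fun w => ?_
  simp only [wedgeOne_apply]
  refine ContDiff.sum fun i _ => contDiff_const.mul (ContDiff.mul ?_ ?_)
  · exact (evalForm (i.removeNth w)).contDiff.comp contDiff_fst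
  · exact (evalForm fun _ => w i).contDiff.comp contDiff_snd

theorem contDiff_form_comp_right (α : W [⋀^Fin k]→L[ℝ] ℝ) :
    ContDiff ℝ r fun A : V →L[ℝ] W => α.compContinuousLinearMap A :=
  contDiff_form_comp.comp (contDiff_const.prodMk contDiff_id)

theorem ContDiffAt.form_apply {f : X → V [⋀^Fin k]→L[ℝ] ℝ} {w : X → Fin k → V} {x : X}
    (hf : ContDiffAt ℝ r f x) (hw : ∀ i, ContDiffAt ℝ r (fun y => w y i) x) :
    ContDiffAt ℝ r (fun y => f y (w y)) x :=
  contDiff_form_apply.contDiffAt.comp x (hf.prodMk (contDiffAt_pi.2 hw))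

theorem ContDiffAt.form_comp {f : X → W [⋀^Fin k]→L[ℝ] ℝ} {A : X → V →L[ℝ] W} {x : X}
    (hf : ContDiffAt ℝ r f x) (hA : ContDiffAt ℝ r A x) :
    ContDiffAt ℝ r (fun y => (f y).compContinuousLinearMap (A y)) x := by
  have h : ContDiffAt ℝ r (fun p : (W [⋀^Fin k]→L[ℝ] ℝ) × (V →L[ℝ] W) =>
    p.1.compContinuousLinearMap p.2) (f x, A x) := contDiff_form_comp.contDiffAt
  exact h.comp x (hf.prodMk hA)

theorem ContDiffAt.form_wedge {β : X → V [⋀^Fin k]→L[ℝ] ℝ} {γ : X → V [⋀^Fin 1]→L[ℝ] ℝ} {x : X}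
    (hβ : ContDiffAt ℝ r β x) (hγ : ContDiffAt ℝ r γ x) :
    ContDiffAt ℝ r (fun y => wedgeOne (β y) (γ y)) x := by
  have h : ContDiffAt ℝ r (fun p : (V [⋀^Fin k]→L[ℝ] ℝ) × (V [⋀^Fin 1]→L[ℝ] ℝ) =>
    wedgeOne p.1 p.2) (β x, γ x) := contDiff_wedgeOne.contDiffAt
  have h' := h.comp x (hβ.prodMk hγ)
  exact h'

theorem contDiffAt_form_of_eval {f : X → V [⋀^Fin k]→L[ℝ] ℝ} {x : X}
    (h : ∀ w, ContDiffAt ℝ r (fun y => f y w) x) : ContDiffAt ℝ r f x := by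
  obtain ⟨S, hS⟩ := exists_leftInverse_evalBasis (V := V) k
  rw [funext fun y => (hS (f y)).symm]
  exact S.contDiff.contDiffAt.comp x (contDiffAt_pi.2 fun s => h _)

section ContMDiff

variable {H N : Type*} [TopologicalSpace H] {I : ModelWithCorners ℝ X H} [TopologicalSpace N]
  [ChartedSpace H N] {x : N}

theorem ContMDiffAt.form_comp {f : N → W [⋀^Fin k]→L[ℝ] ℝ} {A : N → V →L[ℝ] W}
    (hf : ContMDiffAt I 𝓘(ℝ, W [⋀^Fin k]→L[ℝ] ℝ) r f x)
    (hA : ContMDiffAt I 𝓘(ℝ, V →L[ℝ] W) r A x) :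
    ContMDiffAt I 𝓘(ℝ, V [⋀^Fin k]→L[ℝ] ℝ) r
      (fun y => (f y).compContinuousLinearMap (A y)) x := by
  have h : ContDiffAt ℝ r (fun p : (W [⋀^Fin k]→L[ℝ] ℝ) × (V →L[ℝ] W) =>
    p.1.compContinuousLinearMap p.2) (f x, A x) := contDiff_form_comp.contDiffAt
  exact h.contMDiffAt.comp x (hf.prodMk_space hA)

theorem ContMDiffAt.form_insert {f : N → W [⋀^Fin k]→L[ℝ] ℝ} (P : V →L[ℝ] W)
    {A : N → V →L[ℝ] W} (hf : ContMDiffAt I 𝓘(ℝ, W [⋀^Fin k]→L[ℝ] ℝ) r f x)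
    (hA : ContMDiffAt I 𝓘(ℝ, V →L[ℝ] W) r A x) :
    ContMDiffAt I 𝓘(ℝ, V [⋀^Fin k]→L[ℝ] ℝ) r (fun y => insertForm (f y) P (A y)) x := by
  have h : ContDiffAt ℝ r (fun p : (W [⋀^Fin k]→L[ℝ] ℝ) × (V →L[ℝ] W) =>
    insertForm p.1 P p.2) (f x, A x) := (contDiff_insertForm P).contDiffAt
  exact h.contMDiffAt.comp x (hf.prodMk_space hA)

end ContMDiff

end AlternatingSmoothness

/-! ### Forms of top degree and signs -/

section TopForms

variable {V : Type*} [NormedAddCommGroup V] [NormedSpace ℝ V] {m : ℕ}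

/-- Two forms of top degree are proportional. -/
theorem topForm_mul_comm (α β : Euc m [⋀^Fin m]→L[ℝ] ℝ) (u w : Fin m → Euc m) :
    α u * β w = β u * α w := by
  have key : ∀ (v : Fin m → Euc m), α v * β (EuclideanSpace.basisFun (Fin m) ℝ) =
      β v * α (EuclideanSpace.basisFun (Fin m) ℝ) := by
    intro v
    have ha := α.toAlternatingMap.eq_smul_basis_det (EuclideanSpace.basisFun (Fin m) ℝ).toBasis
    have hb := β.toAlternatingMap.eq_smul_basis_det (EuclideanSpace.basisFun (Fin m) ℝ).toBasis
    have ha' := DFunLike.congr_fun ha v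
    have hb' := DFunLike.congr_fun hb v
    simp only [AlternatingMap.smul_apply, smul_eq_mul, OrthonormalBasis.coe_toBasis] at ha' hb'
    change α v = _ at ha'
    change β v = _ at hb'
    rw [ha', hb']
    change α _ * _ * β _ = β _ * _ * α _
    ring
  by_cases hα : α = 0
  · simp [hα]
  have h0 : α (EuclideanSpace.basisFun (Fin m) ℝ) ≠ 0 := by
    have : α.toAlternatingMap (EuclideanSpace.basisFun (Fin m) ℝ).toBasis ≠ 0 := by
      rw [Ne, AlternatingMap.map_basis_eq_zero_iff]
      intro h0
      exact hα (ContinuousAlternatingMap.ext fun w => DFunLike.congr_fun h0 w)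
    simpa using this
  have h1 := key u
  have h2 := key w
  refine mul_right_cancel₀ h0 ?_
  linear_combination (-α u) * h2 + α w * h1

theorem topForm_single_ne_zero {η : Euc m [⋀^Fin m]→L[ℝ] ℝ} (hη : η ≠ 0) :
    η (fun i => EuclideanSpace.single i 1) ≠ 0 := by
  intro h0
  have h := multivectorPairing_dualMultivector η hη
  rw [dualMultivector, map_smul, multivectorPairing_ιMulti, h0] at h
  simp at h

/-- The derivation of the top exterior power given by an endomorphism is its trace. -/
theorem insertForm_id_eq_trace (η : Euc m [⋀^Fin m]→L[ℝ] ℝ) (S : Euc m →L[ℝ] Euc m) :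
    insertForm η (ContinuousLinearMap.id ℝ (Euc m)) S =
      (∑ ν, S (EuclideanSpace.single ν 1) ν) • η := by
  have h : insertForm η (ContinuousLinearMap.id ℝ (Euc m)) S
      (fun i => EuclideanSpace.single i 1) =
      (∑ ν, S (EuclideanSpace.single ν 1) ν) * η (fun i => EuclideanSpace.single i 1) := by
    rw [insertForm_apply, Finset.sum_mul]
    refine Finset.sum_congr rfl fun i _ => ?_
    have h1 : S (EuclideanSpace.single i 1) =
        ∑ j, S (EuclideanSpace.single i 1) j • (EuclideanSpace.single j 1 : Euc m) := by
      ext l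
      simp [Pi.single_apply]
    have h2 : η (Function.update (fun j => EuclideanSpace.single j 1) i
        (S (EuclideanSpace.single i 1))) = ∑ j, S (EuclideanSpace.single i 1) j •
        η (Function.update (fun j => EuclideanSpace.single j 1) i
          (EuclideanSpace.single j 1)) := by
      conv_lhs => rw [h1]
      refine (η.toMultilinearMap.map_update_sum _ _ _ _).trans ?_
      exact Finset.sum_congr rfl fun j _ => η.toMultilinearMap.map_update_smul _ _ _ _
    refine h2.trans ?_
    -- Only the diagonal entry of S survives: for j ≠ i the vector e_j occupies both slots i and j.
    rw [Finset.sum_eq_single i]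
    · rw [Function.update_eq_self]; rfl
    · intro j _ hj
      rw [η.map_eq_zero_of_eq _ (i := i) (j := j) (by simp [hj]) hj.symm, smul_zero]
    · simp
  ext u
  by_cases hη : η = 0
  · subst hη
    simp [insertForm_apply]
  -- Top forms are proportional, so the comparison on the standard basis decides everything.
  have h3 := topForm_mul_comm (insertForm η (ContinuousLinearMap.id ℝ (Euc m)) S) η u
    (fun i => EuclideanSpace.single i 1)
  rw [h] at h3
  refine mul_right_cancel₀ (topForm_single_ne_zero hη) (h3.trans ?_)
  simp only [ContinuousAlternatingMap.smul_apply, smul_eq_mul]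
  ring

/-- Moving `v` from slot `i` to the last slot takes `k - i` transpositions. This is the sign on the
`i`-th summand of `wedgeOne`, so the wedge matches the contraction, which feeds the free vector
last. -/
theorem form_insertNth {k : ℕ} (α : V [⋀^Fin (k + 1)]→L[ℝ] ℝ) (i : Fin (k + 1)) (v : V)
    (w : Fin k → V) :
    α (i.insertNth v w) = (-1) ^ (k + (i : ℕ)) * α (Fin.snoc w v) := by
  have h1 := α.map_insertNth i v w
  have h2 := α.map_insertNth (Fin.last k) v w
  rw [Fin.insertNth_last'] at h2
  rw [h1, h2]
  simp only [zsmul_eq_mul, Fin.val_last]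
  push_cast
  have : ((-1 : ℝ) ^ k) * (-1) ^ k = 1 := by rw [← mul_pow]; simp
  rw [pow_add]
  linear_combination (-(-1 : ℝ) ^ (i : ℕ) * α (Matrix.vecCons v w)) * this

end TopForms

/-! ### Smooth structures on 𝓜π and J¹π -/

section BundleManifolds

variable {M : Type*} [TopologicalSpace M] {E : Type*} [TopologicalSpace E]
  {m n : ℕ} [ChartedSpace (Euc m) M] [ChartedSpace (Euc (m + n)) E] {q : E → M}
  [IsSmoothFibreBundle m n q]

theorem contDiff_modelRetract_comp (y : (Euc m × Euc n) [⋀^Fin m]→L[ℝ] ℝ) :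
    ContDiff ℝ ∞ fun A : Euc m × Euc n →L[ℝ] Euc m × Euc n =>
      modelRetract m n (y.compContinuousLinearMap A) := by
  have h : ContDiff ℝ ∞ (modelRetract m n) := (modelRetract m n).contDiff
  exact h.comp (contDiff_form_comp_right y)

set_option maxHeartbeats 1000000 in
theorem contMDiffOn_mmChange (c c' : AdaptedChart m n q) :
    ContMDiffOn (𝓡 (m + n)) 𝓘(ℝ, ModelMM m n →L[ℝ] ModelMM m n) ∞ (mmChange c c')
      (c.tot.source ∩ c'.tot.source) := by
  have h0 : ContDiff ℝ ∞ fun A : Euc m × Euc n →L[ℝ] Euc m × Euc n =>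
      (modelRetract m n).comp ((ContinuousAlternatingMap.compContinuousLinearMapCLM A).comp
        (lambdaTwo (ContinuousLinearMap.fst ℝ (Euc m) (Euc n)) m).subtypeL) :=
    contDiff_clm_apply_iff.2 fun y => contDiff_modelRetract_comp y.1
  have h2 := c'.contMDiffOn_frameChange c
  rw [inter_comm] at h2
  have h3 := h0.contMDiff.comp_contMDiffOn h2
  exact h3

instance isContMDiff_mmPrebundle [IsManifold (𝓡 m) ∞ M] :
    (mmPrebundle m n q).IsContMDiff (𝓡 (m + n)) ∞ where
  exists_contMDiffCoordChange := by
    rintro _ ⟨c, rfl⟩ _ ⟨c', rfl⟩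
    refine ⟨mmChange c c', contMDiffOn_mmChange c c', fun b hb y => ?_⟩
    rw [Bundle.Pretrivialization.symm_apply _ hb.1]
    exact mmChange_apply c c' hb y

instance contMDiffVectorBundle_mm [IsManifold (𝓡 m) ∞ M] :
    ContMDiffVectorBundle ∞ (ModelMM m n) (MMFibre m n q) (𝓡 (m + n)) :=
  (mmPrebundle m n q).contMDiffVectorBundle (𝓡 (m + n))

variable [IsManifold (𝓡 m) ∞ M]

/-- The trivialisation of `𝓜π` given by an adapted chart. -/
noncomputable def AdaptedChart.mmTriv (c : AdaptedChart m n q) :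
    Bundle.Trivialization (ModelMM m n)
      (Bundle.TotalSpace.proj : Bundle.TotalSpace (ModelMM m n) (MMFibre m n q) → E) :=
  (mmPrebundle m n q).trivializationOfMemPretrivializationAtlas ⟨c, rfl⟩

instance (c : AdaptedChart m n q) : MemTrivializationAtlas c.mmTriv :=
  ⟨_, ⟨c, rfl⟩, rfl⟩

/-- The trivialisation of `J¹π` given by an adapted chart. -/
noncomputable def AdaptedChart.jetTriv (c : AdaptedChart m n q) :
    Bundle.Trivialization (Euc m →L[ℝ] Euc n)
      (Bundle.TotalSpace.proj :
        Bundle.TotalSpace (Euc m →L[ℝ] Euc n) (JetFibre m n q) → E) :=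
  (jetPrebundle m n q).trivializationOfMemPretrivializationAtlas ⟨c, rfl⟩

section

variable {EN HN N : Type*} [NormedAddCommGroup EN] [NormedSpace ℝ EN] [TopologicalSpace HN]
  {IN : ModelWithCorners ℝ EN HN} [TopologicalSpace N] [ChartedSpace HN N]

theorem AdaptedChart.contMDiffAt_mm_iff (c : AdaptedChart m n q) {f : N → MM m n q} {x₀ : N}
    (h : (f x₀).proj ∈ c.tot.source) :
    ContMDiffAt IN (modelMM m n) ∞ f x₀ ↔
      ContMDiffAt IN (𝓡 (m + n)) ∞ (fun x => (f x).proj) x₀ ∧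
      ContMDiffAt IN 𝓘(ℝ, ModelMM m n) ∞ (fun x => c.mmCoord (f x).proj (f x).2) x₀ :=
  c.mmTriv.contMDiffAt_iff h

theorem contMDiffAt_jetChange (c c' : AdaptedChart m n q) {f : N → E}
    {v : N → Euc m →L[ℝ] Euc n} {x₀ : N} (hf : ContMDiffAt IN (𝓡 (m + n)) ∞ f x₀)
    (hv : ContMDiffAt IN 𝓘(ℝ, Euc m →L[ℝ] Euc n) ∞ v x₀) (hc : f x₀ ∈ c.tot.source)
    (hc' : f x₀ ∈ c'.tot.source) :
    ContMDiffAt IN 𝓘(ℝ, Euc m →L[ℝ] Euc n) ∞ (fun x => jetChange c c' (f x) (v x)) x₀ := by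
  have h1 : ContMDiffAt IN 𝓘(ℝ, Euc m × Euc n →L[ℝ] Euc m × Euc n) ∞
      (fun x => c.frameChange c' (f x)) x₀ :=
    ((c.contMDiffOn_frameChange c').contMDiffAt
      ((c.tot.open_source.inter c'.tot.open_source).mem_nhds ⟨hc, hc'⟩)).comp x₀ hf
  have h2 : ContMDiffAt IN 𝓘(ℝ, Euc m × Euc n →L[ℝ] Euc m × Euc n) ∞
      (fun x => c'.frameChange c (f x)) x₀ :=
    ((c'.contMDiffOn_frameChange c).contMDiffAt
      ((c'.tot.open_source.inter c.tot.open_source).mem_nhds ⟨hc', hc⟩)).comp x₀ hf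
  have h3 : ContMDiffAt IN 𝓘(ℝ, Euc m →L[ℝ] Euc m × Euc n) ∞ (fun x => graphMap (v x)) x₀ := by
    have h : ContDiff ℝ ∞ (graphMap (m := m) (n := n)) :=
      contDiff_const.add (contDiff_const.clm_comp contDiff_id)
    exact h.contMDiff.contMDiffAt.comp x₀ hv
  exact (contMDiffAt_const.clm_comp h1).clm_comp
    (h3.clm_comp ((contMDiffAt_const.clm_comp h2).clm_comp contMDiffAt_const))

theorem AdaptedChart.jetCoord_eq_jetChange (c c' : AdaptedChart m n q) {e : E}
    (he : e ∈ c.tot.source ∩ c'.tot.source) (φ : JetFibre m n q e) :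
    c'.jetCoord e φ = jetChange c c' e (c.jetCoord e φ) := by
  rw [jetChange_apply c c' he, jetOfCoord_jetCoord]

/-- J¹π is only a fibre bundle here, so in contrast to 𝓜π no criterion for smooth vector bundles
applies. The chart `c` is compared with the preferred one through the explicit smooth change
`jetChange`. -/
theorem AdaptedChart.contMDiffAt_jet_iff (c : AdaptedChart m n q) {f : N → J1 m n q} {x₀ : N}
    (h : (f x₀).proj ∈ c.tot.source) :
    ContMDiffAt IN (modelJ1 m n) ∞ f x₀ ↔
      ContMDiffAt IN (𝓡 (m + n)) ∞ (fun x => (f x).proj) x₀ ∧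
      ContMDiffAt IN 𝓘(ℝ, Euc m →L[ℝ] Euc n) ∞ (fun x => c.jetCoord (f x).proj (f x).2) x₀ := by
  rw [Bundle.contMDiffAt_totalSpace]
  refine and_congr_right fun hp => ?_
  let c₀ := adaptedChartAt m n q (f x₀).proj
  have h₀ : (f x₀).proj ∈ c₀.tot.source := mem_adaptedChartAt m n q _
  -- By construction, the preferred trivialisation of J¹π at this point is the one of `c₀`.
  change ContMDiffAt IN _ ∞ (fun x => c₀.jetCoord (f x).proj (f x).2) x₀ ↔ _
  have ev : ∀ᶠ x in 𝓝 x₀, (f x).proj ∈ c₀.tot.source ∩ c.tot.source :=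
    hp.continuousAt.eventually_mem ((c₀.tot.open_source.inter c.tot.open_source).mem_nhds ⟨h₀, h⟩)
  constructor
  · intro hv
    refine (contMDiffAt_jetChange c₀ c hp hv h₀ h).congr_of_eventuallyEq ?_
    filter_upwards [ev] with x hx
    exact c₀.jetCoord_eq_jetChange c hx _
  · intro hv
    refine (contMDiffAt_jetChange c c₀ hp hv h h₀).congr_of_eventuallyEq ?_
    filter_upwards [ev] with x hx
    exact c.jetCoord_eq_jetChange c₀ hx.symm _

end

theorem AdaptedChart.contMDiffAt_mmCoord (c : AdaptedChart m n q) {z : MM m n q}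
    (h : z.proj ∈ c.tot.source) : ContMDiffAt (modelMM m n) 𝓘(ℝ, ModelMM m n) ∞
      (fun z : MM m n q => c.mmCoord z.proj z.2) z :=
  ((c.contMDiffAt_mm_iff (f := id) h).1 contMDiffAt_id).2

theorem AdaptedChart.contMDiffAt_jetCoord (c : AdaptedChart m n q) {z : J1 m n q}
    (h : z.proj ∈ c.tot.source) : ContMDiffAt (modelJ1 m n) 𝓘(ℝ, Euc m →L[ℝ] Euc n) ∞
      (fun z : J1 m n q => c.jetCoord z.proj z.2) z :=
  ((c.contMDiffAt_jet_iff (f := id) h).1 contMDiffAt_id).2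

theorem AdaptedChart.contMDiffOn_jetTriv (c : AdaptedChart m n q) :
    ContMDiffOn (modelJ1 m n) (modelJ1 m n) ∞ c.jetTriv c.jetTriv.source := fun _ hz =>
  ((Bundle.contMDiff_proj _).contMDiffAt.prodMk (c.contMDiffAt_jetCoord hz)).contMDiffWithinAt

theorem AdaptedChart.contMDiffOn_jetTriv_symm (c : AdaptedChart m n q) :
    ContMDiffOn (modelJ1 m n) (modelJ1 m n) ∞ c.jetTriv.toOpenPartialHomeomorph.symm
      c.jetTriv.target := by
  intro x hx
  have hx' : x.1 ∈ c.tot.source := hx.1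
  refine ContMDiffAt.contMDiffWithinAt ((c.contMDiffAt_jet_iff hx').2 ⟨contMDiffAt_fst, ?_⟩)
  refine contMDiffAt_snd.congr_of_eventuallyEq ?_
  filter_upwards [c.jetTriv.open_target.mem_nhds hx] with y hy
  exact congrArg Prod.snd (c.jetTriv.toOpenPartialHomeomorph.right_inv hy)

/-- Charts of J¹π are trivialisations from adapted charts followed by product charts. Transition
maps are therefore composites of maps already known to be smooth. -/
instance isManifold_J1 [IsManifold (𝓡 (m + n)) ∞ E] :
    IsManifold (modelJ1 m n) ∞ (J1 m n q) := by
  refine isManifold_of_contDiffOn _ _ _ ?_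
  rintro _ _ ⟨_, ⟨_, ⟨_, ⟨c, rfl⟩, rfl⟩, rfl⟩, g, hg, rfl⟩
    ⟨_, ⟨_, ⟨_, ⟨c', rfl⟩, rfl⟩, rfl⟩, g', hg', rfl⟩
  change OpenPartialHomeomorph (E × (Euc m →L[ℝ] Euc n))
    (ModelProd (Euc (m + n)) (Euc m →L[ℝ] Euc n)) at g g'
  change ContDiffOn ℝ ∞ (modelJ1 m n ∘
    (c.jetTriv.toOpenPartialHomeomorph ≫ₕ g).symm ≫ₕ
      (c'.jetTriv.toOpenPartialHomeomorph ≫ₕ g') ∘ (modelJ1 m n).symm)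
    ((modelJ1 m n).symm ⁻¹' ((c.jetTriv.toOpenPartialHomeomorph ≫ₕ g).symm ≫ₕ
      (c'.jetTriv.toOpenPartialHomeomorph ≫ₕ g')).source ∩ range (modelJ1 m n))
  rw [← contMDiffOn_iff_contDiffOn]
  have k1 : ContMDiffOn (modelJ1 m n) (modelJ1 m n) ∞ g g.source :=
    contMDiffOn_of_mem_maximalAtlas (IsManifold.subset_maximalAtlas hg)
  have k2 : ContMDiffOn (modelJ1 m n) (modelJ1 m n) ∞ g.symm g.target :=
    contMDiffOn_symm_of_mem_maximalAtlas (IsManifold.subset_maximalAtlas hg)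
  have k1' : ContMDiffOn (modelJ1 m n) (modelJ1 m n) ∞ g' g'.source :=
    contMDiffOn_of_mem_maximalAtlas (IsManifold.subset_maximalAtlas hg')
  have k3 := c.contMDiffOn_jetTriv_symm
  have k4 := c'.contMDiffOn_jetTriv
  have k6 := (ModelWithCorners.contMDiff (I := modelJ1 m n) (n := ∞)).comp_contMDiffOn
    ((k1'.comp' (k4.comp' (k3.comp' k2))).comp'
      (ModelWithCorners.contMDiffOn_symm (I := modelJ1 m n) (n := ∞)))
  refine k6.mono ?_
  rintro x ⟨hx, hx'⟩
  simp only [OpenPartialHomeomorph.trans_source, OpenPartialHomeomorph.symm_source,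
    OpenPartialHomeomorph.trans_target, mem_inter_iff, mem_preimage,
    OpenPartialHomeomorph.coe_trans_symm, Function.comp_apply] at hx
  exact ⟨hx', ⟨⟨hx.1.1, hx.1.2⟩, hx.2.1⟩, hx.2.2⟩

end BundleManifolds

/-! ### Differential forms read in charts -/

section FormsInCharts

variable {V : Type*} [NormedAddCommGroup V] [NormedSpace ℝ V] {H : Type*} [TopologicalSpace H]
  {I : ModelWithCorners ℝ V H} [I.Boundaryless] {N : Type*} [TopologicalSpace N]
  [ChartedSpace H N] [IsManifold I ∞ N] {k : ℕ}
  {W : Type*} [NormedAddCommGroup W] [NormedSpace ℝ W]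

namespace DForm

/-- This is the chain rule for the inverse chart followed by `g`. The coefficients `b` depend on the
point of `N` and not on its image under `g`, so `β` need not be a pull-back from `W`. -/
theorem chartRep_eventuallyEq {β : DForm I N k} {g : N → W} {b : N → W [⋀^Fin k]→L[ℝ] ℝ}
    {x₀ z : N} (hz : z ∈ (chartAt H x₀).source) (hg : ContMDiffAt I 𝓘(ℝ, W) ∞ g z)
    (h : ∀ᶠ z' in 𝓝 z, β z' = (b z').compContinuousLinearMap (mfderiv I 𝓘(ℝ, W) g z')) :
    β.chartRep x₀ =ᶠ[𝓝 (extChartAt I x₀ z)] fun y =>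
      (b ((extChartAt I x₀).symm y)).compContinuousLinearMap
        (fderiv ℝ (g ∘ (extChartAt I x₀).symm) y) := by
  have hz' : z ∈ (extChartAt I x₀).source := by rwa [extChartAt_source]
  have hmd : ∀ᶠ z' in 𝓝 z, MDifferentiableAt I 𝓘(ℝ, W) g z' := by
    have hg1 : ContMDiffAt I 𝓘(ℝ, W) 1 g z := hg.of_le (by simp)
    filter_upwards [(contMDiffAt_iff_contMDiffAt_nhds (by simp)).1 hg1] with z' h'
    exact h'.mdifferentiableAt (by simp)
  have hc : ContinuousAt (extChartAt I x₀).symm (extChartAt I x₀ z) :=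
    continuousAt_extChartAt_symm' hz'
  have key := (h.and hmd)
  -- The base point is rewritten so that continuity of the inverse chart pulls the neighbourhood
  -- back to the model space.
  rw [← (extChartAt I x₀).left_inv hz'] at key
  filter_upwards [hc.eventually key, extChartAt_target_mem_nhds' ((extChartAt I x₀).map_source hz')] with y hy hy'
  have hs : MDifferentiableAt 𝓘(ℝ, V) I (extChartAt I x₀).symm y :=
    ((contMDiffOn_extChartAt_symm (n := ∞) x₀).contMDiffAt
      ((isOpen_extChartAt_target x₀).mem_nhds hy')).mdifferentiableAt (by simp)
  have hcomp := mfderiv_comp y hy.2 hs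
  rw [mfderiv_eq_fderiv] at hcomp
  rw [hcomp, chartRep, hy.1]
  rfl

/-- The working criterion for smoothness: it suffices to write the form near the point with smooth
coefficients `b` along a smooth map `g` into a vector space. -/
theorem contDiffAt_chartRep [FiniteDimensional ℝ V] [FiniteDimensional ℝ W] {β : DForm I N k}
    {g : N → W} {b : N → W [⋀^Fin k]→L[ℝ] ℝ}
    {x₀ z : N} (hz : z ∈ (chartAt H x₀).source) (hg : ContMDiffAt I 𝓘(ℝ, W) ∞ g z)
    (hb : ContMDiffAt I 𝓘(ℝ, W [⋀^Fin k]→L[ℝ] ℝ) ∞ b z)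
    (h : ∀ᶠ z' in 𝓝 z, β z' = (b z').compContinuousLinearMap (mfderiv I 𝓘(ℝ, W) g z')) :
    ContDiffAt ℝ ∞ (β.chartRep x₀) (extChartAt I x₀ z) := by
  have hz' : z ∈ (extChartAt I x₀).source := by rwa [extChartAt_source]
  refine ContDiffAt.congr_of_eventuallyEq ?_ (chartRep_eventuallyEq hz hg h)
  have hs : ContMDiffAt 𝓘(ℝ, V) I ∞ (extChartAt I x₀).symm (extChartAt I x₀ z) :=
    (contMDiffOn_extChartAt_symm x₀).contMDiffAt (extChartAt_target_mem_nhds' ((extChartAt I x₀).map_source hz'))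
  have hz2 := (extChartAt I x₀).left_inv hz'
  have hg' : ContDiffAt ℝ ∞ (g ∘ (extChartAt I x₀).symm) (extChartAt I x₀ z) := by
    rw [← contMDiffAt_iff_contDiffAt]
    exact ContMDiffAt.comp _ (by rwa [hz2]) hs
  have hb' : ContDiffAt ℝ ∞ (b ∘ (extChartAt I x₀).symm) (extChartAt I x₀ z) := by
    rw [← contMDiffAt_iff_contDiffAt]
    exact ContMDiffAt.comp _ (by rwa [hz2]) hs
  exact hb'.form_comp (hg'.fderiv_right (by simp))

/-- The differentials of a chart and of its inverse cancel. With `g` the chart itself, this supplies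
the hypothesis of `contDiffAt_chartRep` for an arbitrary form. -/
theorem eq_chartRep_comp (β : DForm I N k) {x₀ z : N} (hz : z ∈ (chartAt H x₀).source) :
    β z = (β.chartRep x₀ (extChartAt I x₀ z)).compContinuousLinearMap
      (mfderiv I 𝓘(ℝ, V) (extChartAt I x₀) z) := by
  have hz' : z ∈ (extChartAt I x₀).source := by rwa [extChartAt_source]
  have h1 : MDifferentiableAt I 𝓘(ℝ, V) (extChartAt I x₀) z :=
    (contMDiffAt_extChartAt' (n := ∞) hz).mdifferentiableAt (by simp)
  have hs : MDifferentiableAt 𝓘(ℝ, V) I (extChartAt I x₀).symm (extChartAt I x₀ z) :=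
    ((contMDiffOn_extChartAt_symm (n := ∞) x₀).contMDiffAt
      (extChartAt_target_mem_nhds' ((extChartAt I x₀).map_source hz'))).mdifferentiableAt (by simp)
  have hcomp := mfderiv_comp z hs h1
  have hid : mfderiv I I ((extChartAt I x₀).symm ∘ extChartAt I x₀) z =
      ContinuousLinearMap.id ℝ (TangentSpace I z) := by
    rw [← mfderiv_id]
    refine Filter.EventuallyEq.mfderiv_eq ?_
    filter_upwards [extChartAt_source_mem_nhds' (I := I) hz'] with y hy
    exact (extChartAt I x₀).left_inv hy
  rw [hid] at hcomp
  have hpt := (extChartAt I x₀).left_inv hz'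
  ext w
  have h2 : ∀ v : V, (mfderiv 𝓘(ℝ, V) I (extChartAt I x₀).symm (extChartAt I x₀ z) : V →L[ℝ] V)
      ((mfderiv I 𝓘(ℝ, V) (extChartAt I x₀) z : V →L[ℝ] V) v) = v := fun v =>
    (DFunLike.congr_fun hcomp v).symm
  have h3 : (β ((extChartAt I x₀).symm (extChartAt I x₀ z)) : V [⋀^Fin k]→L[ℝ] ℝ) = β z := by
    rw [hpt]
  change (β z : V [⋀^Fin k]→L[ℝ] ℝ) w =
    (β ((extChartAt I x₀).symm (extChartAt I x₀ z)) : V [⋀^Fin k]→L[ℝ] ℝ) fun i =>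
      (mfderiv 𝓘(ℝ, V) I (extChartAt I x₀).symm (extChartAt I x₀ z) : V →L[ℝ] V)
      ((mfderiv I 𝓘(ℝ, V) (extChartAt I x₀) z : V →L[ℝ] V) (w i))
  rw [h3]
  exact congrArg _ (funext fun i => (h2 (w i)).symm)

/-- `IsSmooth` asks for smoothness at all points of every preferred chart; a change of charts
reduces this to the centre of each chart. -/
theorem isSmooth_of_contDiffAt [FiniteDimensional ℝ V] {β : DForm I N k}
    (h : ∀ p, ContDiffAt ℝ ∞ (β.chartRep p) (extChartAt I p p)) : β.IsSmooth := by
  intro x₀ y hy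
  set z := (extChartAt I x₀).symm y with hz
  have hzs : z ∈ (chartAt H x₀).source := by
    rw [← extChartAt_source I]; exact (extChartAt I x₀).map_target hy
  have hy' : extChartAt I x₀ z = y := (extChartAt I x₀).right_inv hy
  rw [← hy']
  -- Near `z` the form is recovered from its representative in the chart centred at `z`, which is
  -- smooth by hypothesis.
  refine ContDiffAt.contDiffWithinAt (contDiffAt_chartRep (g := extChartAt I z)
    (b := fun z' => β.chartRep z (extChartAt I z z')) hzs contMDiffAt_extChartAt ?_ ?_)
  · exact ContMDiffAt.comp (g := β.chartRep z) z (h z).contMDiffAt contMDiffAt_extChartAt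
  · filter_upwards [chart_source_mem_nhds H z] with z' hz'
    exact β.eq_chartRep_comp hz'

theorem IsSmooth.contDiffAt {β : DForm I N k} (h : β.IsSmooth) (p : N) :
    ContDiffAt ℝ ∞ (β.chartRep p) (extChartAt I p p) :=
  (h p).contDiffAt (extChartAt_target_mem_nhds p)

end DForm

end FormsInCharts

/-! ### The tautological form on a vector space and its derivative -/

section CanonicalForms

variable {V Y : Type*} [NormedAddCommGroup V] [NormedSpace ℝ V] [NormedAddCommGroup Y]
  [NormedSpace ℝ Y] {k : ℕ}

/-- The tautological form on `V × Y`, for a family of forms on `V` parametrised linearly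
by `Y`. -/
noncomputable def linearTheta (T : Y →L[ℝ] (V [⋀^Fin k]→L[ℝ] ℝ)) :
    (V × Y) →L[ℝ] ((V × Y) [⋀^Fin k]→L[ℝ] ℝ) :=
  (ContinuousAlternatingMap.compContinuousLinearMapCLM (ContinuousLinearMap.fst ℝ V Y)).comp
    (T.comp (ContinuousLinearMap.snd ℝ V Y))

/-- The exterior derivative of `linearTheta`, a form with constant coefficients. -/
noncomputable def linearOmega (T : Y →L[ℝ] (V [⋀^Fin k]→L[ℝ] ℝ)) :
    (V × Y) [⋀^Fin (k + 1)]→L[ℝ] ℝ :=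
  ContinuousAlternatingMap.alternatizeUncurryFin (linearTheta T)

theorem linearOmega_apply (T : Y →L[ℝ] (V [⋀^Fin k]→L[ℝ] ℝ)) (w : Fin (k + 1) → V × Y) :
    linearOmega T w = ∑ i : Fin (k + 1),
      (-1 : ℤ) ^ (i : ℕ) • T (w i).2 (fun j => (i.removeNth w j).1) := by
  rw [linearOmega, ContinuousAlternatingMap.alternatizeUncurryFin_apply]
  rfl

theorem extDeriv_linearTheta (T : Y →L[ℝ] (V [⋀^Fin k]→L[ℝ] ℝ)) (w : V × Y) :
    extDeriv (fun w => linearTheta T w) w = linearOmega T := by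
  rw [extDeriv, ContinuousLinearMap.fderiv]
  rfl

variable {X : Type*} [NormedAddCommGroup X] [NormedSpace ℝ X] {H : Type*} [TopologicalSpace H]
  {I : ModelWithCorners ℝ X H} [I.Boundaryless] {N : Type*} [TopologicalSpace N]
  [ChartedSpace H N] [IsManifold I ∞ N]

/-- The exterior derivative commutes with pull-back, and that of `linearTheta T` is constant because
`linearTheta T` is linear in the point. The chart used in `extD` drops out by the chain rule. -/
theorem DForm.extD_of_linearTheta (T : Y →L[ℝ] (V [⋀^Fin k]→L[ℝ] ℝ)) {β : DForm I N k}
    {g : N → V × Y} {z : N} (hg : ContMDiffAt I 𝓘(ℝ, V × Y) ∞ g z)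
    (h : ∀ᶠ z' in 𝓝 z, β z' =
      (linearTheta T (g z')).compContinuousLinearMap (mfderiv I 𝓘(ℝ, V × Y) g z')) :
    β.extD z = (linearOmega T).compContinuousLinearMap (mfderiv I 𝓘(ℝ, V × Y) g z) := by
  have h1 := DForm.chartRep_eventuallyEq (b := fun z' => linearTheta T (g z'))
    (mem_chart_source H z) hg h
  have hs : ContMDiffAt 𝓘(ℝ, X) I ∞ (extChartAt I z).symm (extChartAt I z z) :=
    (contMDiffOn_extChartAt_symm z).contMDiffAt (extChartAt_target_mem_nhds z)
  have hz2 := (extChartAt I z).left_inv (mem_extChartAt_source (I := I) z)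
  have hg' : ContDiffAt ℝ ∞ (g ∘ (extChartAt I z).symm) (extChartAt I z z) := by
    rw [← contMDiffAt_iff_contDiffAt]
    exact ContMDiffAt.comp _ (by rwa [hz2]) hs
  have h2 := extDeriv_pullback
    (show DifferentiableAt ℝ (fun w => linearTheta T w) ((g ∘ (extChartAt I z).symm)
      (extChartAt I z z)) from (linearTheta T).differentiableAt) hg'
    (by simpa using ENat.LEInfty.out)
  rw [extDeriv_linearTheta] at h2
  have h3 : extDeriv (β.chartRep z) (extChartAt I z z) =
      (linearOmega T).compContinuousLinearMap
        (fderiv ℝ (g ∘ (extChartAt I z).symm) (extChartAt I z z)) :=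
    (Filter.EventuallyEq.extDeriv_eq h1).trans h2
  rw [DForm.extD, h3]
  have h4 : MDifferentiableAt I 𝓘(ℝ, X) (extChartAt I z) z :=
    (contMDiffAt_extChartAt (n := ∞)).mdifferentiableAt (by simp)
  have h5 := mfderiv_comp z
    (hg'.differentiableAt (by simp)).mdifferentiableAt h4
  rw [mfderiv_eq_fderiv] at h5
  have h6 : mfderiv I 𝓘(ℝ, V × Y) ((g ∘ (extChartAt I z).symm) ∘ extChartAt I z) z =
      mfderiv I 𝓘(ℝ, V × Y) g z := by
    refine Filter.EventuallyEq.mfderiv_eq ?_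
    filter_upwards [extChartAt_source_mem_nhds (I := I) z] with y hy
    exact congrArg g ((extChartAt I z).left_inv hy)
  rw [h6] at h5
  rw [h5]
  rfl

end CanonicalForms

/-! ### Darboux coordinates on 𝓜π -/

section Darboux

variable {M : Type*} [TopologicalSpace M] {E : Type*} [TopologicalSpace E]
  {m n : ℕ} [ChartedSpace (Euc m) M] [ChartedSpace (Euc (m + n)) E] {q : E → M}
  [IsSmoothFibreBundle m n q] [IsManifold (𝓡 m) ∞ M]

/-- The coordinates `(xᵅ, yᴬ; α)` of `𝓜π` in an adapted chart. -/
noncomputable def AdaptedChart.mmChart (c : AdaptedChart m n q) (z : MM m n q) :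
    (Euc m × Euc n) × ModelMM m n :=
  (c.tot z.proj, c.mmCoord z.proj z.2)

theorem AdaptedChart.contMDiffAt_tot (c : AdaptedChart m n q) {e : E} (h : e ∈ c.tot.source) :
    ContMDiffAt (𝓡 (m + n)) 𝓘(ℝ, Euc m × Euc n) ∞ c.tot e :=
  c.contMDiffOn_tot.contMDiffAt (c.tot.open_source.mem_nhds h)

theorem AdaptedChart.contMDiffAt_mmChart (c : AdaptedChart m n q) {z : MM m n q}
    (h : z.proj ∈ c.tot.source) :
    ContMDiffAt (modelMM m n) 𝓘(ℝ, (Euc m × Euc n) × ModelMM m n) ∞ c.mmChart z := by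
  have h1 : ContMDiffAt (modelMM m n) 𝓘(ℝ, Euc m × Euc n) ∞
      (fun z : MM m n q => c.tot z.proj) z :=
    (c.contMDiffAt_tot h).comp z (Bundle.contMDiff_proj _).contMDiffAt
  exact h1.prodMk_space (c.contMDiffAt_mmCoord h)

variable (m n) in
/-- The inclusion of `ModelMM m n` into the space of all `m`-forms. -/
noncomputable def modelIncl : ModelMM m n →L[ℝ] ((Euc m × Euc n) [⋀^Fin m]→L[ℝ] ℝ) :=
  (lambdaTwo (ContinuousLinearMap.fst ℝ (Euc m) (Euc n)) m).subtypeL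

theorem AdaptedChart.fst_comp_mfderiv_mmChart (c : AdaptedChart m n q) {z : MM m n q}
    (h : z.proj ∈ c.tot.source) :
    (ContinuousLinearMap.fst ℝ (Euc m × Euc n) (ModelMM m n)).comp
      (mfderiv (modelMM m n) 𝓘(ℝ, (Euc m × Euc n) × ModelMM m n) c.mmChart z) =
      (c.frame z.proj).comp
        (mfderiv (modelMM m n) (𝓡 (m + n)) (fun z : MM m n q => z.proj) z) := by
  have h1 := mfderiv_comp z (ContinuousLinearMap.fst ℝ (Euc m × Euc n)
    (ModelMM m n)).mdifferentiableAt ((c.contMDiffAt_mmChart h).mdifferentiableAt (by simp))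
  rw [ContinuousLinearMap.mfderiv_eq] at h1
  have h2 := mfderiv_comp z ((c.contMDiffAt_tot h).mdifferentiableAt (by simp))
    ((Bundle.contMDiff_proj (IB := 𝓡 (m + n)) (n := ∞) (F := ModelMM m n)
      (MMFibre m n q)).mdifferentiableAt (x := z) (by simp))
  exact h1.symm.trans h2

/-- The fibre coordinate of `z` is its form pulled back by the inverse frame, while the differential
of the (x, y)-coordinates brings in the frame; the two cancel. -/
theorem AdaptedChart.liouville_eq (c : AdaptedChart m n q) {z : MM m n q}
    (h : z.proj ∈ c.tot.source) :
    liouville m n q z = (linearTheta (modelIncl m n) (c.mmChart z)).compContinuousLinearMap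
      (mfderiv (modelMM m n) 𝓘(ℝ, (Euc m × Euc n) × ModelMM m n) c.mmChart z) := by
  ext w
  have h1 := c.fst_comp_mfderiv_mmChart h
  have h2 : (linearTheta (modelIncl m n) (c.mmChart z)).compContinuousLinearMap
      (mfderiv (modelMM m n) 𝓘(ℝ, (Euc m × Euc n) × ModelMM m n) c.mmChart z) w =
      z.2.1 (fun i => (c.frame z.proj).inverse ((c.frame z.proj)
        (mfderiv (modelMM m n) (𝓡 (m + n)) (fun z : MM m n q => z.proj) z (w i)))) := by
    have h3 : (linearTheta (modelIncl m n) (c.mmChart z)).compContinuousLinearMap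
      (mfderiv (modelMM m n) 𝓘(ℝ, (Euc m × Euc n) × ModelMM m n) c.mmChart z) w =
      (c.mmCoord z.proj z.2).1 (fun i => (mfderiv (modelMM m n)
        𝓘(ℝ, (Euc m × Euc n) × ModelMM m n) c.mmChart z (w i)).1) := rfl
    rw [h3, mmCoord_of_mem c h]
    refine congrArg z.2.1 (funext fun i => ?_)
    exact congrArg (c.frame z.proj).inverse (DFunLike.congr_fun h1 (w i))
  rw [h2]
  exact congrArg z.2.1 (funext fun i =>
    ((c.frame_isInvertible h).inverse_apply_self _).symm)

/-- The Darboux normal form: Ω has constant coefficients in these coordinates, so its algebraic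
properties can be checked on `linearOmega`. -/
theorem AdaptedChart.multisymplectic_eq [IsManifold (𝓡 (m + n)) ∞ E] (c : AdaptedChart m n q)
    {z : MM m n q} (h : z.proj ∈ c.tot.source) :
    multisymplectic m n q z = -(linearOmega (modelIncl m n)).compContinuousLinearMap
      (mfderiv (modelMM m n) 𝓘(ℝ, (Euc m × Euc n) × ModelMM m n) c.mmChart z) := by
  refine congrArg Neg.neg ?_
  refine DForm.extD_of_linearTheta (modelIncl m n) (c.contMDiffAt_mmChart h) ?_
  have ho : IsOpen {z : MM m n q | z.proj ∈ c.tot.source} := c.mmTriv.open_source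
  filter_upwards [ho.mem_nhds h] with z' hz'
  exact c.liouville_eq hz'

/-- The canonical form vanishes on three vectors that are vertical over the base. -/
theorem linearOmega_eq_zero (w : Fin (m + 1) → (Euc m × Euc n) × ModelMM m n)
    {S : Finset (Fin (m + 1))} (hS : 3 ≤ S.card) (h : ∀ i ∈ S, (w i).1.1 = 0) :
    linearOmega (modelIncl m n) w = 0 := by
  rw [linearOmega_apply]
  refine Finset.sum_eq_zero fun i _ => ?_
  -- Summand `i` sees slot `i` only through its fibre component, so two of the three vertical slots
  -- remain as arguments of a form in Λ₂ᵐ.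
  have h1 : 1 < (S.erase i).card := by
    have := Finset.pred_card_le_card_erase (s := S) (a := i)
    omega
  obtain ⟨a, ha, b, hb, hab⟩ := Finset.one_lt_card.1 h1
  rw [Finset.mem_erase] at ha hb
  obtain ⟨a', rfl⟩ := Fin.exists_succAbove_eq ha.1
  obtain ⟨b', rfl⟩ := Fin.exists_succAbove_eq hb.1
  have h2 : modelIncl m n (w i).2 (fun j => (i.removeNth w j).1) = 0 :=
    (w i).2.2 _ a' b' (fun hne => hab (congrArg _ hne)) (h _ ha.2) (h _ hb.2)
  rw [h2, smul_zero]

end Darboux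

/-! ### The Lagrangian and its momenta in adapted coordinates -/

section LegendreCoordinates

variable {M : Type*} [TopologicalSpace M] {E : Type*} [TopologicalSpace E]
  {m n : ℕ} [ChartedSpace (Euc m) M] [ChartedSpace (Euc (m + n)) E] {q : E → M}

/-- The coordinate expression `X ↦ (∂L/∂v^A_α)(Xᴬ - v^A_β X^β) ∂/∂xᵅ` of `momentum`. -/
noncomputable def momentumCoord (lam : (Euc m →L[ℝ] Euc n) →L[ℝ] ℝ) (v : Euc m →L[ℝ] Euc n) :
    Euc m × Euc n →L[ℝ] Euc m :=
  ∑ ν : Fin m, ((lam.comp ((ContinuousLinearMap.smulRightL ℝ (Euc m) (Euc n)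
    (EuclideanSpace.proj ν : Euc m →L[ℝ] ℝ)))).comp
      (ContinuousLinearMap.snd ℝ (Euc m) (Euc n) -
        v.comp (ContinuousLinearMap.fst ℝ (Euc m) (Euc n)))).smulRight
        (EuclideanSpace.single ν (1 : ℝ) : Euc m)

theorem momentumCoord_apply (lam : (Euc m →L[ℝ] Euc n) →L[ℝ] ℝ) (v : Euc m →L[ℝ] Euc n)
    (X : Euc m × Euc n) : momentumCoord lam v X =
      ∑ ν : Fin m, lam ((EuclideanSpace.proj ν : Euc m →L[ℝ] ℝ).smulRight (X.2 - v X.1)) •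
        (EuclideanSpace.single ν (1 : ℝ) : Euc m) := by
  rw [momentumCoord, sum_apply]
  rfl

theorem momentumCoord_apply_coord (lam : (Euc m →L[ℝ] Euc n) →L[ℝ] ℝ) (v : Euc m →L[ℝ] Euc n)
    (X : Euc m × Euc n) (ν : Fin m) : momentumCoord lam v X ν =
      lam ((EuclideanSpace.proj ν : Euc m →L[ℝ] ℝ).smulRight (X.2 - v X.1)) := by
  rw [momentumCoord_apply]
  simp [Pi.single_apply]

theorem contDiff_momentumCoord :
    ContDiff ℝ ∞ fun p : ((Euc m →L[ℝ] Euc n) →L[ℝ] ℝ) × (Euc m →L[ℝ] Euc n) =>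
      momentumCoord p.1 p.2 := by
  refine contDiff_clm_apply_iff.2 fun X => ?_
  simp only [momentumCoord_apply]
  refine ContDiff.sum fun ν _ => ?_
  have h : ContDiff ℝ ∞ fun p : ((Euc m →L[ℝ] Euc n) →L[ℝ] ℝ) × (Euc m →L[ℝ] Euc n) =>
      p.1 ((EuclideanSpace.proj ν : Euc m →L[ℝ] ℝ).smulRight (X.2 - p.2 X.1)) := ?_
  · exact h.smul contDiff_const
  refine contDiff_fst.clm_apply ?_
  refine (ContinuousLinearMap.smulRightL ℝ (Euc m) (Euc n)
    (EuclideanSpace.proj ν : Euc m →L[ℝ] ℝ)).contDiff.comp ?_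
  exact contDiff_const.sub (contDiff_snd.clm_apply contDiff_const)

/-- The coordinate expression of `cartanValue`. -/
noncomputable def cartanCoord (η : Euc m [⋀^Fin m]→L[ℝ] ℝ) (lam : (Euc m →L[ℝ] Euc n) →L[ℝ] ℝ)
    (v : Euc m →L[ℝ] Euc n) (l : ℝ) : (Euc m × Euc n) [⋀^Fin m]→L[ℝ] ℝ :=
  insertForm η (ContinuousLinearMap.fst ℝ (Euc m) (Euc n)) (momentumCoord lam v) +
    l • η.compContinuousLinearMap (ContinuousLinearMap.fst ℝ (Euc m) (Euc n))

theorem sum_proj_smul (ξ : Euc m →L[ℝ] ℝ) :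
    ∑ μ, ξ (EuclideanSpace.single μ 1) • (EuclideanSpace.proj μ : Euc m →L[ℝ] ℝ) = ξ := by
  ext u
  have h : u = ∑ μ, u μ • (EuclideanSpace.single μ 1 : Euc m) := by
    ext l
    simp [Pi.single_apply]
  conv_rhs => rw [h]
  simp [mul_comm]

/-- The vector that represents a functional on covectors does not depend on the frame. -/
theorem sum_single_comp (a : (Euc m →L[ℝ] ℝ) →ₗ[ℝ] ℝ) (B : Euc m →L[ℝ] Euc m) :
    ∑ ν : Fin m, a ((EuclideanSpace.proj ν : Euc m →L[ℝ] ℝ).comp B) •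
      (EuclideanSpace.single ν (1 : ℝ) : Euc m) =
    B (∑ μ : Fin m, a (EuclideanSpace.proj μ : Euc m →L[ℝ] ℝ) •
      (EuclideanSpace.single μ (1 : ℝ) : Euc m)) := by
  ext ν
  have h := sum_proj_smul ((EuclideanSpace.proj ν : Euc m →L[ℝ] ℝ).comp B)
  have h1 : (∑ ν : Fin m, a ((EuclideanSpace.proj ν : Euc m →L[ℝ] ℝ).comp B) •
      (EuclideanSpace.single ν (1 : ℝ) : Euc m)) ν =
      a ((EuclideanSpace.proj ν : Euc m →L[ℝ] ℝ).comp B) := by simp [Pi.single_apply]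
  rw [h1, ← h]
  simp [mul_comm]

variable [IsSmoothFibreBundle m n q] [IsManifold (𝓡 m) ∞ M]

/-- The derivative `∂L/∂v^A_α` in an adapted chart. -/
noncomputable def AdaptedChart.fibreDeriv (c : AdaptedChart m n q) (L : J1 m n q → ℝ)
    (z : J1 m n q) : (Euc m →L[ℝ] Euc n) →L[ℝ] ℝ :=
  fderiv ℝ (fun v => L ⟨z.proj, c.jetCoordSymm z.proj v⟩) (c.jetCoord z.proj z.2)

/-- The coordinate expression of a form of top degree on the base. -/
noncomputable def AdaptedChart.baseForm (c : AdaptedChart m n q) (η : DForm (𝓡 m) M m) (x : M) :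
    Euc m [⋀^Fin m]→L[ℝ] ℝ :=
  (η x).compContinuousLinearMap (c.baseFrame x).inverse

/-- The coordinate expression of a map `T_x M → V_e E`. -/
noncomputable def AdaptedChart.vertCoord (c : AdaptedChart m n q) (e : E) :
    (Euc m →L[ℝ] vertSpace m n q e) →L[ℝ] (Euc m →L[ℝ] Euc n) :=
  (ContinuousLinearMap.precomp (Euc n)
    ((c.baseFrame (q e)).inverse : Euc m →L[ℝ] Euc m)).comp
  (ContinuousLinearMap.postcomp (Euc m)
    (((ContinuousLinearMap.snd ℝ (Euc m) (Euc n)).comp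
      (c.frame e : Euc (m + n) →L[ℝ] Euc m × Euc n)).comp (vertSpace m n q e).subtypeL))

theorem AdaptedChart.jetCoord_translate (c : AdaptedChart m n q) {e : E} (φ : JetFibre m n q e)
    (A : Euc m →L[ℝ] vertSpace m n q e) :
    c.jetCoord e (φ.translate A) = c.jetCoord e φ + c.vertCoord e A := by
  refine ContinuousLinearMap.ext fun u => ?_
  change (c.frame e (φ.lift ((c.baseFrame (q e)).inverse u) +
    (A ((c.baseFrame (q e)).inverse u) : Euc (m + n)))).2 = _
  exact (congrArg Prod.snd (map_add (c.frame e) _ _)).trans rfl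

/-- Presents translation of jets as an affine map of coordinate spaces, the form in which
`vertDeriv` can be differentiated. -/
theorem AdaptedChart.mk_translate (c : AdaptedChart m n q) {e : E} (he : e ∈ c.tot.source)
    (φ : JetFibre m n q e) (A : Euc m →L[ℝ] vertSpace m n q e) :
    φ.translate A = c.jetCoordSymm e (c.jetCoord e φ + c.vertCoord e A) := by
  rw [jetCoordSymm_of_mem c he, ← c.jetCoord_translate, jetOfCoord_jetCoord]

/-- The Lagrangian in an adapted chart. -/
noncomputable def AdaptedChart.lagrangianCoord (c : AdaptedChart m n q) (L : J1 m n q → ℝ)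
    (p : (Euc m × Euc n) × (Euc m →L[ℝ] Euc n)) : ℝ :=
  L ⟨c.tot.symm p.1, c.jetCoordSymm (c.tot.symm p.1) p.2⟩

theorem AdaptedChart.contMDiffAt_jetMk (c : AdaptedChart m n q)
    {p : E × (Euc m →L[ℝ] Euc n)} (h : p.1 ∈ c.tot.source) :
    ContMDiffAt (modelJ1 m n) (modelJ1 m n) ∞
      (fun p : E × (Euc m →L[ℝ] Euc n) => (⟨p.1, c.jetCoordSymm p.1 p.2⟩ : J1 m n q)) p :=
  c.contMDiffOn_jetTriv_symm.contMDiffAt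
    (c.jetTriv.open_target.mem_nhds (show p ∈ c.jetTriv.target from ⟨h, mem_univ _⟩))

theorem AdaptedChart.contDiffAt_lagrangianCoord (c : AdaptedChart m n q) {L : J1 m n q → ℝ}
    (hL : ContMDiff (modelJ1 m n) 𝓘(ℝ, ℝ) ∞ L)
    {p : (Euc m × Euc n) × (Euc m →L[ℝ] Euc n)} (h : p.1 ∈ c.tot.target) :
    ContDiffAt ℝ ∞ (c.lagrangianCoord L) p := by
  rw [← contMDiffAt_iff_contDiffAt]
  have h1 : ContMDiffAt 𝓘(ℝ, (Euc m × Euc n) × (Euc m →L[ℝ] Euc n)) (𝓡 (m + n)) ∞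
      (fun p : (Euc m × Euc n) × (Euc m →L[ℝ] Euc n) => c.tot.symm p.1) p :=
    (c.contMDiffOn_tot_symm.contMDiffAt (c.tot.open_target.mem_nhds h)).comp p
      contDiff_fst.contMDiff.contMDiffAt
  have h2 : ContMDiffAt 𝓘(ℝ, (Euc m × Euc n) × (Euc m →L[ℝ] Euc n))
      𝓘(ℝ, Euc m →L[ℝ] Euc n) ∞
      (fun p : (Euc m × Euc n) × (Euc m →L[ℝ] Euc n) => p.2) p :=
    contDiff_snd.contMDiff.contMDiffAt
  have h3 := (c.contMDiffAt_jetMk (p := (c.tot.symm p.1, p.2)) (c.tot.map_target h)).comp p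
    (h1.prodMk h2)
  exact hL.contMDiffAt.comp p h3

theorem AdaptedChart.lagrangianCoord_tot (c : AdaptedChart m n q) (L : J1 m n q → ℝ) {e : E}
    (he : e ∈ c.tot.source) (v : Euc m →L[ℝ] Euc n) :
    c.lagrangianCoord L (c.tot e, v) = L ⟨e, c.jetCoordSymm e v⟩ := by
  rw [lagrangianCoord, c.tot.left_inv he]

theorem AdaptedChart.contDiff_fibreLagrangian (c : AdaptedChart m n q) {L : J1 m n q → ℝ}
    (hL : ContMDiff (modelJ1 m n) 𝓘(ℝ, ℝ) ∞ L) {e : E} (he : e ∈ c.tot.source) :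
    ContDiff ℝ ∞ fun v => L ⟨e, c.jetCoordSymm e v⟩ := by
  rw [contDiff_iff_contDiffAt]
  intro v
  have h := (c.contDiffAt_lagrangianCoord hL (p := (c.tot e, v)) (c.tot.map_source he)).comp v
    (contDiff_prodMk_right (c.tot e)).contDiffAt
  exact h.congr_of_eventuallyEq (.of_forall fun v => (c.lagrangianCoord_tot L he v).symm)

/-- Rewrites the fibre derivative as a partial derivative of one function on an open subset of a
vector space, so that its smooth dependence on the base point becomes visible. -/
theorem AdaptedChart.fibreDeriv_eq (c : AdaptedChart m n q) {L : J1 m n q → ℝ}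
    (hL : ContMDiff (modelJ1 m n) 𝓘(ℝ, ℝ) ∞ L) {z : J1 m n q} (hz : z.proj ∈ c.tot.source) :
    c.fibreDeriv L z = (fderiv ℝ (c.lagrangianCoord L)
      (c.tot z.proj, c.jetCoord z.proj z.2)).comp
        (ContinuousLinearMap.inr ℝ (Euc m × Euc n) (Euc m →L[ℝ] Euc n)) := by
  have h1 := (c.contDiffAt_lagrangianCoord hL (p := (c.tot z.proj, c.jetCoord z.proj z.2))
    (c.tot.map_source hz)).differentiableAt (by simp)
  have h2 := h1.hasFDerivAt.comp (c.jetCoord z.proj z.2)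
    (hasFDerivAt_prodMk_right (𝕜 := ℝ) (c.tot z.proj) (c.jetCoord z.proj z.2))
  have h3 : (fun v => L ⟨z.proj, c.jetCoordSymm z.proj v⟩) =
      c.lagrangianCoord L ∘ fun v => (c.tot z.proj, v) :=
    funext fun v => (c.lagrangianCoord_tot L hz v).symm
  rw [fibreDeriv, h3]
  exact h2.fderiv

/-- Translation is affine in coordinates, so the chain rule only inserts its linear part
`vertCoord`. -/
theorem AdaptedChart.vertDeriv_eq (c : AdaptedChart m n q) {L : J1 m n q → ℝ}
    (hL : ContMDiff (modelJ1 m n) 𝓘(ℝ, ℝ) ∞ L) {z : J1 m n q} (hz : z.proj ∈ c.tot.source) :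
    vertDeriv L z = (c.fibreDeriv L z).comp (c.vertCoord z.proj) := by
  have h1 : (fun A => L ⟨z.proj, z.2.translate A⟩) =
      (fun v => L ⟨z.proj, c.jetCoordSymm z.proj v⟩) ∘
        fun A => c.jetCoord z.proj z.2 + c.vertCoord z.proj A :=
    funext fun A => congrArg (fun φ => L ⟨z.proj, φ⟩) (c.mk_translate hz z.2 A)
  rw [vertDeriv, h1]
  have h2 : HasFDerivAt (fun A => c.jetCoord z.proj z.2 + c.vertCoord z.proj A)
      (c.vertCoord z.proj) 0 := (c.vertCoord z.proj).hasFDerivAt.const_add _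
  have h3 : HasFDerivAt (fun v => L ⟨z.proj, c.jetCoordSymm z.proj v⟩) (c.fibreDeriv L z)
      (c.jetCoord z.proj z.2 + c.vertCoord z.proj 0) := by
    rw [map_zero, add_zero]
    exact ((c.contDiff_fibreLagrangian hL hz).differentiable (by simp) _).hasFDerivAt
  exact (h3.comp 0 h2).fderiv

end LegendreCoordinates

/-! ### Coordinate form and smoothness of the extended Legendre map -/

section LegendreSmooth

theorem insertForm_comp {V V' W W' : Type*} [NormedAddCommGroup V] [NormedSpace ℝ V]
    [NormedAddCommGroup V'] [NormedSpace ℝ V'] [NormedAddCommGroup W] [NormedSpace ℝ W]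
    [NormedAddCommGroup W'] [NormedSpace ℝ W'] {k : ℕ} (η : W [⋀^Fin k]→L[ℝ] ℝ) (P C : V →L[ℝ] W)
    (A : V' →L[ℝ] V) (B : W' →L[ℝ] W) (P' C' : V' →L[ℝ] W') (w : Fin k → V')
    (hP : ∀ i, P (A (w i)) = B (P' (w i))) (hC : ∀ i, C (A (w i)) = B (C' (w i))) :
    insertForm η P C (fun i => A (w i)) =
      insertForm (η.compContinuousLinearMap B) P' C' w := by
  rw [insertForm_apply, insertForm_apply]
  refine Finset.sum_congr rfl fun i _ => congrArg η (funext fun j => ?_)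
  rcases eq_or_ne j i with rfl | h
  · simpa using hC j
  · simpa [h] using hP j

variable {M : Type*} [TopologicalSpace M] {E : Type*} [TopologicalSpace E]
  {m n : ℕ} [ChartedSpace (Euc m) M] [ChartedSpace (Euc (m + n)) E] {q : E → M}
  [IsSmoothFibreBundle m n q] [IsManifold (𝓡 m) ∞ M]

/-- `vertPart` subtracts the jet's lift of the projected vector; in coordinates this gives the
contact forms dyᴬ - v^A_β dx^β. -/
theorem AdaptedChart.frame_vertPart (c : AdaptedChart m n q) {e : E} (he : e ∈ c.tot.source)
    (φ : JetFibre m n q e) (Z : Euc (m + n)) :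
    (c.frame e (φ.vertPart Z : Euc (m + n))).2 =
      (c.frame e Z).2 - c.jetCoord e φ (c.frame e Z).1 := by
  have h1 : (c.frame e (φ.vertPart Z : Euc (m + n))).2 =
      (c.frame e Z).2 - (c.frame e (φ.lift (dproj m n q e Z))).2 :=
    (congrArg Prod.snd (map_sub (c.frame e) _ _)).trans rfl
  have h2 : (c.frame e Z).1 = c.baseFrame (q e) (dproj m n q e Z) :=
    DFunLike.congr_fun (c.fst_comp_frame he) Z
  have h3 : c.jetCoord e φ (c.frame e Z).1 = (c.frame e (φ.lift (dproj m n q e Z))).2 := by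
    rw [h2]
    exact congrArg (fun u : Euc m => (c.frame e (φ.lift u)).2)
      ((c.baseFrame_isInvertible (c.mapsTo e he)).inverse_apply_self (dproj m n q e Z))
  rw [h1, h3]

/-- `momentum` sums over the standard basis of the model tangent space of M, `momentumCoord` over
the coordinate basis of the chart. That they correspond is the frame independence in
`sum_single_comp`. -/
theorem AdaptedChart.momentum_eq (c : AdaptedChart m n q) {L : J1 m n q → ℝ}
    (hL : ContMDiff (modelJ1 m n) 𝓘(ℝ, ℝ) ∞ L) {z : J1 m n q} (hz : z.proj ∈ c.tot.source)
    (Z : Euc (m + n)) : momentum L z Z = (c.baseFrame (q z.proj)).inverse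
      (momentumCoord (c.fibreDeriv L z) (c.jetCoord z.proj z.2) (c.frame z.proj Z)) := by
  set y : Euc n := (c.frame z.proj Z).2 - c.jetCoord z.proj z.2 (c.frame z.proj Z).1 with hy
  -- With the vertical vector `y` fixed, the momenta give a functional on covectors of the base, and
  -- the momentum is the vector representing it.
  let a : (Euc m →L[ℝ] ℝ) →ₗ[ℝ] ℝ :=
    { toFun := fun ξ => c.fibreDeriv L z (ξ.smulRight y)
      map_add' := fun ξ ξ' => by
        rw [← map_add]
        exact congrArg _ (ContinuousLinearMap.ext fun u => add_smul (ξ u) (ξ' u) y)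
      map_smul' := fun r ξ => by
        rw [RingHom.id_apply, ← map_smul]
        exact congrArg _ (ContinuousLinearMap.ext fun u => mul_smul r (ξ u) y) }
  have h := sum_single_comp a (c.baseFrame (q z.proj)).inverse
  rw [momentum_apply, momentumCoord_apply]
  refine Eq.trans (Finset.sum_congr rfl fun ν _ => ?_) h
  refine congrArg (· • (EuclideanSpace.single ν (1 : ℝ) : Euc m)) ?_
  rw [c.vertDeriv_eq hL hz]
  refine congrArg (c.fibreDeriv L z) (ContinuousLinearMap.ext fun u => ?_)
  let r : ℝ := (EuclideanSpace.proj ν : Euc m →L[ℝ] ℝ) ((c.baseFrame (q z.proj)).inverse u)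
  have h1 : c.frame z.proj (r • (z.2.vertPart Z : Euc (m + n))) =
      r • c.frame z.proj (z.2.vertPart Z : Euc (m + n)) := map_smul (c.frame z.proj) _ _
  refine (congrArg Prod.snd h1).trans ?_
  exact congrArg (r • ·) (c.frame_vertPart hz z.2 Z)

/-- Both parts of the Poincaré–Cartan form, the inserted momentum and the multiple of η, are natural
under the change from tangent vectors to coordinates. -/
theorem AdaptedChart.mmCoord_extendedLegendre (c : AdaptedChart m n q) (η : DForm (𝓡 m) M m)
    {L : J1 m n q → ℝ} (hL : ContMDiff (modelJ1 m n) 𝓘(ℝ, ℝ) ∞ L) {z : J1 m n q}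
    (hz : z.proj ∈ c.tot.source) :
    (c.mmCoord z.proj (extendedLegendre η L z).2).1 =
      cartanCoord (c.baseForm η (q z.proj)) (c.fibreDeriv L z) (c.jetCoord z.proj z.2) (L z) := by
  rw [mmCoord_of_mem c hz]
  ext w
  have h1 : ∀ i, dproj m n q z.proj ((c.frame z.proj).inverse (w i)) =
      (c.baseFrame (q z.proj)).inverse (w i).1 := fun i =>
    DFunLike.congr_fun (c.mfderiv_comp_coframe hz) (w i)
  have h2 : ∀ i, momentum L z ((c.frame z.proj).inverse (w i)) =
      (c.baseFrame (q z.proj)).inverse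
        (momentumCoord (c.fibreDeriv L z) (c.jetCoord z.proj z.2) (w i)) := fun i =>
    (c.momentum_eq hL hz _).trans
      (by rw [(c.frame_isInvertible hz).self_apply_inverse])
  have h3 := insertForm_comp (η (q z.proj) : Euc m [⋀^Fin m]→L[ℝ] ℝ) (dproj m n q z.proj)
    (momentum L z) (c.frame z.proj).inverse (c.baseFrame (q z.proj)).inverse
    (ContinuousLinearMap.fst ℝ (Euc m) (Euc n))
    (momentumCoord (c.fibreDeriv L z) (c.jetCoord z.proj z.2)) w h1 h2
  exact congrArg₂ (· + ·) h3 (congrArg (fun u : Fin m → Euc m =>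
    L z * (η (q z.proj) : Euc m [⋀^Fin m]→L[ℝ] ℝ) u) (funext h1))

/-- Smoothness of η is formulated in the preferred charts of M, whereas the base chart of `c` is
arbitrary. Near `x` the expression is the preferred representative pulled back along the transition
map. -/
theorem AdaptedChart.contMDiffAt_baseForm (c : AdaptedChart m n q) {η : DForm (𝓡 m) M m}
    (hη : η.IsSmooth) {x : M} (hx : x ∈ c.base.source) :
    ContMDiffAt (𝓡 m) 𝓘(ℝ, Euc m [⋀^Fin m]→L[ℝ] ℝ) ∞ (c.baseForm η) x := by
  have hb : ContMDiffAt (𝓡 m) 𝓘(ℝ, Euc m) ∞ c.base x :=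
    c.contMDiffOn_base.contMDiffAt (c.base.open_source.mem_nhds hx)
  have hbs : ∀ {x}, x ∈ c.base.source →
      ContMDiffAt 𝓘(ℝ, Euc m) (𝓡 m) ∞ c.base.symm (c.base x) := fun hx =>
    c.contMDiffOn_base_symm.contMDiffAt (c.base.open_target.mem_nhds (c.base.map_source hx))
  let ψ := extChartAt (𝓡 m) x
  have hψ : ∀ {x'}, x' ∈ (chartAt (Euc m) x).source → ContMDiffAt (𝓡 m) 𝓘(ℝ, Euc m) ∞ ψ x' :=
    fun h => contMDiffAt_extChartAt' h
  have h1 : ContDiffAt ℝ ∞ (ψ ∘ c.base.symm) (c.base x) := by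
    rw [← contMDiffAt_iff_contDiffAt]
    refine ContMDiffAt.comp _ ?_ (hbs hx)
    rw [c.base.left_inv hx]
    exact hψ (mem_chart_source _ x)
  have h2 : ContDiffAt ℝ ∞ (fun y => (η.chartRep x ((ψ ∘ c.base.symm) y)).compContinuousLinearMap
      (fderiv ℝ (ψ ∘ c.base.symm) y)) (c.base x) := by
    refine ContDiffAt.form_comp ?_ (h1.fderiv_right (by simp))
    refine ContDiffAt.comp (g := η.chartRep x) _ ?_ h1
    rw [Function.comp_apply, c.base.left_inv hx]
    exact hη.contDiffAt x
  refine (h2.contMDiffAt.comp x hb).congr_of_eventuallyEq ?_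
  filter_upwards [c.base.open_source.mem_nhds hx, chart_source_mem_nhds (Euc m) x] with x' hx' hx2
  have h3 := η.eq_chartRep_comp hx2
  have h4 := mfderiv_comp (c.base x') (I' := 𝓡 m) (g := ψ) (f := c.base.symm) (by
    rw [c.base.left_inv hx']
    exact (hψ hx2).mdifferentiableAt (by simp)) ((hbs hx').mdifferentiableAt (by simp))
  have h5 := c.base_mdifferentiable.symm_comp_deriv hx'
  rw [mfderiv_eq_fderiv] at h4
  have h6 : ∀ u : Euc m, (mfderiv 𝓘(ℝ, Euc m) (𝓡 m) c.base.symm (c.base x') : Euc m →L[ℝ] Euc m)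
      u = (c.baseFrame x').inverse u := by
    intro u
    obtain ⟨u', rfl⟩ := (c.baseFrame_isInvertible hx').surjective u
    rw [(c.baseFrame_isInvertible hx').inverse_apply_self]
    exact DFunLike.congr_fun h5 u'
  ext w
  have h7 : c.base.symm (c.base x') = x' := c.base.left_inv hx'
  change (η x' : Euc m [⋀^Fin m]→L[ℝ] ℝ) (fun i => (c.baseFrame x').inverse (w i)) =
    η.chartRep x (ψ (c.base.symm (c.base x')))
      (fun i => fderiv ℝ (ψ ∘ c.base.symm) (c.base x') (w i))
  rw [h3, h7]
  refine congrArg (η.chartRep x (ψ x')) (funext fun i => ?_)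
  refine Eq.trans ?_ (DFunLike.congr_fun h4 (w i)).symm
  refine Eq.trans ?_ (congrArg (mfderiv (𝓡 m) 𝓘(ℝ, Euc m) ψ (c.base.symm (c.base x')) :
    Euc m →L[ℝ] Euc m) (h6 (w i)).symm)
  rw [h7]
  rfl

theorem AdaptedChart.contMDiffAt_fibreDeriv (c : AdaptedChart m n q) {L : J1 m n q → ℝ}
    (hL : ContMDiff (modelJ1 m n) 𝓘(ℝ, ℝ) ∞ L) {z : J1 m n q} (hz : z.proj ∈ c.tot.source) :
    ContMDiffAt (modelJ1 m n) 𝓘(ℝ, (Euc m →L[ℝ] Euc n) →L[ℝ] ℝ) ∞ (c.fibreDeriv L) z := by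
  have h1 : ContMDiffAt (modelJ1 m n) 𝓘(ℝ, (Euc m × Euc n) × (Euc m →L[ℝ] Euc n)) ∞
      (fun z : J1 m n q => (c.tot z.proj, c.jetCoord z.proj z.2)) z := by
    have h : ContMDiffAt (modelJ1 m n) 𝓘(ℝ, Euc m × Euc n) ∞
      (fun z : J1 m n q => c.tot z.proj) z :=
      (c.contMDiffAt_tot hz).comp z (Bundle.contMDiff_proj _).contMDiffAt
    exact h.prodMk_space (c.contMDiffAt_jetCoord hz)
  have h2 : ContDiffAt ℝ ∞ (fderiv ℝ (c.lagrangianCoord L))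
      (c.tot z.proj, c.jetCoord z.proj z.2) :=
    (c.contDiffAt_lagrangianCoord hL (c.tot.map_source hz)).fderiv_right (by simp)
  have h3 : ContMDiffAt (modelJ1 m n)
      𝓘(ℝ, ((Euc m × Euc n) × (Euc m →L[ℝ] Euc n)) →L[ℝ] ℝ) ∞
      (fun z : J1 m n q => fderiv ℝ (c.lagrangianCoord L)
        (c.tot z.proj, c.jetCoord z.proj z.2)) z := h2.contMDiffAt.comp z h1
  refine (h3.clm_comp (contMDiffAt_const (c := ContinuousLinearMap.inr ℝ (Euc m × Euc n)
    (Euc m →L[ℝ] Euc n)))).congr_of_eventuallyEq ?_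
  have ho : IsOpen {z : J1 m n q | z.proj ∈ c.tot.source} := c.jetTriv.open_source
  filter_upwards [ho.mem_nhds hz] with z' hz'
  exact c.fibreDeriv_eq hL hz'

theorem ContMDiffAt.cartan {X H N : Type*} [NormedAddCommGroup X] [NormedSpace ℝ X]
    [TopologicalSpace H] {I : ModelWithCorners ℝ X H} [TopologicalSpace N] [ChartedSpace H N] {x : N}
    {η : N → Euc m [⋀^Fin m]→L[ℝ] ℝ} {S : N → Euc m × Euc n →L[ℝ] Euc m} {l : N → ℝ}
    (hη : ContMDiffAt I 𝓘(ℝ, Euc m [⋀^Fin m]→L[ℝ] ℝ) ∞ η x)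
    (hS : ContMDiffAt I 𝓘(ℝ, Euc m × Euc n →L[ℝ] Euc m) ∞ S x)
    (hl : ContMDiffAt I 𝓘(ℝ, ℝ) ∞ l x) :
    ContMDiffAt I 𝓘(ℝ, (Euc m × Euc n) [⋀^Fin m]→L[ℝ] ℝ) ∞ (fun y =>
      insertForm (η y) (ContinuousLinearMap.fst ℝ (Euc m) (Euc n)) (S y) +
      l y • (η y).compContinuousLinearMap (ContinuousLinearMap.fst ℝ (Euc m) (Euc n))) x := by
  have h4 := hη.form_insert (ContinuousLinearMap.fst ℝ (Euc m) (Euc n)) hS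
  have h5 := hη.form_comp (contMDiffAt_const (c := ContinuousLinearMap.fst ℝ (Euc m) (Euc n)))
  have h6 := hl.smul h5
  exact h4.add h6

theorem ContMDiffAt.momentumCoord {X H N : Type*} [NormedAddCommGroup X] [NormedSpace ℝ X]
    [TopologicalSpace H] {I : ModelWithCorners ℝ X H} [TopologicalSpace N] [ChartedSpace H N] {x : N}
    {lam : N → (Euc m →L[ℝ] Euc n) →L[ℝ] ℝ} {v : N → Euc m →L[ℝ] Euc n}
    (hl : ContMDiffAt I 𝓘(ℝ, (Euc m →L[ℝ] Euc n) →L[ℝ] ℝ) ∞ lam x)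
    (hv : ContMDiffAt I 𝓘(ℝ, Euc m →L[ℝ] Euc n) ∞ v x) :
    ContMDiffAt I 𝓘(ℝ, Euc m × Euc n →L[ℝ] Euc m) ∞
      (fun y => _root_.momentumCoord (lam y) (v y)) x := by
  have h : ContDiffAt ℝ ∞ (fun p : ((Euc m →L[ℝ] Euc n) →L[ℝ] ℝ) × (Euc m →L[ℝ] Euc n) =>
    _root_.momentumCoord p.1 p.2) (lam x, v x) := contDiff_momentumCoord.contDiffAt
  have h' := h.contMDiffAt.comp x (hl.prodMk_space hv)
  exact h'

theorem contMDiff_extendedLegendre {η : DForm (𝓡 m) M m} (hη : η.IsSmooth) {L : J1 m n q → ℝ}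
    (hL : ContMDiff (modelJ1 m n) 𝓘(ℝ, ℝ) ∞ L) :
    ContMDiff (modelJ1 m n) (modelMM m n) ∞ (extendedLegendre η L) := by
  intro z
  let c := adaptedChartAt m n q z.proj
  have hz : z.proj ∈ c.tot.source := mem_adaptedChartAt m n q _
  have hp : ContMDiffAt (modelJ1 m n) (𝓡 (m + n)) ∞ (fun z : J1 m n q => z.proj) z :=
    (Bundle.contMDiff_proj _).contMDiffAt
  refine (c.contMDiffAt_mm_iff (f := extendedLegendre η L) hz).2 ⟨hp, ?_⟩
  have hq : ContMDiffAt (modelJ1 m n) (𝓡 m) ∞ (fun z : J1 m n q => q z.proj) z :=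
    (IsSmoothFibreBundle.contMDiff (m := m) (n := n)).contMDiffAt.comp z hp
  have h1 : ContMDiffAt (modelJ1 m n) 𝓘(ℝ, Euc m [⋀^Fin m]→L[ℝ] ℝ) ∞
      (fun z : J1 m n q => c.baseForm η (q z.proj)) z :=
    (c.contMDiffAt_baseForm hη (c.mapsTo _ hz)).comp z hq
  have h2 : ContMDiffAt (modelJ1 m n) 𝓘(ℝ, Euc m × Euc n →L[ℝ] Euc m) ∞
      (fun z : J1 m n q => momentumCoord (c.fibreDeriv L z) (c.jetCoord z.proj z.2)) z :=
    (c.contMDiffAt_fibreDeriv hL hz).momentumCoord (c.contMDiffAt_jetCoord hz)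
  have h3 := h1.cartan h2 (hL.contMDiffAt (x := z))
  -- The smoothness obtained so far is in the space of all m-forms; the retraction transfers it to
  -- the subspace `ModelMM m n`.
  have h7 : ContMDiffAt (modelJ1 m n) 𝓘(ℝ, ModelMM m n) ∞
      (fun z : J1 m n q => modelRetract m n (cartanCoord (c.baseForm η (q z.proj))
        (c.fibreDeriv L z) (c.jetCoord z.proj z.2) (L z))) z :=
    (modelRetract m n).contMDiff.contMDiffAt.comp z h3
  refine h7.congr_of_eventuallyEq ?_
  have ho : IsOpen {z : J1 m n q | z.proj ∈ c.tot.source} := c.jetTriv.open_source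
  filter_upwards [ho.mem_nhds hz] with z' hz'
  rw [← c.mmCoord_extendedLegendre η hL hz', modelRetract_apply]
  rfl

end LegendreSmooth

/-! ### Local sections of submersions and curves in their fibres -/

section Submersions

variable {V V' H H' N N' : Type*} [NormedAddCommGroup V] [NormedSpace ℝ V]
  [NormedAddCommGroup V'] [NormedSpace ℝ V'] [TopologicalSpace H] [TopologicalSpace H']
  {I : ModelWithCorners ℝ V H} {J : ModelWithCorners ℝ V' H'} [I.Boundaryless] [J.Boundaryless]
  [TopologicalSpace N] [ChartedSpace H N] [IsManifold I ∞ N]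
  [TopologicalSpace N'] [ChartedSpace H' N'] [IsManifold J ∞ N'] {f : N → N'} {x : N}

theorem contMDiffAt_extend_symm {φ : OpenPartialHomeomorph N H}
    (hφ : φ ∈ IsManifold.maximalAtlas I ∞ N) {y : V} (hy : y ∈ (φ.extend I).target) :
    ContMDiffAt 𝓘(ℝ, V) I ∞ (φ.extend I).symm y := by
  have h := contMDiffOn_extend_symm hφ
  rw [← OpenPartialHomeomorph.extend_target'] at h
  exact h.contMDiffAt (φ.isOpen_extend_target.mem_nhds hy)

/-- A submersion has local sections through every point. -/
theorem Manifold.IsSubmersionAt.exists_section (h : IsSubmersionAt I J ∞ f x) :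
    ∃ s : N' → N, ContMDiffAt J I ∞ s (f x) ∧ s (f x) = x ∧ ∀ᶠ y in 𝓝 (f x), f (s y) = y := by
  let φ := h.domChart.extend I
  let ψ := h.codChart.extend J
  have hx : x ∈ φ.source := by
    rw [OpenPartialHomeomorph.extend_source]; exact h.mem_domChart_source
  have hfx : f x ∈ ψ.source := by
    rw [OpenPartialHomeomorph.extend_source]; exact h.mem_codChart_source
  have hw : (h.equiv (φ x)).1 = ψ (f x) := by
    have h1 := h.writtenInCharts (φ.map_source hx)
    refine h1.symm.trans ?_
    exact congrArg (ψ ∘ f) (φ.left_inv hx)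
  -- In the charts `f` is a linear projection; the section varies the projected component and
  -- freezes the complementary one at its value at `x`.
  let a : N' → V := fun y => h.equiv.symm (ψ y, (h.equiv (φ x)).2)
  have ha : a (f x) = φ x := by
    change h.equiv.symm (ψ (f x), _) = _
    rw [← hw, Prod.mk.eta, ContinuousLinearEquiv.symm_apply_apply]
  have hψ : ContMDiffAt J 𝓘(ℝ, V') ∞ ψ (f x) :=
    h.codChart.contMDiffAt_extend h.codChart_mem_maximalAtlas h.mem_codChart_source
  have ha' : ContMDiffAt J 𝓘(ℝ, V) ∞ a (f x) := by
    have h1 : ContDiff ℝ ∞ fun u : V' => h.equiv.symm (u, (h.equiv (φ x)).2) :=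
      h.equiv.symm.contDiff.comp (contDiff_prodMk_left _)
    exact ContMDiffAt.comp (g := fun u : V' => h.equiv.symm (u, (h.equiv (φ x)).2)) (f x)
      h1.contMDiff.contMDiffAt hψ
  have hs : ContMDiffAt 𝓘(ℝ, V) I ∞ φ.symm (a (f x)) := by
    rw [ha]
    exact contMDiffAt_extend_symm h.domChart_mem_maximalAtlas (φ.map_source hx)
  refine ⟨φ.symm ∘ a, hs.comp (f x) ha', ?_, ?_⟩
  · rw [Function.comp_apply, ha]
    exact φ.left_inv hx
  · have h2 : ∀ᶠ y in 𝓝 (f x), a y ∈ φ.target := by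
      refine ha'.continuousAt.eventually_mem ?_
      rw [ha]
      exact h.domChart.isOpen_extend_target.mem_nhds (φ.map_source hx)
    have h3 : ψ.source ∈ 𝓝 (f x) := h.codChart.isOpen_extend_source.mem_nhds hfx
    filter_upwards [h2, h3] with y hy hy'
    have h4 : ψ (f (φ.symm (a y))) = (h.equiv (a y)).1 := h.writtenInCharts hy
    have h5 : (h.equiv (a y)).1 = ψ y := by
      change (h.equiv (h.equiv.symm _)).1 = _
      rw [ContinuousLinearEquiv.apply_symm_apply]
    refine ψ.injOn ?_ hy' (h4.trans h5)
    have h6 : φ.symm (a y) ∈ h.domChart.source := by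
      rw [← OpenPartialHomeomorph.extend_source (I := I)]; exact φ.map_target hy
    rw [OpenPartialHomeomorph.extend_source]
    exact h.source_subset_preimage_source h6

/-- Nearby points of a fibre of a submersion are joined by smooth curves in the fibre. -/
theorem Manifold.IsSubmersionAt.exists_curve (h : IsSubmersionAt I J ∞ f x) :
    ∀ᶠ y in 𝓝 x, f y = f x → ∃ (T : Set ℝ) (γ : ℝ → N), IsOpen T ∧ IsPreconnected T ∧ 0 ∈ T ∧
      1 ∈ T ∧ γ 0 = x ∧ γ 1 = y ∧ ∀ t ∈ T, f (γ t) = f x ∧ ContMDiffAt 𝓘(ℝ, ℝ) I ∞ γ t := by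
  let φ := h.domChart.extend I
  let ψ := h.codChart.extend J
  have hx : x ∈ φ.source := by
    rw [OpenPartialHomeomorph.extend_source]; exact h.mem_domChart_source
  -- A ball is convex, so segments between points near `x` stay in the image of the chart.
  obtain ⟨r, hr, hB⟩ := Metric.isOpen_iff.1 h.domChart.isOpen_extend_target _ (φ.map_source hx)
  have h1 : ∀ᶠ y in 𝓝 x, φ y ∈ Metric.ball (φ x) r :=
    (h.domChart.contMDiffAt_extend h.domChart_mem_maximalAtlas
      h.mem_domChart_source).continuousAt.eventually_mem (Metric.ball_mem_nhds _ hr)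
  have h2 : φ.source ∈ 𝓝 x := h.domChart.isOpen_extend_source.mem_nhds hx
  filter_upwards [h1, h2] with y hy hy' hf
  -- The curve is a straight segment in the chart, extended to the open convex set of parameters
  -- that keep it in the ball.
  let s : ℝ → V := fun t => AffineMap.lineMap (φ x) (φ y) t
  have hs : ContDiff ℝ ∞ s := by
    change ContDiff ℝ ∞ fun t : ℝ => AffineMap.lineMap (φ x) (φ y) t
    simp only [AffineMap.lineMap_apply_module']
    exact (contDiff_id.smul contDiff_const).add contDiff_const
  have hsc : Convex ℝ (s ⁻¹' Metric.ball (φ x) r) :=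
    (convex_ball (φ x) r).affine_preimage (AffineMap.lineMap (φ x) (φ y))
  have hs0 : s 0 = φ x := AffineMap.lineMap_apply_zero _ _
  have hs1 : s 1 = φ y := AffineMap.lineMap_apply_one _ _
  refine ⟨s ⁻¹' Metric.ball (φ x) r, φ.symm ∘ s, Metric.isOpen_ball.preimage hs.continuous,
    hsc.isPreconnected, ?_, ?_, ?_, ?_, fun t ht => ⟨?_, ?_⟩⟩
  · rw [mem_preimage, hs0]; exact Metric.mem_ball_self hr
  · rw [mem_preimage, hs1]; exact hy
  · rw [Function.comp_apply, hs0]; exact φ.left_inv hx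
  · rw [Function.comp_apply, hs1]; exact φ.left_inv hy'
  -- In the charts `f` is the first component of `h.equiv`. It is linear and agrees at both ends of
  -- the segment, hence is constant along it.
  · have key : ∀ w ∈ φ.target, ψ (f (φ.symm w)) = (h.equiv w).1 := h.writtenInCharts
    have hsrc : ∀ w ∈ φ.target, f (φ.symm w) ∈ ψ.source := by
      intro w hw
      have h6 : φ.symm w ∈ h.domChart.source := by
        rw [← OpenPartialHomeomorph.extend_source (I := I)]; exact φ.map_target hw
      rw [OpenPartialHomeomorph.extend_source]
      exact h.source_subset_preimage_source h6
    have kx := key _ (φ.map_source hx)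
    have ky := key _ (φ.map_source hy')
    have kt := key _ (hB ht)
    rw [φ.left_inv hx] at kx
    rw [φ.left_inv hy', hf, kx] at ky
    refine ψ.injOn (hsrc _ (hB ht)) (by
      have := hsrc _ (φ.map_source hx)
      rwa [φ.left_inv hx] at this) ?_
    rw [kt, kx]
    change (h.equiv (AffineMap.lineMap (φ x) (φ y) t)).1 = _
    rw [AffineMap.lineMap_apply_module', map_add, map_smul, map_sub, Prod.fst_add, Prod.smul_fst,
      Prod.fst_sub, ← ky, sub_self, smul_zero, zero_add]
  · exact (contMDiffAt_extend_symm h.domChart_mem_maximalAtlas (hB ht)).comp t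
      hs.contMDiff.contMDiffAt

end Submersions

/-! ### What the Poincaré–Cartan form determines: momenta and energy -/

section FibreConstancy

variable {m n : ℕ}

/-- A vertical vector in slot ν kills the basic part and every summand of `insertForm` except the
ν-th; of the momentum vector, only the component along e_ν then contributes to η. The value isolates
the ν-th momenta. -/
theorem cartanCoord_apply_vertical (η : Euc m [⋀^Fin m]→L[ℝ] ℝ)
    (lam : (Euc m →L[ℝ] Euc n) →L[ℝ] ℝ) (v : Euc m →L[ℝ] Euc n) (l : ℝ) (ν : Fin m) (Y : Euc n) :
    cartanCoord η lam v l
      (Function.update (fun j => (EuclideanSpace.single j 1, 0)) ν (0, Y)) =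
      lam ((EuclideanSpace.proj ν : Euc m →L[ℝ] ℝ).smulRight Y) *
        η (fun i => EuclideanSpace.single i 1) := by
  set w : Fin m → Euc m × Euc n :=
    Function.update (fun j => (EuclideanSpace.single j 1, 0)) ν (0, Y) with hw
  have hwν : w ν = (0, Y) := Function.update_self _ _ _
  have hwj : ∀ j, j ≠ ν → w j = (EuclideanSpace.single j 1, 0) := fun j hj =>
    Function.update_of_ne hj _ _
  have h1 : η.compContinuousLinearMap (ContinuousLinearMap.fst ℝ (Euc m) (Euc n)) w = 0 :=
    η.map_coord_zero ν (by simp [hwν])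
  have h2 : insertForm η (ContinuousLinearMap.fst ℝ (Euc m) (Euc n)) (momentumCoord lam v) w =
      η (Function.update (fun j => (w j).1) ν (momentumCoord lam v (w ν))) := by
    rw [insertForm_apply]
    refine (Finset.sum_eq_single ν (fun i _ hi => ?_) (by simp)).trans rfl
    exact η.map_coord_zero ν (by simp [hi.symm, hwν])
  have h3 : ∀ u, Function.update (fun j => (w j).1) ν u =
      Function.update (fun j => (EuclideanSpace.single j 1 : Euc m)) ν u := by
    intro u
    ext1 j
    rcases eq_or_ne j ν with rfl | hj
    · simp
    · simp [hj, hwj j hj]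
  have h4 : momentumCoord lam v (w ν) = ∑ μ : Fin m,
      lam ((EuclideanSpace.proj μ : Euc m →L[ℝ] ℝ).smulRight Y) •
        (EuclideanSpace.single μ (1 : ℝ) : Euc m) := by
    rw [momentumCoord_apply, hwν]
    simp
  have h5 : η (Function.update (fun j => (EuclideanSpace.single j 1 : Euc m)) ν
      (momentumCoord lam v (w ν))) =
      ∑ μ : Fin m, lam ((EuclideanSpace.proj μ : Euc m →L[ℝ] ℝ).smulRight Y) •
        η (Function.update (fun j => (EuclideanSpace.single j 1 : Euc m)) ν
          (EuclideanSpace.single μ (1 : ℝ))) := by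
    rw [h4]
    refine (η.toMultilinearMap.map_update_sum _ _ _ _).trans ?_
    exact Finset.sum_congr rfl fun j _ => η.toMultilinearMap.map_update_smul _ _ _ _
  rw [cartanCoord, ContinuousAlternatingMap.add_apply, ContinuousAlternatingMap.smul_apply, h1,
    smul_zero, add_zero, h2, h3, h5, Finset.sum_eq_single ν]
  · rw [Function.update_eq_self]; rfl
  · intro j _ hj
    rw [η.map_eq_zero_of_eq _ (i := ν) (j := j) (by simp [hj]) hj.symm, smul_zero]
  · simp

theorem eq_sum_smulRight (A : Euc m →L[ℝ] Euc n) :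
    A = ∑ ν, (EuclideanSpace.proj ν : Euc m →L[ℝ] ℝ).smulRight (A (EuclideanSpace.single ν 1)) := by
  ext1 u
  have h : u = ∑ μ, u μ • (EuclideanSpace.single μ 1 : Euc m) := by
    ext l
    simp [Pi.single_apply]
  conv_lhs => rw [h]
  rw [map_sum, sum_apply]
  exact Finset.sum_congr rfl fun ν _ => map_smul A _ _

/-- The momenta are determined by the Legendre map. -/
theorem fibreDeriv_unique {η : Euc m [⋀^Fin m]→L[ℝ] ℝ} (hη : η ≠ 0)
    {lam lam' : (Euc m →L[ℝ] Euc n) →L[ℝ] ℝ} {v v' : Euc m →L[ℝ] Euc n} {l l' : ℝ}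
    (β : Euc m [⋀^Fin m]→L[ℝ] ℝ)
    (h : β.compContinuousLinearMap (ContinuousLinearMap.fst ℝ (Euc m) (Euc n)) =
      cartanCoord η lam v l - cartanCoord η lam' v' l') : lam = lam' := by
  have h1 : ∀ (ν : Fin m) (Y : Euc n),
      lam ((EuclideanSpace.proj ν : Euc m →L[ℝ] ℝ).smulRight Y) =
      lam' ((EuclideanSpace.proj ν : Euc m →L[ℝ] ℝ).smulRight Y) := by
    intro ν Y
    -- Basic forms vanish on this tuple, so the equation compares the ν-th momenta, both multiplied
    -- by the same nonzero value of η.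
    have h2 := DFunLike.congr_fun h
      (Function.update (fun j => (EuclideanSpace.single j 1, 0)) ν (0, Y))
    rw [ContinuousAlternatingMap.sub_apply, cartanCoord_apply_vertical,
      cartanCoord_apply_vertical] at h2
    have h3 : β.compContinuousLinearMap (ContinuousLinearMap.fst ℝ (Euc m) (Euc n))
        (Function.update (fun j => (EuclideanSpace.single j 1, 0)) ν (0, Y)) = 0 :=
      β.map_coord_zero ν (by simp)
    rw [h3] at h2
    exact mul_right_cancel₀ (topForm_single_ne_zero hη) (sub_eq_zero.1 h2.symm)
  ext A
  rw [eq_sum_smulRight A, map_sum, map_sum]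
  exact Finset.sum_congr rfl fun ν _ => h1 ν _

/-- Replacing v' by v changes the momentum map by an endomorphism S of the base directions.
Inserting S into the top form η multiplies it by the trace of S, which is λ(v') - λ(v). The basic
part therefore sees v and l only through l - λ(v). -/
theorem cartanCoord_eq_of_energy_eq (η : Euc m [⋀^Fin m]→L[ℝ] ℝ)
    (lam : (Euc m →L[ℝ] Euc n) →L[ℝ] ℝ) {v v' : Euc m →L[ℝ] Euc n} {l l' : ℝ}
    (h : l - lam v = l' - lam v') : cartanCoord η lam v l = cartanCoord η lam v' l' := by
  let S : Euc m →L[ℝ] Euc m :=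
    (momentumCoord lam v - momentumCoord lam v').comp (ContinuousLinearMap.inl ℝ (Euc m) (Euc n))
  have hS : ∀ X, momentumCoord lam v X = momentumCoord lam v' X + S X.1 := by
    intro X
    ext ν
    change momentumCoord lam v X ν = momentumCoord lam v' X ν +
      (momentumCoord lam v (X.1, 0) ν - momentumCoord lam v' (X.1, 0) ν)
    simp only [momentumCoord_apply_coord, ← map_sub, ← map_add]
    refine congrArg lam (ContinuousLinearMap.ext fun u => ?_)
    change u ν • (X.2 - v X.1) = u ν • (X.2 - v' X.1) + (u ν • (0 - v X.1) - u ν • (0 - v' X.1))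
    module
  -- The ν-th diagonal entry of S is λ(dx^ν ⊗ (v' - v)e_ν), and these rank-one maps add up to v' -
  -- v.
  have htr : ∑ ν, S (EuclideanSpace.single ν 1) ν = lam v' - lam v := by
    rw [← map_sub]
    conv_rhs => rw [eq_sum_smulRight (v' - v), map_sum]
    refine Finset.sum_congr rfl fun ν _ => ?_
    change momentumCoord lam v (EuclideanSpace.single ν 1, 0) ν -
      momentumCoord lam v' (EuclideanSpace.single ν 1, 0) ν = _
    simp only [momentumCoord_apply_coord, ← map_sub]
    refine congrArg lam (ContinuousLinearMap.ext fun u => ?_)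
    change u ν • (0 - v (EuclideanSpace.single ν 1)) - u ν • (0 - v' (EuclideanSpace.single ν 1)) =
      u ν • (v' (EuclideanSpace.single ν 1) - v (EuclideanSpace.single ν 1))
    module
  ext w
  have h1 := DFunLike.congr_fun (insertForm_id_eq_trace η S) (fun i => (w i).1)
  rw [htr, insertForm_apply, ContinuousAlternatingMap.smul_apply] at h1
  have h2 : ∀ i, η (Function.update (fun j => (w j).1) i (momentumCoord lam v (w i))) =
      η (Function.update (fun j => (w j).1) i (momentumCoord lam v' (w i))) +
      η (Function.update (fun j => (w j).1) i (S (w i).1)) := by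
    intro i
    rw [hS]
    exact η.toMultilinearMap.map_update_add _ _ _ _
  change insertForm η (ContinuousLinearMap.fst ℝ (Euc m) (Euc n)) (momentumCoord lam v) w +
    l * η (fun i => (w i).1) = insertForm η (ContinuousLinearMap.fst ℝ (Euc m) (Euc n))
      (momentumCoord lam v') w + l' * η (fun i => (w i).1)
  rw [insertForm_apply, insertForm_apply]
  have h3 : ∑ i, η (Function.update (fun j => (w j).1) i (momentumCoord lam v (w i))) =
      ∑ i, η (Function.update (fun j => (w j).1) i (momentumCoord lam v' (w i))) +
      (lam v' - lam v) * η (fun i => (w i).1) := by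
    rw [Finset.sum_congr rfl fun i _ => h2 i, Finset.sum_add_distrib]
    exact congrArg _ h1
  refine (congrArg (· + l * η (fun i => (w i).1)) h3).trans ?_
  have h4 : l = l' - lam v' + lam v := by linarith
  rw [h4]
  change _ = ∑ i, η (Function.update (fun j => (w j).1) i (momentumCoord lam v' (w i))) + _
  ring

end FibreConstancy

/-! ### The Hamiltonian section -/

section HamiltonianSection

variable {M : Type*} [TopologicalSpace M] {E : Type*} [TopologicalSpace E]
  {m n : ℕ} [ChartedSpace (Euc m) M] [ChartedSpace (Euc (m + n)) E] {q : E → M}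
  [IsSmoothFibreBundle m n q] [IsManifold (𝓡 m) ∞ M]

theorem AdaptedChart.baseForm_ne_zero (c : AdaptedChart m n q) {η : DForm (𝓡 m) M m} {x : M}
    (hη : η x ≠ 0) (hx : x ∈ c.base.source) : c.baseForm η x ≠ 0 := by
  intro h0
  refine hη (ContinuousAlternatingMap.ext fun w => ?_)
  have h1 := DFunLike.congr_fun h0 fun i => c.baseFrame x (w i)
  refine Eq.trans ?_ h1
  exact congrArg (η x) (funext fun i =>
    ((c.baseFrame_isInvertible hx).inverse_apply_self (w i)).symm)

theorem AdaptedChart.exists_of_muProj_eq (c : AdaptedChart m n q) {z z' : MM m n q}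
    (h : muProj m n q z = muProj m n q z') (hz : z.proj ∈ c.tot.source) :
    z.proj = z'.proj ∧ ∃ β : Euc m [⋀^Fin m]→L[ℝ] ℝ,
      β.compContinuousLinearMap (ContinuousLinearMap.fst ℝ (Euc m) (Euc n)) =
        (c.mmCoord z.proj z.2).1 - (c.mmCoord z'.proj z'.2).1 := by
  obtain ⟨e, α⟩ := z
  obtain ⟨e', α'⟩ := z'
  obtain rfl : e = e' := congrArg Bundle.TotalSpace.proj h
  refine ⟨rfl, ?_⟩
  have h1 : (basicForms (mfderiv (𝓡 (m + n)) (𝓡 m) q e) m).mkQ α =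
      (basicForms (mfderiv (𝓡 (m + n)) (𝓡 m) q e) m).mkQ α' :=
    (Bundle.TotalSpace.mk_inj (F := ModelRMM m n) (E := RMMFibre m n q)).1 h
  have h2 : (modelBasic m n).mkQ (c.mmCoord e α) = (modelBasic m n).mkQ (c.mmCoord e α') :=
    (rmmCoord_mkQ c hz α).symm.trans ((congrArg (c.rmmCoord e) h1).trans (rmmCoord_mkQ c hz α'))
  exact (Submodule.Quotient.eq _).1 h2

/-- Equal Legendre images have coordinate forms that differ by a basic form, which cannot affect the
momenta. -/
theorem AdaptedChart.fibreDeriv_eq_of_legendre_eq (c : AdaptedChart m n q) {η : DForm (𝓡 m) M m}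
    (hη : ∀ x, η x ≠ 0) {L : J1 m n q → ℝ} (hL : ContMDiff (modelJ1 m n) 𝓘(ℝ, ℝ) ∞ L)
    {z z' : J1 m n q} (h : legendre η L z = legendre η L z') (hz : z.proj ∈ c.tot.source) :
    z.proj = z'.proj ∧ c.fibreDeriv L z = c.fibreDeriv L z' := by
  obtain ⟨e, φ⟩ := z
  obtain ⟨e', φ'⟩ := z'
  obtain rfl : e = e' := congrArg Bundle.TotalSpace.proj h
  obtain ⟨-, β, hβ⟩ := c.exists_of_muProj_eq h hz
  have h1 := c.mmCoord_extendedLegendre η hL (z := ⟨e, φ⟩) hz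
  have h2 := c.mmCoord_extendedLegendre η hL (z := ⟨e, φ'⟩) hz
  exact ⟨rfl, fibreDeriv_unique (c.baseForm_ne_zero (hη _) (c.mapsTo _ hz)) β
    (hβ.trans (congrArg₂ (· - ·) h1 h2))⟩

/-- The momenta at `z` and `z'` coincide, so `hE`, written with those of `z` on both sides, does
compare L - λ(v) at the two jets. -/
theorem AdaptedChart.extendedLegendre_eq (c : AdaptedChart m n q) {η : DForm (𝓡 m) M m}
    (hη : ∀ x, η x ≠ 0) {L : J1 m n q → ℝ} (hL : ContMDiff (modelJ1 m n) 𝓘(ℝ, ℝ) ∞ L)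
    {z z' : J1 m n q} (h : legendre η L z = legendre η L z') (hz : z.proj ∈ c.tot.source)
    (hE : L z - c.fibreDeriv L z (c.jetCoord z.proj z.2) =
      L z' - c.fibreDeriv L z (c.jetCoord z'.proj z'.2)) :
    extendedLegendre η L z = extendedLegendre η L z' := by
  obtain ⟨h1, h2⟩ := c.fibreDeriv_eq_of_legendre_eq hη hL h hz
  obtain ⟨e, φ⟩ := z
  obtain ⟨e', φ'⟩ := z'
  obtain rfl : e = e' := h1
  have h3 := c.mmCoord_extendedLegendre η hL (z := ⟨e, φ⟩) hz
  have h4 := c.mmCoord_extendedLegendre η hL (z := ⟨e, φ'⟩) hz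
  rw [cartanCoord_eq_of_energy_eq _ _ hE, h2] at h3
  have h5 := Subtype.ext (h3.trans h4.symm)
  have h6 : (extendedLegendre η L ⟨e, φ⟩).2 = (extendedLegendre η L ⟨e, φ'⟩).2 := by
    rw [← mmCoord_symm c hz (extendedLegendre η L ⟨e, φ⟩).2, ← mmCoord_symm c hz
      (extendedLegendre η L ⟨e, φ'⟩).2]
    exact congrArg (c.mmCoordSymm e) h5
  exact congrArg (Bundle.TotalSpace.mk e) h6

/-- Along a curve in a fibre of the Legendre map, the energy is constant. -/
theorem AdaptedChart.energy_eq_of_curve (c : AdaptedChart m n q) {η : DForm (𝓡 m) M m}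
    (hη : ∀ x, η x ≠ 0) {L : J1 m n q → ℝ} (hL : ContMDiff (modelJ1 m n) 𝓘(ℝ, ℝ) ∞ L)
    {z : J1 m n q} (hz : z.proj ∈ c.tot.source) {T : Set ℝ} {γ : ℝ → J1 m n q} (hT : IsOpen T)
    (hT' : IsPreconnected T) (h : ∀ t ∈ T, legendre η L z = legendre η L (γ t))
    (hγ : ∀ t ∈ T, ContMDiffAt 𝓘(ℝ, ℝ) (modelJ1 m n) ∞ γ t) {a b : ℝ} (ha : a ∈ T) (hb : b ∈ T) :
    L (γ a) - c.fibreDeriv L z (c.jetCoord (γ a).proj (γ a).2) =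
      L (γ b) - c.fibreDeriv L z (c.jetCoord (γ b).proj (γ b).2) := by
  let v : ℝ → Euc m →L[ℝ] Euc n := fun t => c.jetCoord (γ t).proj (γ t).2
  let l : (Euc m →L[ℝ] Euc n) → ℝ := fun w => L ⟨z.proj, c.jetCoordSymm z.proj w⟩
  have hp : ∀ t ∈ T, z.proj = (γ t).proj ∧ c.fibreDeriv L z = c.fibreDeriv L (γ t) := fun t ht =>
    c.fibreDeriv_eq_of_legendre_eq hη hL (h t ht) hz
  have hv : ∀ t ∈ T, DifferentiableAt ℝ v t := by
    intro t ht
    have h1 := ((c.contMDiffAt_jet_iff ((hp t ht).1 ▸ hz)).1 (hγ t ht)).2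
    exact (contMDiffAt_iff_contDiffAt.1 h1).differentiableAt (by simp)
  -- The curve stays over a single point of E, so along it L is a function `l` of the coordinates v
  -- in a fixed vector space.
  have hmk : ∀ ζ : J1 m n q, z.proj = ζ.proj → ζ =
      ⟨z.proj, c.jetCoordSymm z.proj (c.jetCoord ζ.proj ζ.2)⟩ := by
    rintro ⟨e, φ⟩ rfl
    refine congrArg (Bundle.TotalSpace.mk z.proj) ?_
    rw [jetCoordSymm_of_mem c hz]
    exact (jetOfCoord_jetCoord c hz φ).symm
  have hfd : ∀ ζ : J1 m n q, z.proj = ζ.proj →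
      c.fibreDeriv L ζ = fderiv ℝ l (c.jetCoord ζ.proj ζ.2) := by
    rintro ⟨e, φ⟩ rfl
    rfl
  have hl : ∀ t ∈ T, HasFDerivAt l (c.fibreDeriv L z) (v t) := by
    intro t ht
    have h1 := ((c.contDiff_fibreLagrangian hL hz).differentiable (by simp) (v t)).hasFDerivAt
    rw [(hp t ht).2, hfd _ (hp t ht).1]
    exact h1
  -- The derivative of `l` at every `v t` is the same functional λ, so both terms have derivative
  -- λ(v') and cancel.
  have hd : ∀ t ∈ T, HasDerivAt (fun t => l (v t) - c.fibreDeriv L z (v t)) 0 t := by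
    intro t ht
    have h1 := (hl t ht).comp_hasDerivAt t (hv t ht).hasDerivAt
    have h2 := (c.fibreDeriv L z).hasFDerivAt.comp_hasDerivAt t (hv t ht).hasDerivAt
    have h3 := h1.sub h2
    rw [sub_self] at h3
    exact h3
  have hc := hT.is_const_of_deriv_eq_zero hT'
    (fun t ht => (hd t ht).differentiableAt.differentiableWithinAt) (fun t ht => (hd t ht).deriv)
    ha hb
  have hLl : ∀ t ∈ T, L (γ t) = l (v t) := fun t ht => congrArg L (hmk (γ t) (hp t ht).1)
  rw [hLl a ha, hLl b hb]
  exact hc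

variable [IsManifold (𝓡 (m + n)) ∞ E] {k : ℕ} {P : Type*} [TopologicalSpace P]
  [ChartedSpace (Euc k) P] [IsManifold (𝓡 k) ∞ P]
  {η : DForm (𝓡 m) M m} {L : J1 m n q → ℝ} {ι : P → RMM m n q} {FL₀ : J1 m n q → P}

/-- The extended Legendre map is constant on the fibres of the Legendre map. -/
theorem IsAlmostRegular.extendedLegendre_eq (h : IsAlmostRegular k η L ι FL₀)
    (hη : ∀ x, η x ≠ 0) (hL : ContMDiff (modelJ1 m n) 𝓘(ℝ, ℝ) ∞ L) {z z' : J1 m n q}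
    (hzz' : legendre η L z = legendre η L z') :
    extendedLegendre η L z = extendedLegendre η L z' := by
  let c := adaptedChartAt m n q z.proj
  have hz : z.proj ∈ c.tot.source := mem_adaptedChartAt m n q _
  -- The momenta are frozen at `z`, which loses nothing since they are constant on the fibre.
  let en : J1 m n q → ℝ := fun ζ => L ζ - c.fibreDeriv L z (c.jetCoord ζ.proj ζ.2)
  let Φ : Set (J1 m n q) := legendre η L ⁻¹' {legendre η L z}
  have hΦ : IsPreconnected Φ := (h.isConnected_fibre z).isPreconnected
  have hlc : IsLocallyConstant fun ζ : Φ => en ζ := by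
    rw [IsLocallyConstant.iff_eventually_eq]
    rintro ⟨ζ, hζ⟩
    have h1 := (h.isSubmersion.isSubmersionAt ζ).exists_curve
    rw [nhds_subtype_eq_comap]
    refine Filter.mem_comap.2 ⟨_, h1, ?_⟩
    rintro ⟨ζ', hζ'⟩ hmem
    -- The embedding `ι` is injective, so the fibres of the Legendre map are those of the submersion
    -- `FL₀`.
    have hFL : FL₀ ζ' = FL₀ ζ := by
      refine h.isSmoothEmbedding.isEmbedding.injective ?_
      rw [h.comp_eq, h.comp_eq]
      exact (hζ' : legendre η L ζ' = _).trans (hζ : legendre η L ζ = _).symm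
    obtain ⟨T, γ, hT, hT', h0, h1, hγ0, hγ1, hγ⟩ := hmem hFL
    have h2 := c.energy_eq_of_curve hη hL hz hT hT' (fun t ht => ?_) (fun t ht => (hγ t ht).2) h1 h0
    · rw [hγ0, hγ1] at h2
      exact h2
    · rw [← h.comp_eq (γ t), (hγ t ht).1, h.comp_eq]
      exact (hζ : legendre η L ζ = _).symm
  have : PreconnectedSpace Φ := Subtype.preconnectedSpace hΦ
  exact c.extendedLegendre_eq hη hL hzz' hz
    (hlc.apply_eq_of_preconnectedSpace ⟨z, rfl⟩ ⟨z', hzz'.symm⟩)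

/-- The section is defined by choosing a point of the image of the extended Legendre map; constancy
on the fibres makes this choice immaterial. -/
theorem IsAlmostRegular.hamiltonianSection_apply (h : IsAlmostRegular k η L ι FL₀)
    (hη : ∀ x, η x ≠ 0) (hL : ContMDiff (modelJ1 m n) 𝓘(ℝ, ℝ) ∞ L) (z : J1 m n q) :
    h.hamiltonianSection (FL₀ z) = extendedLegendre η L z := by
  obtain ⟨⟨z', hz'⟩, hμ⟩ := Classical.choose_spec (h.exists_section (FL₀ z))
  have h1 : h.hamiltonianSection (FL₀ z) = extendedLegendre η L z' := hz'.symm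
  rw [h1]
  refine h.extendedLegendre_eq hη hL ?_
  rw [← h.comp_eq z]
  exact (congrArg (muProj m n q) h1).symm.trans hμ

theorem IsAlmostRegular.muProj_hamiltonianSection (h : IsAlmostRegular k η L ι FL₀) (p : P) :
    muProj m n q (h.hamiltonianSection p) = ι p :=
  (Classical.choose_spec (h.exists_section p)).2

theorem IsAlmostRegular.surjective (h : IsAlmostRegular k η L ι FL₀) :
    Function.Surjective FL₀ := by
  intro p
  obtain ⟨z, hz⟩ : ι p ∈ range (legendre η L) := h.range_eq ▸ mem_range_self p
  exact ⟨z, h.isSmoothEmbedding.isEmbedding.injective ((h.comp_eq z).trans hz)⟩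

/-- Composing the extended Legendre map with a local section of the submersion `FL₀` gives the
Hamiltonian section near any given point. -/
theorem IsAlmostRegular.contMDiff_hamiltonianSection (h : IsAlmostRegular k η L ι FL₀)
    (hη : η.IsVolumeForm) (hL : ContMDiff (modelJ1 m n) 𝓘(ℝ, ℝ) ∞ L) :
    ContMDiff (𝓡 k) (modelMM m n) ∞ h.hamiltonianSection := by
  intro p
  obtain ⟨z, rfl⟩ := h.surjective p
  obtain ⟨s, hs, _, hs'⟩ := (h.isSubmersion.isSubmersionAt z).exists_section
  refine (((contMDiff_extendedLegendre hη.isSmooth hL).contMDiffAt).comp _ hs).congr_of_eventuallyEq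
    ?_
  filter_upwards [hs'] with p hp
  rw [Function.comp_apply, ← h.hamiltonianSection_apply hη.ne_zero hL, hp]

theorem IsAlmostRegular.toBase_eq (h : IsAlmostRegular k η L ι FL₀) (p : P) :
    toBase m n q ι p = q (h.hamiltonianSection p).proj :=
  congrArg (fun ζ : RMM m n q => q ζ.proj) (h.muProj_hamiltonianSection p).symm

theorem IsAlmostRegular.contMDiff_toBase (h : IsAlmostRegular k η L ι FL₀)
    (hη : η.IsVolumeForm) (hL : ContMDiff (modelJ1 m n) 𝓘(ℝ, ℝ) ∞ L) :
    ContMDiff (𝓡 k) (𝓡 m) ∞ (toBase m n q ι) := by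
  have h1 : ContMDiff (𝓡 k) (𝓡 (m + n)) ∞ fun p => (h.hamiltonianSection p).proj :=
    (Bundle.contMDiff_proj (MMFibre m n q)).comp (h.contMDiff_hamiltonianSection hη hL)
  rw [funext h.toBase_eq]
  exact (IsSmoothFibreBundle.contMDiff (m := m) (n := n)).comp h1

end HamiltonianSection

/-! ### Contraction with the horizontal multivector and bidegree -/

section Bidegree

theorem form_snoc {V : Type*} [NormedAddCommGroup V] [NormedSpace ℝ V] [FiniteDimensional ℝ V]
    {k : ℕ} (α : V [⋀^Fin (k + 1)]→L[ℝ] ℝ) (w : Fin k → V) (v : V) :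
    α (Fin.snoc w v) = (-1 : ℝ) ^ k * α.curryLeft v w := by
  refine (multivectorContraction_ιMulti w α fun _ => v).symm.trans ?_
  change (-1 : ℝ) ^ k * multivectorPairing (α.curryLeft v) (exteriorPower.ιMulti ℝ k w) = _
  rw [multivectorPairing_ιMulti]

theorem multivectorContraction_smul {V : Type*} [NormedAddCommGroup V] [NormedSpace ℝ V]
    [FiniteDimensional ℝ V] {k : ℕ} (r : ℝ) (Y : ⋀[ℝ]^k V) (α : V [⋀^Fin (k + 1)]→L[ℝ] ℝ)
    (u : Fin 1 → V) :
    multivectorContraction (r • Y) α u = r * multivectorContraction Y α u := by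
  change (-1 : ℝ) ^ k * multivectorPairing (α.curryLeft (u 0)) (r • Y) =
    r * ((-1 : ℝ) ^ k * multivectorPairing (α.curryLeft (u 0)) Y)
  rw [map_smul, smul_eq_mul]
  ring

/-- The contraction with the lift of the dual multivector, evaluated in an arbitrary frame. -/
theorem multivectorContraction_map_dualMultivector {V : Type*} [NormedAddCommGroup V]
    [NormedSpace ℝ V] [FiniteDimensional ℝ V] {m : ℕ} (Λ : Euc m →L[ℝ] V)
    {η : Euc m [⋀^Fin m]→L[ℝ] ℝ} (hη : η ≠ 0) (α : V [⋀^Fin (m + 1)]→L[ℝ] ℝ) (w : Fin m → Euc m)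
    (u : Fin 1 → V) :
    multivectorContraction (exteriorPower.map m Λ.toLinearMap (dualMultivector η)) α u * η w =
      α (Fin.snoc (fun i => Λ (w i)) (u 0)) := by
  -- With the last argument fixed, α pulled back along Λ has top degree, hence is proportional to η;
  -- this trades the standard basis for an arbitrary tuple `w`.
  have h := topForm_mul_comm ((α.curryLeft (u 0)).compContinuousLinearMap Λ) η
    (fun i => EuclideanSpace.single i 1) w
  change α.curryLeft (u 0) (fun i => Λ (EuclideanSpace.single i 1)) * η w =
    η (fun i => EuclideanSpace.single i 1) * α.curryLeft (u 0) (fun i => Λ (w i)) at h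
  have h0 := topForm_single_ne_zero hη
  rw [dualMultivector, map_smul, exteriorPower.map_apply_ιMulti, multivectorContraction_smul,
    multivectorContraction_ιMulti, form_snoc, form_snoc]
  change _ * (_ * α.curryLeft (u 0) (fun i => Λ (EuclideanSpace.single i 1))) * _ = _
  field_simp
  linear_combination h

/-- Subtracting `K^*η ∧ γ` from `Ω` leaves only the component of bidegree `(m - 1, 2)`. -/
theorem hasBidegree_sub_wedgeOne {V : Type*} [NormedAddCommGroup V] [NormedSpace ℝ V] {m : ℕ}
    (hm : 1 < m) {K : V →L[ℝ] Euc m} {Λ : Euc m →L[ℝ] V} (hK : ∀ u, K (Λ u) = u)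
    {η : Euc m [⋀^Fin m]→L[ℝ] ℝ} {Ω : V [⋀^Fin (m + 1)]→L[ℝ] ℝ} {γ : V [⋀^Fin 1]→L[ℝ] ℝ}
    (hγ : ∀ (w : Fin m → Euc m) (u : V), γ (fun _ => u) * η w = Ω (Fin.snoc (fun i => Λ (w i)) u))
    (hΩ : ∀ (w : Fin (m + 1) → V) (S : Finset (Fin (m + 1))), 3 ≤ S.card →
      (∀ i ∈ S, K (w i) = 0) → Ω w = 0) :
    HasBidegree (LinearMap.range Λ.toLinearMap) (LinearMap.ker K.toLinearMap) (m - 1) 2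
      (Ω - wedgeOne (η.compContinuousLinearMap K) γ) := by
  intro w S hS hS' hc
  have hS : ∀ i ∈ S, K (w i) = 0 := hS
  have hcard : S.card + Sᶜ.card = m + 1 := by
    rw [Finset.card_add_card_compl, Fintype.card_fin]
  choose! a ha using hS'
  have ha : ∀ i ∉ S, Λ (a i) = w i := ha
  -- In the `l`-th summand of the wedge only `w l` goes to γ, so any other vertical vector ends up
  -- in K^*η.
  have hη0 : ∀ l : Fin (m + 1), (∃ i ∈ S, i ≠ l) →
      η.compContinuousLinearMap K (l.removeNth w) = 0 := by
    rintro l ⟨i, hi, hil⟩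
    obtain ⟨i', rfl⟩ := Fin.exists_succAbove_eq hil
    exact η.map_coord_zero i' (hS _ hi)
  -- Two vertical vectors leave exactly m - 1 horizontal ones among m + 1, the case excluded by
  -- `hc`.
  obtain h | h | h : S.card = 0 ∨ S.card = 1 ∨ 3 ≤ S.card := by omega
  · have hw : w = fun i => Λ (a i) := funext fun i =>
      (ha i (by rw [Finset.card_eq_zero.1 h]; exact Finset.notMem_empty i)).symm
    -- All vectors are horizontal lifts of m + 1 vectors of an m-dimensional space.
    have hdep : ¬ LinearIndependent ℝ a := by
      intro hl
      have := hl.fintype_card_le_finrank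
      simp at this
    rw [hw]
    exact ((Ω - wedgeOne (η.compContinuousLinearMap K) γ).compContinuousLinearMap
      Λ).toAlternatingMap.map_linearDependent a hdep
  · obtain ⟨i, rfl⟩ := Finset.card_eq_one.1 h
    have hr : i.removeNth w = fun j => Λ (i.removeNth a j) := funext fun j =>
      (ha _ (by rw [Finset.mem_singleton]; exact Fin.succAbove_ne i j)).symm
    -- Moving the only vertical vector to the last slot turns Ω into γ times η, with the same sign
    -- as the surviving summand of the wedge.
    have h1 : Ω w = (-1) ^ (m + (i : ℕ)) * (γ (fun _ => w i) * η (i.removeNth a)) := by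
      rw [hγ, ← form_insertNth, ← hr, Fin.insertNth_self_removeNth]
    have h2 : wedgeOne (η.compContinuousLinearMap K) γ w =
        (-1) ^ (m + (i : ℕ)) * (η (i.removeNth a) * γ (fun _ => w i)) := by
      rw [wedgeOne_apply, Finset.sum_eq_single i]
      · rw [hr]
        refine congrArg (fun r => (-1 : ℝ) ^ (m + (i : ℕ)) * (r * γ fun _ => w i)) ?_
        exact congrArg η (funext fun j => hK _)
      · intro l _ hl
        rw [hη0 l ⟨i, Finset.mem_singleton_self i, hl.symm⟩, zero_mul, mul_zero]
      · simp
    rw [ContinuousAlternatingMap.sub_apply, h1, h2]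
    ring
  · rw [ContinuousAlternatingMap.sub_apply, hΩ w S h hS, wedgeOne_apply, zero_sub, neg_eq_zero]
    refine Finset.sum_eq_zero fun l _ => ?_
    obtain ⟨i, hi, hil⟩ := Finset.exists_mem_ne (show 1 < S.card by omega) l
    rw [hη0 l ⟨i, hi, hil⟩, zero_mul, mul_zero]

end Bidegree

/-! ### Smoothness of wedges, pull-backs and contractions -/

section SmoothForms

theorem wedgeOne_comp {V V' : Type*} [NormedAddCommGroup V] [NormedSpace ℝ V]
    [NormedAddCommGroup V'] [NormedSpace ℝ V'] {l : ℕ} (β : V [⋀^Fin l]→L[ℝ] ℝ)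
    (γ : V [⋀^Fin 1]→L[ℝ] ℝ) (A : V' →L[ℝ] V) (w : Fin (l + 1) → V') :
    wedgeOne β γ (fun i => A (w i)) =
      wedgeOne (β.compContinuousLinearMap A) (γ.compContinuousLinearMap A) w := by
  rw [wedgeOne_apply, wedgeOne_apply]
  rfl

theorem map_comp_snoc {V V' : Type*} {l : ℕ} (A : V → V') (w : Fin l → V) (v : V) :
    (fun i => A ((Fin.snoc w v : Fin (l + 1) → V) i)) = Fin.snoc (fun i => A (w i)) (A v) := by
  funext i
  induction i using Fin.lastCases with
  | last => simp
  | cast i => simp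

variable {m k l : ℕ} {M : Type*} [TopologicalSpace M] [ChartedSpace (Euc m) M]
  [IsManifold (𝓡 m) ∞ M] {P : Type*} [TopologicalSpace P] [ChartedSpace (Euc k) P]
  [IsManifold (𝓡 k) ∞ P]

namespace DForm

theorem IsSmooth.sub_wedge {α : DForm (𝓡 k) P (l + 1)} {β : DForm (𝓡 k) P l}
    {γ : DForm (𝓡 k) P 1} (hα : α.IsSmooth) (hβ : β.IsSmooth) (hγ : γ.IsSmooth) :
    DForm.IsSmooth (I := 𝓡 k) (N := P) fun p => α p - β.wedge γ p := by
  refine isSmooth_of_contDiffAt fun p => ?_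
  refine ((hα.contDiffAt p).sub ((hβ.contDiffAt p).form_wedge
    (hγ.contDiffAt p))).congr_of_eventuallyEq (.of_forall fun y => ?_)
  ext w
  let A : Euc k →L[ℝ] Euc k := mfderiv 𝓘(ℝ, Euc k) (𝓡 k) (extChartAt (𝓡 k) p).symm y
  let x : P := (extChartAt (𝓡 k) p).symm y
  have h : wedgeOne (β x : Euc k [⋀^Fin l]→L[ℝ] ℝ) (γ x) (fun i => A (w i)) =
      wedgeOne (β.chartRep p y) (γ.chartRep p y) w := wedgeOne_comp (V := Euc k) (β x) (γ x) A w
  exact congrArg (fun r => α.chartRep p y w - r) h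

/-- A chart of M around κ(p) composed with κ serves as the map into a vector space, with the chart
representative of η as coefficients. -/
theorem IsSmooth.pullback {η : DForm (𝓡 m) M l} (hη : η.IsSmooth) {κ : P → M}
    (hκ : ContMDiff (𝓡 k) (𝓡 m) ∞ κ) : (η.pullback κ : DForm (𝓡 k) P l).IsSmooth := by
  refine isSmooth_of_contDiffAt fun p => ?_
  have hc : ∀ p', κ p' ∈ (chartAt (Euc m) (κ p)).source →
      ContMDiffAt (𝓡 m) 𝓘(ℝ, Euc m) ∞ (extChartAt (𝓡 m) (κ p)) (κ p') := fun _ h =>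
    contMDiffAt_extChartAt' h
  have hg : ContMDiffAt (𝓡 k) 𝓘(ℝ, Euc m) ∞ (extChartAt (𝓡 m) (κ p) ∘ κ) p :=
    (hc p (mem_chart_source _ _)).comp p hκ.contMDiffAt
  refine contDiffAt_chartRep (g := extChartAt (𝓡 m) (κ p) ∘ κ)
    (b := fun p' => η.chartRep (κ p) (extChartAt (𝓡 m) (κ p) (κ p')))
    (mem_chart_source _ p) hg ?_ ?_
  · exact ContMDiffAt.comp (g := η.chartRep (κ p)) p (hη.contDiffAt (κ p)).contMDiffAt hg
  · filter_upwards [hκ.continuous.continuousAt.preimage_mem_nhds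
      (chart_source_mem_nhds (Euc m) (κ p))] with p' hp'
    have h1 := mfderiv_comp p' ((hc p' hp').mdifferentiableAt (by simp))
      (hκ.contMDiffAt.mdifferentiableAt (by simp))
    rw [h1]
    have h2 := η.eq_chartRep_comp (z := κ p') hp'
    ext w
    exact DFunLike.congr_fun h2 fun i => (mfderiv (𝓡 k) (𝓡 m) κ p' : Euc k →L[ℝ] Euc m) (w i)

theorem chartRep_ne_zero {η : DForm (𝓡 m) M l} {x₀ x : M} (hη : η x ≠ 0)
    (hx : x ∈ (chartAt (Euc m) x₀).source) :
    η.chartRep x₀ (extChartAt (𝓡 m) x₀ x) ≠ 0 := by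
  intro h0
  refine hη ((η.eq_chartRep_comp hx).trans ?_)
  rw [h0]
  rfl

end DForm

/-- The model for the contraction of a form with the lift of the dual multivector. -/
noncomputable def contractModel (η : Euc m [⋀^Fin m]→L[ℝ] ℝ) (Λ : Euc m →L[ℝ] Euc k)
    (α : Euc k [⋀^Fin (m + 1)]→L[ℝ] ℝ) : Euc k [⋀^Fin 1]→L[ℝ] ℝ :=
  multivectorContraction (exteriorPower.map m Λ.toLinearMap (dualMultivector η)) α

/-- Characterises the contraction without multivectors, since η is nonzero on some `w`; smoothness
and change of coordinates are both derived from it. -/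
theorem contractModel_mul {η : Euc m [⋀^Fin m]→L[ℝ] ℝ} (hη : η ≠ 0) (Λ : Euc m →L[ℝ] Euc k)
    (α : Euc k [⋀^Fin (m + 1)]→L[ℝ] ℝ) (w : Fin m → Euc m) (u : Fin 1 → Euc k) :
    contractModel η Λ α u * η w = α (Fin.snoc (fun i => Λ (w i)) (u 0)) :=
  multivectorContraction_map_dualMultivector Λ hη α w u

/-- On a fixed vector the contraction is the quotient of α on the lifted standard frame by η on the
standard frame, whose denominator does not vanish near `x`. -/
theorem ContDiffAt.contractModel {X : Type*} [NormedAddCommGroup X] [NormedSpace ℝ X] {x : X}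
    {η : X → Euc m [⋀^Fin m]→L[ℝ] ℝ} {Λ : X → Euc m →L[ℝ] Euc k}
    {α : X → Euc k [⋀^Fin (m + 1)]→L[ℝ] ℝ} (hη : ContDiffAt ℝ ∞ η x) (hη' : η x ≠ 0)
    (hΛ : ContDiffAt ℝ ∞ Λ x) (hα : ContDiffAt ℝ ∞ α x) :
    ContDiffAt ℝ ∞ (fun y => _root_.contractModel (η y) (Λ y) (α y)) x := by
  refine contDiffAt_form_of_eval fun u => ?_
  have h1 : ContDiffAt ℝ ∞ (fun y => η y fun i => EuclideanSpace.single i 1) x :=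
    hη.form_apply fun _ => contDiffAt_const
  have h2 : ContDiffAt ℝ ∞ (fun y => α y
      (Fin.snoc (fun i => Λ y (EuclideanSpace.single i 1)) (u 0) : Fin (m + 1) → Euc k)) x := by
    refine hα.form_apply fun i => ?_
    induction i using Fin.lastCases with
    | last => simpa using contDiffAt_const
    | cast i => simpa using hΛ.clm_apply contDiffAt_const
  have h0 := topForm_single_ne_zero hη'
  refine (h2.div h1 h0).congr_of_eventuallyEq ?_
  filter_upwards [hη.continuousAt.eventually_ne hη'] with y hy
  rw [Pi.div_apply, eq_div_iff (topForm_single_ne_zero hy)]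
  exact contractModel_mul hy _ _ _ _

namespace EhresmannConnection

variable {κ : P → M} (D : EhresmannConnection m k κ)

theorem contract_mul {η : DForm (𝓡 m) M m} {α : DForm (𝓡 k) P (m + 1)} {p : P}
    (hη : η (κ p) ≠ 0) (w : Fin m → Euc m) (u : Fin 1 → Euc k) :
    (D.contract η α p : Euc k [⋀^Fin 1]→L[ℝ] ℝ) u * (η (κ p) : Euc m [⋀^Fin m]→L[ℝ] ℝ) w =
      (α p : Euc k [⋀^Fin (m + 1)]→L[ℝ] ℝ)
        (Fin.snoc (fun i => (D.lift p : Euc m →L[ℝ] Euc k) (w i)) (u 0)) :=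
  contractModel_mul hη (D.lift p) (α p) w u

/-- The horizontal lift in charts around `p₀` and `κ(p₀)`. -/
noncomputable def liftCoord (p₀ p : P) : Euc m →L[ℝ] Euc k :=
  inTangentCoordinates (𝓡 m) (𝓡 k) κ id (fun p => (D.lift p : Euc m →L[ℝ] Euc k)) p₀ p

theorem liftCoord_eq {p₀ p : P} (hp : p ∈ (chartAt (Euc k) p₀).source)
    (hκp : κ p ∈ (chartAt (Euc m) (κ p₀)).source) (u : Euc m) :
    D.liftCoord p₀ p u = (mfderiv (𝓡 k) 𝓘(ℝ, Euc k) (extChartAt (𝓡 k) p₀) p : Euc k →L[ℝ] Euc k)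
      ((D.lift p : Euc m →L[ℝ] Euc k)
        ((mfderiv 𝓘(ℝ, Euc m) (𝓡 m) (extChartAt (𝓡 m) (κ p₀)).symm
          (extChartAt (𝓡 m) (κ p₀) (κ p)) : Euc m →L[ℝ] Euc m) u)) := by
  have h := inTangentCoordinates_eq_mfderiv_comp (I := 𝓡 m) (I' := 𝓡 k) (f := κ) (g := id)
    (ϕ := fun p => D.lift p) (x₀ := p₀) (x := p) hκp hp
  refine (DFunLike.congr_fun h u).trans ?_
  have h1 : range (𝓡 m) = univ := ModelWithCorners.range_eq_univ _
  rw [h1, mfderivWithin_univ]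
  rfl

/-- Contraction is natural under passage to coordinates: multiplied by the same nonzero value of η,
both sides become α on the same lifted frame. -/
theorem contract_eq {η : DForm (𝓡 m) M m} {α : DForm (𝓡 k) P (m + 1)} {p₀ p : P}
    (hη : η (κ p) ≠ 0) (hp : p ∈ (chartAt (Euc k) p₀).source)
    (hκp : κ p ∈ (chartAt (Euc m) (κ p₀)).source) :
    D.contract η α p = (contractModel (η.chartRep (κ p₀) (extChartAt (𝓡 m) (κ p₀) (κ p)))
      (D.liftCoord p₀ p) (α.chartRep p₀ (extChartAt (𝓡 k) p₀ p))).compContinuousLinearMap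
        (mfderiv (𝓡 k) 𝓘(ℝ, Euc k) (extChartAt (𝓡 k) p₀) p) := by
  have hη' := DForm.chartRep_ne_zero hη hκp
  have h0 := topForm_single_ne_zero hη'
  have hpt : (extChartAt (𝓡 m) (κ p₀)).symm (extChartAt (𝓡 m) (κ p₀) (κ p)) = κ p :=
    (extChartAt (𝓡 m) (κ p₀)).left_inv (by rwa [extChartAt_source])
  let B : Euc m →L[ℝ] Euc m := mfderiv 𝓘(ℝ, Euc m) (𝓡 m) (extChartAt (𝓡 m) (κ p₀)).symm
    (extChartAt (𝓡 m) (κ p₀) (κ p))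
  let A : Euc k →L[ℝ] Euc k := mfderiv (𝓡 k) 𝓘(ℝ, Euc k) (extChartAt (𝓡 k) p₀) p
  ext u
  -- The frame is the coordinate frame of the chart at κ(p₀), on which η takes the value of its
  -- representative on the standard basis.
  have h1 := D.contract_mul (α := α) hη (fun i => B (EuclideanSpace.single i 1)) u
  have h2 := contractModel_mul hη' (D.liftCoord p₀ p) (α.chartRep p₀ (extChartAt (𝓡 k) p₀ p))
    (fun i => EuclideanSpace.single i 1) (fun i => A (u i))
  have h3 : η.chartRep (κ p₀) (extChartAt (𝓡 m) (κ p₀) (κ p))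
      (fun i => EuclideanSpace.single i 1) =
      (η (κ p) : Euc m [⋀^Fin m]→L[ℝ] ℝ) (fun i => B (EuclideanSpace.single i 1)) := by
    have h4 : (η ((extChartAt (𝓡 m) (κ p₀)).symm (extChartAt (𝓡 m) (κ p₀) (κ p))) :
      Euc m [⋀^Fin m]→L[ℝ] ℝ) = η (κ p) := by rw [hpt]
    exact DFunLike.congr_fun h4 _
  have h5 : (α p : Euc k [⋀^Fin (m + 1)]→L[ℝ] ℝ) (Fin.snoc (fun i =>
      (D.lift p : Euc m →L[ℝ] Euc k) (B (EuclideanSpace.single i 1))) (u 0)) =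
      α.chartRep p₀ (extChartAt (𝓡 k) p₀ p) (Fin.snoc (fun i =>
        D.liftCoord p₀ p (EuclideanSpace.single i 1)) (A (u 0))) := by
    have h6 := DFunLike.congr_fun (α.eq_chartRep_comp (z := p) (x₀ := p₀) hp) (Fin.snoc (fun i =>
      (D.lift p : Euc m →L[ℝ] Euc k) (B (EuclideanSpace.single i 1))) (u 0))
    refine h6.trans (congrArg (α.chartRep p₀ (extChartAt (𝓡 k) p₀ p)) ?_)
    refine (map_comp_snoc (V := Euc k) A _ _).trans ?_
    exact congrArg (fun a : Fin m → Euc k => (Fin.snoc a (A (u 0)) : Fin (m + 1) → Euc k))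
      (funext fun i => (D.liftCoord_eq hp hκp _).symm)
  rw [h3] at h2 h0
  exact mul_right_cancel₀ h0 (h1.trans (h5.trans h2.symm))

/-- By `contract_eq` the coefficients in a chart are the model contraction of the representatives of
η, ∇ and α, all smooth at the centre. -/
theorem isSmooth_contract {η : DForm (𝓡 m) M m} (hη : η.IsVolumeForm)
    (hκ : ContMDiff (𝓡 k) (𝓡 m) ∞ κ) {α : DForm (𝓡 k) P (m + 1)} (hα : α.IsSmooth) :
    (D.contract η α).IsSmooth := by
  refine DForm.isSmooth_of_contDiffAt fun p => ?_
  let φ := extChartAt (𝓡 k) p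
  have hs : ContMDiffAt 𝓘(ℝ, Euc k) (𝓡 k) ∞ φ.symm (φ p) :=
    (contMDiffOn_extChartAt_symm p).contMDiffAt (extChartAt_target_mem_nhds p)
  have hsp : φ.symm (φ p) = p := φ.left_inv (mem_extChartAt_source p)
  have hc : ContMDiffAt (𝓡 k) 𝓘(ℝ, Euc m) ∞ (extChartAt (𝓡 m) (κ p) ∘ κ) p :=
    (contMDiffAt_extChartAt (x := κ p)).comp p hκ.contMDiffAt
  have h1 : ContDiffAt ℝ ∞ ((extChartAt (𝓡 m) (κ p) ∘ κ) ∘ φ.symm) (φ p) := by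
    rw [← contMDiffAt_iff_contDiffAt]
    exact ContMDiffAt.comp _ (by rwa [hsp]) hs
  have h2 : ContDiffAt ℝ ∞ (D.liftCoord p ∘ φ.symm) (φ p) := by
    rw [← contMDiffAt_iff_contDiffAt]
    refine ContMDiffAt.comp (I' := 𝓡 k) _ ?_ hs
    rw [hsp]
    exact D.smooth p
  have h3 : ContDiffAt ℝ ∞
      (η.chartRep (κ p) ∘ ((extChartAt (𝓡 m) (κ p) ∘ κ) ∘ φ.symm)) (φ p) := by
    refine ContDiffAt.comp _ ?_ h1
    rw [Function.comp_apply, Function.comp_apply, hsp]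
    exact hη.isSmooth.contDiffAt (κ p)
  have h4 : (η.chartRep (κ p) ∘ ((extChartAt (𝓡 m) (κ p) ∘ κ) ∘ φ.symm)) (φ p) ≠ 0 := by
    simp only [Function.comp_apply, hsp]
    exact DForm.chartRep_ne_zero (hη.ne_zero _) (mem_chart_source _ _)
  let F : Euc k → Euc k [⋀^Fin 1]→L[ℝ] ℝ := fun y => contractModel
    ((η.chartRep (κ p) ∘ ((extChartAt (𝓡 m) (κ p) ∘ κ) ∘ φ.symm)) y)
    ((D.liftCoord p ∘ φ.symm) y) (α.chartRep p y)
  have h5 : ContDiffAt ℝ ∞ F (φ p) := h3.contractModel h4 h2 (hα.contDiffAt p)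
  refine DForm.contDiffAt_chartRep (g := φ) (b := F ∘ φ) (mem_chart_source _ p)
    contMDiffAt_extChartAt (h5.contMDiffAt.comp p contMDiffAt_extChartAt) ?_
  filter_upwards [chart_source_mem_nhds (Euc k) p, hκ.continuous.continuousAt.preimage_mem_nhds
    (chart_source_mem_nhds (Euc m) (κ p))] with p' hp' hκp'
  have h6 : φ.symm (φ p') = p' := φ.left_inv (by rwa [extChartAt_source])
  have h7 : (F ∘ φ) p' = contractModel (η.chartRep (κ p) (extChartAt (𝓡 m) (κ p) (κ p')))
      (D.liftCoord p p') (α.chartRep p (φ p')) := by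
    simp only [F, Function.comp_apply, h6]
  rw [h7]
  exact D.contract_eq (hη.ne_zero _) hp' hκp'

end EhresmannConnection

end SmoothForms

/-! ### The Hamilton–Cartan form in coordinates -/

section HamiltonCartan

variable {M : Type*} [TopologicalSpace M] {E : Type*} [TopologicalSpace E]
  {m n : ℕ} [ChartedSpace (Euc m) M] [ChartedSpace (Euc (m + n)) E] {q : E → M}
  [IsSmoothFibreBundle m n q] [IsManifold (𝓡 m) ∞ M] [IsManifold (𝓡 (m + n)) ∞ E]
  {k : ℕ} {P : Type*} [TopologicalSpace P] [ChartedSpace (Euc k) P] [IsManifold (𝓡 k) ∞ P]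
  {η : DForm (𝓡 m) M m} {L : J1 m n q → ℝ} {ι : P → RMM m n q} {FL₀ : J1 m n q → P}

theorem IsAlmostRegular.contMDiffAt_sectionCoord (h : IsAlmostRegular k η L ι FL₀)
    (hη : η.IsVolumeForm) (hL : ContMDiff (modelJ1 m n) 𝓘(ℝ, ℝ) ∞ L) (c : AdaptedChart m n q)
    {p : P} (hp : (h.hamiltonianSection p).proj ∈ c.tot.source) :
    ContMDiffAt (𝓡 k) 𝓘(ℝ, (Euc m × Euc n) × ModelMM m n) ∞
      (c.mmChart ∘ h.hamiltonianSection) p :=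
  (c.contMDiffAt_mmChart hp).comp p (h.contMDiff_hamiltonianSection hη hL).contMDiffAt

/-- Pulling back the Darboux form presents the Hamilton–Cartan form as a constant form pulled back
along a smooth map; its smoothness and its vanishing properties are both read off from this. -/
theorem IsAlmostRegular.hamiltonCartan_eq (h : IsAlmostRegular k η L ι FL₀)
    (hη : η.IsVolumeForm) (hL : ContMDiff (modelJ1 m n) 𝓘(ℝ, ℝ) ∞ L) (c : AdaptedChart m n q)
    {p : P} (hp : (h.hamiltonianSection p).proj ∈ c.tot.source) :
    h.hamiltonCartan p = (-linearOmega (modelIncl m n)).compContinuousLinearMap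
      (mfderiv (𝓡 k) 𝓘(ℝ, (Euc m × Euc n) × ModelMM m n)
        (c.mmChart ∘ h.hamiltonianSection) p) := by
  have h1 := c.multisymplectic_eq hp
  have h2 := mfderiv_comp p ((c.contMDiffAt_mmChart hp).mdifferentiableAt (by simp))
    ((h.contMDiff_hamiltonianSection hη hL).contMDiffAt.mdifferentiableAt (by simp))
  rw [h2, IsAlmostRegular.hamiltonCartan, DForm.pullback, h1]
  rfl

theorem IsAlmostRegular.isSmooth_hamiltonCartan (h : IsAlmostRegular k η L ι FL₀)
    (hη : η.IsVolumeForm) (hL : ContMDiff (modelJ1 m n) 𝓘(ℝ, ℝ) ∞ L) :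
    h.hamiltonCartan.IsSmooth := by
  refine DForm.isSmooth_of_contDiffAt fun p => ?_
  let c := adaptedChartAt m n q (h.hamiltonianSection p).proj
  have hp : (h.hamiltonianSection p).proj ∈ c.tot.source := mem_adaptedChartAt m n q _
  refine DForm.contDiffAt_chartRep (b := fun _ => -linearOmega (modelIncl m n))
    (mem_chart_source _ p) (h.contMDiffAt_sectionCoord hη hL c hp) contMDiffAt_const ?_
  have ho : IsOpen {z : MM m n q | z.proj ∈ c.tot.source} := c.mmTriv.open_source
  filter_upwards [(h.contMDiff_hamiltonianSection hη hL).continuous.continuousAt.preimage_mem_nhds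
    (ho.mem_nhds hp)] with p' hp'
  exact h.hamiltonCartan_eq hη hL c hp'

/-- The Hamiltonian section covers κ, so its x-coordinates are the base coordinates of κ. Vectors
vertical for κ thus satisfy the hypothesis of `linearOmega_eq_zero`. -/
theorem IsAlmostRegular.mfderiv_sectionCoord (h : IsAlmostRegular k η L ι FL₀)
    (hη : η.IsVolumeForm) (hL : ContMDiff (modelJ1 m n) 𝓘(ℝ, ℝ) ∞ L) (c : AdaptedChart m n q)
    {p : P} (hp : (h.hamiltonianSection p).proj ∈ c.tot.source) (u : Euc k)
    (hu : (mfderiv (𝓡 k) (𝓡 m) (toBase m n q ι) p : Euc k →L[ℝ] Euc m) u = 0) :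
    ((mfderiv (𝓡 k) 𝓘(ℝ, (Euc m × Euc n) × ModelMM m n) (c.mmChart ∘ h.hamiltonianSection) p :
      Euc k →L[ℝ] (Euc m × Euc n) × ModelMM m n) u).1.1 = 0 := by
  let π : (Euc m × Euc n) × ModelMM m n →L[ℝ] Euc m :=
    (ContinuousLinearMap.fst ℝ (Euc m) (Euc n)).comp
      (ContinuousLinearMap.fst ℝ (Euc m × Euc n) (ModelMM m n))
  have h1 := mfderiv_comp p π.mdifferentiableAt
    ((h.contMDiffAt_sectionCoord hη hL c hp).mdifferentiableAt (by simp))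
  rw [ContinuousLinearMap.mfderiv_eq] at h1
  have hκ : toBase m n q ι p ∈ c.base.source := by
    rw [h.toBase_eq]
    exact c.mapsTo _ hp
  have h2 := mfderiv_comp p (c.base_mdifferentiable.mdifferentiableAt hκ)
    ((h.contMDiff_toBase hη hL).contMDiffAt.mdifferentiableAt (by simp))
  have h3 : mfderiv (𝓡 k) 𝓘(ℝ, Euc m) (π ∘ c.mmChart ∘ h.hamiltonianSection) p =
      mfderiv (𝓡 k) 𝓘(ℝ, Euc m) (c.base ∘ toBase m n q ι) p := by
    refine Filter.EventuallyEq.mfderiv_eq ?_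
    have ho : IsOpen {z : MM m n q | z.proj ∈ c.tot.source} := c.mmTriv.open_source
    filter_upwards [(h.contMDiff_hamiltonianSection hη hL).continuous.continuousAt.preimage_mem_nhds
      (ho.mem_nhds hp)] with p' hp'
    exact (c.fst_tot _ hp').trans (congrArg c.base (h.toBase_eq p').symm)
  have h4 := h1.symm.trans (h3.trans h2)
  have h5 := DFunLike.congr_fun h4 u
  refine h5.trans ?_
  exact (congrArg (c.baseFrame (toBase m n q ι p)) hu).trans (map_zero _)

end HamiltonCartan

/-! ### The splitting of the Hamilton–Cartan form -/

theorem mainTheorem10 {M E P : Type*} {m n k : ℕ} (hm : 1 < m)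
    [TopologicalSpace M] [T2Space M] [ParacompactSpace M] [ConnectedSpace M]
    [ChartedSpace (Euc m) M] [IsManifold (𝓡 m) ∞ M]
    [TopologicalSpace E] [T2Space E] [ParacompactSpace E] [ConnectedSpace E]
    [ChartedSpace (Euc (m + n)) E] [IsManifold (𝓡 (m + n)) ∞ E]
    (q : E → M) [IsSmoothFibreBundle m n q]
    (η : DForm (𝓡 m) M m) (hη : η.IsVolumeForm)
    (L : J1 m n q → ℝ) (hL : ContMDiff (modelJ1 m n) 𝓘(ℝ, ℝ) ∞ L)
    [TopologicalSpace P] [ChartedSpace (Euc k) P] [IsManifold (𝓡 k) ∞ P]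
    (ι : P → RMM m n q) (FL₀ : J1 m n q → P) (hAR : IsAlmostRegular k η L ι FL₀)
    (D : EhresmannConnection m k (toBase m n q ι)) :
    ContMDiff (𝓡 k) (modelMM m n) ∞ hAR.hamiltonianSection ∧
    (∀ z, hAR.hamiltonianSection (FL₀ z) = extendedLegendre η L z) ∧
    (D.contract η hAR.hamiltonCartan).IsSmooth ∧
    ∃ Ω' : DForm (𝓡 k) P (m + 1), Ω'.IsSmooth ∧ D.HasBidegree (m - 1) 2 Ω' ∧
      ∀ p, hAR.hamiltonCartan p = Ω' p +
        ((η.pullback (toBase m n q ι)).wedge (D.contract η hAR.hamiltonCartan)) p := by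
  have hκ := hAR.contMDiff_toBase hη hL
  have hΩ := hAR.isSmooth_hamiltonCartan hη hL
  have hγ := D.isSmooth_contract hη hκ hΩ
  -- The component Ω' is taken to be the difference, so the decomposition is automatic and only its
  -- bidegree needs an argument.
  refine ⟨hAR.contMDiff_hamiltonianSection hη hL,
    hAR.hamiltonianSection_apply hη.ne_zero hL, hγ, fun p => hAR.hamiltonCartan p -
      ((η.pullback (toBase m n q ι)).wedge (D.contract η hAR.hamiltonCartan)) p,
    hΩ.sub_wedge (hη.isSmooth.pullback hκ) hγ, fun p => ?_, fun p => (sub_add_cancel _ _).symm⟩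
  let c := adaptedChartAt m n q (hAR.hamiltonianSection p).proj
  have hp : (hAR.hamiltonianSection p).proj ∈ c.tot.source := mem_adaptedChartAt m n q _
  refine hasBidegree_sub_wedgeOne (V := Euc k) hm
    (K := mfderiv (𝓡 k) (𝓡 m) (toBase m n q ι) p) (Λ := D.lift p)
    (η := η (toBase m n q ι p)) (Ω := hAR.hamiltonCartan p)
    (γ := D.contract η hAR.hamiltonCartan p)
    (fun u => DFunLike.congr_fun (D.mfderiv_comp_lift p) u)
    (fun w u => D.contract_mul (hη.ne_zero _) w fun _ => u) (fun w S hS hw => ?_)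
  -- It remains to see that the Hamilton–Cartan form vanishes on three vertical vectors, which is
  -- checked in Darboux coordinates.
  have h1 := DFunLike.congr_fun (hAR.hamiltonCartan_eq hη hL c hp) w
  refine h1.trans (neg_eq_zero.2 ?_)
  exact linearOmega_eq_zero _ hS fun i hi =>
    hAR.mfderiv_sectionCoord hη hL c hp (w i) (hw i hi)
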